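/- **Theorem 2.3.** Let $p\ge 1$. All matrices below are real $p\times p$; $X>0$ means that $X$ is symmetric positive definite, $X<Y$ means $Y-X>0$, $|X|$ is the determinant, $X^{1/2}$ is the positive definite square root, and $\int_{Z>0}f(Z)\,dZ$ is the integral over the positive definite symmetric matrices with respect to $dZ=\prod_{i\le j}dz_{ij}$. Put $$\Gamma_p(a)=\pi^{p(p-1)/4}\prod_{i=1}^{p}\Gamma\left(a-\tfrac{i-1}{2}\right).$$ For $S>0$ and $\alpha,\beta\in\mathbb C$ with $\mathrm{Re}(\beta-\alpha)>\frac{p-3}{4}$, the Whittaker function $W_{\alpha,\beta}(S)$ is defined by $$\int_{X>0}|X|^{\beta-\alpha-\frac{p+1}{4}}\,|I+X|^{\alpha+\beta-\frac{p+1}{4}}\,e^{-\mathrm{tr}(SX)}\,dX=|S|^{-\beta-\frac{p+1}{4}}\,\Gamma_p\left(\beta-\alpha+\tfrac{p+1}{4}\right)e^{\frac12\mathrm{tr}(S)}\,W_{\alpha,\beta}(S),$$ and $W_{\alpha,\beta}(BZ)$ stands for $W_{\alpha,\beta}(B^{1/2}ZB^{1/2})$. For a real symmetric $X$ of spectral norm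 $\|X\|<1$, $${}_2F_1(a,b;c;X)=\sum_{k\ge0}\ \sum_{\kappa}\frac{(a)_\kappa(b)_\kappa}{(c)_\kappa}\frac{C_\kappa(X)}{k!},\qquad (a)_\kappa=\prod_{i=1}^p\left(a-\tfrac{i-1}{2}\right)_{k_i},$$ where $\kappa=(k_1\ge\dots\ge k_p\ge0)$ runs over the partitions of $k$ into at most $p$ parts. Here $(x)_n=x(x+1)\cdots(x+n-1)$, and the $C_\kappa$ are the zonal polynomials normalized by $\sum_{\kappa}C_\kappa(X)=(\mathrm{tr}\,X)^k$ for each $k$: $C_\kappa(X)$ is a constant multiple of $\int_{O(p)}\prod_{j=1}^{p}|(HXH')_j|^{k_j-k_{j+1}}\,dH$, where $(Y)_j$ is the leading principal $j\times j$ submatrix of $Y$, $k_{p+1}=0$, and $dH$ is the Haar probability measure on the orthogonal group $O(p)$. Let $A>0$, $B>0$, and let $\alpha,\beta,\gamma\in\mathbb C$ satisfy $\mathrm{Re}(\gamma+\beta)>\frac{p-3}{4}$, $\mathrm{Re}(\gamma-\beta)>\frac{p-3}{4}$ and $\mathrm{Re}(\beta-\alpha)>\frac{p-3}{4}$. Then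 the integral $$J=\int_{Z>0}|Z|^{\gamma-\frac{p+1}{2}}\,e^{-\mathrm{tr}(AZ)}\,W_{\alpha,\beta}(BZ)\,dZ$$ converges absolutely, and the following hold; in each formula the outer series over $k$ defining ${}_2F_1$ converges absolutely. 1. If $0<B^{1/2}(A+\frac12B)^{-1}B^{1/2}<I$ or $2B^{-1/2}AB^{-1/2}>I$, then $$J=|B|^{\beta+\frac{p+1}{4}}\left|A+\tfrac12B\right|^{-\left(\gamma+\beta+\frac{p+1}{4}\right)}\frac{\Gamma_p\left(\gamma+\beta+\frac{p+1}{4}\right)\Gamma_p\left(\gamma-\beta+\frac{p+1}{4}\right)}{\Gamma_p\left(\gamma-\alpha+\frac{p+1}{2}\right)}$$ $$\times\,{}_2F_1\left(\tfrac{p+1}{4}+\beta-\alpha,\ \tfrac{p+1}{4}+\gamma+\beta;\ \tfrac{p+1}{2}+\gamma-\alpha;\ I-B^{1/2}\left(A+\tfrac12B\right)^{-1}B^{1/2}\right).\tag{2.8}$$ 2. Let $C=B^{-1/2}AB^{-1/2}-\frac12I$. If $\|C\|<1$ (spectral norm), then $$J=|B|^{-\gamma}\,\frac{\Gamma_p\left(\frac{p+1}{4}+\gamma+\beta\right)\Gamma_p\left(\frac{p+1}{4}+\gamma-\beta\right)}{\Gamma_p\left(\frac{p+1}{2}+\gamma-\alpha\right)}\,{}_2F_1\left(\tfrac{p+1}{4}+\gamma-\beta,\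 \tfrac{p+1}{4}+\gamma+\beta;\ \tfrac{p+1}{2}+\gamma-\alpha;\ -C\right).\tag{2.9}$$ 3. The condition $\|C\|<1$ holds whenever $0<C<I$ or $0<-C<I$. -/

import Mathlib

open MeasureTheory
open scoped MatrixOrder

/-- The symmetric `p × p` matrix whose entries on and above the diagonal are the `p(p+1)/2`
coordinates `z`. -/
def symOf {p : ℕ} (z : {q : Fin p × Fin p // q.1 ≤ q.2} → ℝ) : Matrix (Fin p) (Fin p) ℝ :=
  Matrix.of fun i j => z ⟨(min i j, max i j), min_le_max⟩

/-- The coordinates of the open cone of positive definite symmetric matrices. -/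
def posCone (p : ℕ) : Set ({q : Fin p × Fin p // q.1 ≤ q.2} → ℝ) :=
  {z | (symOf z).PosDef}

/-- `∫_{Z>0} f(Z) dZ`, with `dZ = ∏_{i ≤ j} dz_{ij}` (Lebesgue measure in the distinct entries). -/
noncomputable def posInt {p : ℕ} (f : Matrix (Fin p) (Fin p) ℝ → ℂ) : ℂ :=
  ∫ z in posCone p, f (symOf z)

/-- Absolute convergence of `∫_{Z>0} f(Z) dZ`. -/
def PosIntegrable {p : ℕ} (f : Matrix (Fin p) (Fin p) ℝ → ℂ) : Prop :=
  IntegrableOn (fun z => f (symOf z)) (posCone p)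

/-- The determinant power `|Z|^s`, complex exponent (used for `Z > 0`). -/
noncomputable def detPow {p : ℕ} (Z : Matrix (Fin p) (Fin p) ℝ) (s : ℂ) : ℂ :=
  (Z.det : ℂ) ^ s

/-- The exponential trace `e^{tr X}`. -/
noncomputable def etr {p : ℕ} (X : Matrix (Fin p) (Fin p) ℝ) : ℂ :=
  Complex.exp (X.trace : ℂ)

/-- The real matrix-variate gamma function
`Γ_p(a) = π^{p(p-1)/4} Γ(a) Γ(a - 1/2) ⋯ Γ(a - (p-1)/2)`. -/
noncomputable def gammaP (p : ℕ) (a : ℂ) : ℂ :=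
  (Real.pi : ℂ) ^ ((p : ℂ) * ((p : ℂ) - 1) / 4) *
    ∏ i : Fin p, Complex.Gamma (a - ((i : ℕ) : ℂ) / 2)

/-- `M(μ, ν; A) = ∫_{X>0} |X|^{μ-(p+1)/2} |I+X|^{ν-(p+1)/2} e^{-tr(AX)} dX`. -/
noncomputable def confluentM {p : ℕ} (μ ν : ℂ) (A : Matrix (Fin p) (Fin p) ℝ) : ℂ :=
  posInt fun X : Matrix (Fin p) (Fin p) ℝ =>
    detPow X (μ - ((p : ℂ) + 1) / 2) * detPow (1 + X) (ν - ((p : ℂ) + 1) / 2) * etr (-(A * X))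

/-- The Whittaker function `W_{α,β}(A)` of a positive definite matrix argument, i.e. the solution of
`M(μ, ν; A) = |A|^{-(μ+ν)/2} Γ_p(μ) e^{tr(A)/2} W_{α,β}(A)` where `α = (ν-μ)/2` and
`β = (ν+μ-(p+1)/2)/2`, that is, `μ = β - α + (p+1)/4` and `ν = β + α + (p+1)/4`. -/
noncomputable def whittakerW {p : ℕ} (α β : ℂ) (A : Matrix (Fin p) (Fin p) ℝ) : ℂ :=
  detPow A (β + ((p : ℂ) + 1) / 4) * etr (-((1 / 2 : ℝ) • A)) *
    confluentM (β - α + ((p : ℂ) + 1) / 4) (β + α + ((p : ℂ) + 1) / 4) A /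
      gammaP p (β - α + ((p : ℂ) + 1) / 4)

/-! ### Zonal polynomials and the Gauss hypergeometric function of matrix argument -/

/-- The orthogonal group is compact. -/
instance orthogonalGroup_compactSpace (p : ℕ) :
    CompactSpace (Matrix.orthogonalGroup (Fin p) ℝ) := by
  suffices h : IsCompact {U : Matrix (Fin p) (Fin p) ℝ | U ∈ Matrix.orthogonalGroup (Fin p) ℝ} from
    isCompact_iff_compactSpace.mp h
  have hK : IsCompact (Set.pi Set.univ fun _ : Fin p =>
      Set.pi Set.univ fun _ : Fin p => Set.Icc (-1 : ℝ) 1) :=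
    isCompact_univ_pi fun _ => isCompact_univ_pi fun _ => isCompact_Icc
  have hcl : IsClosed {U : Matrix (Fin p) (Fin p) ℝ | U * U.transpose = 1} :=
    isClosed_eq (by fun_prop) continuous_const
  refine IsCompact.of_isClosed_subset hK ?_ ?_
  · convert hcl using 1
    ext U
    exact Matrix.mem_orthogonalGroup_iff (Fin p) ℝ
  · intro U hU i _ j _
    have := entry_norm_bound_of_unitary (𝕜 := ℝ) hU i j
    exact abs_le.mp this

instance orthogonalGroup_measurableSpace (p : ℕ) :
    MeasurableSpace (Matrix.orthogonalGroup (Fin p) ℝ) := borel _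

instance orthogonalGroup_borelSpace (p : ℕ) :
    BorelSpace (Matrix.orthogonalGroup (Fin p) ℝ) := ⟨rfl⟩

/-- The Haar probability measure on the orthogonal group `O(p)`. -/
noncomputable def orthHaar (p : ℕ) : Measure (Matrix.orthogonalGroup (Fin p) ℝ) :=
  Measure.haarMeasure ⊤

open Classical in
/-- The partitions `κ = (k_1 ≥ ⋯ ≥ k_p ≥ 0)` of `k` into at most `p` parts. -/
noncomputable def partsOf (p k : ℕ) : Finset (Fin p → ℕ) :=
  (Finset.piAntidiag Finset.univ k).filter Antitone

/-- The determinant of the leading principal `(j+1) × (j+1)` submatrix, `j = 0, …, p-1`. -/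
def leadingMinor {p : ℕ} (X : Matrix (Fin p) (Fin p) ℝ) (j : Fin p) : ℝ :=
  (X.submatrix (Fin.castLE (Nat.succ_le_of_lt j.isLt)) (Fin.castLE (Nat.succ_le_of_lt j.isLt))).det

/-- The generalized power `Δ_κ(X) = |X_1|^{k_1-k_2} |X_2|^{k_2-k_3} ⋯ |X_p|^{k_p}`, where `X_j` is
the leading principal `j × j` submatrix. -/
noncomputable def genPow {p : ℕ} (κ : Fin p → ℕ) (X : Matrix (Fin p) (Fin p) ℝ) : ℝ :=
  ∏ j : Fin p, leadingMinor X j ^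
    (κ j - if h : (j : ℕ) + 1 < p then κ ⟨(j : ℕ) + 1, h⟩ else 0)

/-- The spherical polynomial `Φ_κ(X) = ∫_{O(p)} Δ_κ(H X H') dH`; it equals `C_κ(X) / C_κ(I)`. -/
noncomputable def sphericalPoly {p : ℕ} (κ : Fin p → ℕ) (X : Matrix (Fin p) (Fin p) ℝ) : ℝ :=
  ∫ H : Matrix.orthogonalGroup (Fin p) ℝ,
    genPow κ ((H : Matrix (Fin p) (Fin p) ℝ) * X * (H : Matrix (Fin p) (Fin p) ℝ).transpose)
      ∂(orthHaar p)

/-- The normalization `∑_{|κ|=k} C_κ(X) = (tr X)^k` of the zonal polynomials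
`C_κ = c κ • Φ_κ` of degree `k`. -/
def IsZonalNormalization (p k : ℕ) (c : (Fin p → ℕ) → ℝ) : Prop :=
  ∀ X : Matrix (Fin p) (Fin p) ℝ, X.IsSymm →
    ∑ κ ∈ partsOf p k, c κ * sphericalPoly κ X = X.trace ^ k

/-- The values `C_κ(I)`, `|κ| = k`: the coefficients in the expansion of `(tr X)^k` in the
(linearly independent) spherical polynomials of degree `k`. -/
noncomputable def zonalCoeff (p k : ℕ) : (Fin p → ℕ) → ℝ :=
  Classical.epsilon (IsZonalNormalization p k)

/-- The zonal polynomial `C_κ(X)` of a real symmetric matrix, normalized by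
`∑_{|κ|=k} C_κ(X) = (tr X)^k`. -/
noncomputable def zonal {p : ℕ} (κ : Fin p → ℕ) (X : Matrix (Fin p) (Fin p) ℝ) : ℝ :=
  zonalCoeff p (∑ i, κ i) κ * sphericalPoly κ X

/-- The generalized Pochhammer symbol `(a)_κ = ∏_{i=1}^p (a - (i-1)/2)_{k_i}`. -/
noncomputable def pochP {p : ℕ} (a : ℂ) (κ : Fin p → ℕ) : ℂ :=
  ∏ i : Fin p, (ascPochhammer ℂ (κ i)).eval (a - ((i : ℕ) : ℂ) / 2)

/-- The degree `k` part of the zonal series of `₂F₁(a, b; c; X)`. -/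
noncomputable def hypTerm {p : ℕ} (a b c : ℂ) (X : Matrix (Fin p) (Fin p) ℝ) (k : ℕ) : ℂ :=
  ∑ κ ∈ partsOf p k, pochP a κ * pochP b κ / pochP c κ * (zonal κ X : ℂ) / (k.factorial : ℂ)

/-- The Gauss hypergeometric function of a real symmetric matrix argument,
`₂F₁(a, b; c; X) = ∑_{k ≥ 0} ∑_{|κ|=k} (a)_κ (b)_κ / (c)_κ · C_κ(X) / k!` (for `‖X‖ < 1`). -/
noncomputable def hyp2F1 {p : ℕ} (a b c : ℂ) (X : Matrix (Fin p) (Fin p) ℝ) : ℂ :=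
  ∑' k : ℕ, hypTerm a b c X k

/-- The positive semidefinite square root `B^{1/2}`. -/
noncomputable def msqrt {p : ℕ} (B : Matrix (Fin p) (Fin p) ℝ) : Matrix (Fin p) (Fin p) ℝ :=
  CFC.sqrt B

/-- The spectral norm, i.e. the operator norm for the Euclidean norm on `ℝ^p`. -/
noncomputable def specNorm {p : ℕ} (C : Matrix (Fin p) (Fin p) ℝ) : ℝ :=
  ‖Matrix.toEuclideanCLM (n := Fin p) (𝕜 := ℝ) C‖

/-- `B^{-1/2} A B^{-1/2}`. -/
noncomputable def conjInvSqrt {p : ℕ} (A B : Matrix (Fin p) (Fin p) ℝ) :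
    Matrix (Fin p) (Fin p) ℝ :=
  (msqrt B)⁻¹ * A * (msqrt B)⁻¹

/-- `B^{1/2} (A + B/2)^{-1} B^{1/2}`. -/
noncomputable def shiftD {p : ℕ} (A B : Matrix (Fin p) (Fin p) ℝ) : Matrix (Fin p) (Fin p) ℝ :=
  msqrt B * (A + (1 / 2 : ℝ) • B)⁻¹ * msqrt B

/-- `C = B^{-1/2} A B^{-1/2} - I/2`. -/
noncomputable def shiftC {p : ℕ} (A B : Matrix (Fin p) (Fin p) ℝ) : Matrix (Fin p) (Fin p) ℝ :=
  conjInvSqrt A B - (1 / 2 : ℝ) • 1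

/-- The integrand `|Z|^{γ-(p+1)/2} e^{-tr(AZ)} W_{α,β}(BZ)`. As usual for functions of the
eigenvalues, `W_{α,β}(BZ)` stands for `W_{α,β}(B^{1/2} Z B^{1/2})`, whose argument is symmetric
with the eigenvalues of `BZ`. -/
noncomputable def laplaceIntegrand {p : ℕ} (A B : Matrix (Fin p) (Fin p) ℝ) (α β γ : ℂ)
    (Z : Matrix (Fin p) (Fin p) ℝ) : ℂ :=
  detPow Z (γ - ((p : ℂ) + 1) / 2) * etr (-(A * Z)) * whittakerW α β (msqrt B * Z * msqrt B)

/-! ### The Lebesgue measure of the cone of positive definite matrices -/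

/-! Put `b = γ+β+(p+1)/4`, `μ = β-α+(p+1)/4`, `c = γ-α+(p+1)/2`. Substituting `Z = B^{-1/2} Y
B^{-1/2}` and writing out the Whittaker function turns `J` into `|B|^{-γ} Γ_p(μ)⁻¹` times the
integral of `|Y|^{b-(p+1)/2} e^{-tr(DY)} M(μ,ν;Y)`, where `D = I + C`: the factor `e^{-tr/2}` inside
`W` supplies the missing `I/2` (`laplaceIntegrand_conj`). Both formulas are statements about this
Laplace transform of the confluent function `M`.

At `D = I` the integrand is a function `h(Y)` of the eigenvalues of `Y`. For `D = I - N` with `‖N‖ <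
1` the additional factor is `e^{tr(NY)}`. Expand it in powers of `tr(NY)`. Since `h` and `dY` are
invariant under `O(p)`, each power may be replaced by its average over rotations, which is `∑ C_κ(N)
Φ_κ(Y)` by the normalization of the zonal polynomials and the functional equation of spherical
functions (`integral_trace_pow_orthConj`). Invariance also lets `Φ_κ` be replaced by the generalized
power `Δ_κ`. Dominated convergence with majorant `|h| e^{‖N‖ tr Y}` justifies the expansion and
gives absolute convergence of the series in `k` (`hasSum_zonal_laplace`).

The coefficients `∫ h Δ_κ` are explicit. By Fubini, `Y` is integrated first: the Laplace transform
of a generalized power (`laplace_gen`) produces `Γ_p(b) (b)_κ`. What remains is a beta integral of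
the second kind (`beta_integral`), which produces `Γ_p(μ) Γ_p(c-μ) (c-μ)_κ / (Γ_p(c) (c)_κ)`. Hence
the Laplace transform is a multiple of `₂F₁(c-μ, b; c; N)` (`hasSum_hypTerm`), and `N = -C` is the
second formula. The substitution `X ↦ X⁻¹` in the integral defining `M` exchanges `μ` with `c-μ` and
`D` with `D⁻¹` (`integral_confluentDensity_inv`); then `N = I - D⁻¹` is the first formula.

Two foundations are built from scratch. The gamma integral `gamma_integral` goes by induction on
`p`, splitting off the first row by a Schur complement. The zonal normalization exists
(`exists_isZonalNormalization`) because the spherical polynomials of degree `k` are linearly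
independent and lie in the space of symmetric forms spanned by as many monomial symmetric functions.
-/

instance matrixMeasurableSpace (m n : ℕ) : MeasurableSpace (Matrix (Fin m) (Fin n) ℝ) :=
  inferInstanceAs (MeasurableSpace (Fin m → Fin n → ℝ))

instance matrixBorelSpace (m n : ℕ) : BorelSpace (Matrix (Fin m) (Fin n) ℝ) :=
  inferInstanceAs (BorelSpace (Fin m → Fin n → ℝ))

instance matrixSecondCountable (m n : ℕ) : SecondCountableTopology (Matrix (Fin m) (Fin n) ℝ) :=
  inferInstanceAs (SecondCountableTopology (Fin m → Fin n → ℝ))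

/-- The coordinates of a symmetric `p × p` matrix. -/
abbrev SymCoord (p : ℕ) : Type := {q : Fin p × Fin p // q.1 ≤ q.2} → ℝ

/-- The entries on and above the diagonal. -/
def upperOf {p : ℕ} (X : Matrix (Fin p) (Fin p) ℝ) : SymCoord p := fun q => X q.1.1 q.1.2

lemma upperOf_symOf {p : ℕ} (z : SymCoord p) : upperOf (symOf z) = z := by
  ext ⟨⟨i, j⟩, h⟩
  simp only at h
  simp [upperOf, symOf, min_eq_left h, max_eq_right h]

lemma symOf_injective (p : ℕ) : Function.Injective (symOf (p := p)) :=
  Function.LeftInverse.injective upperOf_symOf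

lemma symOf_upperOf {p : ℕ} {X : Matrix (Fin p) (Fin p) ℝ} (hX : X.IsSymm) :
    symOf (upperOf X) = X := by
  ext i j
  rcases le_total i j with h | h
  · simp [upperOf, symOf, h]
  · simpa [upperOf, symOf, h] using hX.apply i j

lemma symOf_isSymm {p : ℕ} (z : SymCoord p) : (symOf z).IsSymm := by
  ext i j
  simp [symOf, min_comm, max_comm]

/-- `symOf` as a linear map. -/
def symLin (p : ℕ) : SymCoord p →ₗ[ℝ] Matrix (Fin p) (Fin p) ℝ where
  toFun := symOf
  map_add' x y := by ext; simp [symOf]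
  map_smul' c x := by ext; simp [symOf]

/-- `upperOf` as a linear map. -/
def upperLin (p : ℕ) : Matrix (Fin p) (Fin p) ℝ →ₗ[ℝ] SymCoord p where
  toFun := upperOf
  map_add' _ _ := rfl
  map_smul' _ _ := rfl

lemma continuous_symOf (p : ℕ) : Continuous (symOf (p := p)) :=
  (symLin p).continuous_of_finiteDimensional

lemma continuous_upperOf (p : ℕ) : Continuous (upperOf (p := p)) :=
  continuous_pi fun q => (continuous_apply q.1.2).comp (continuous_apply q.1.1)

/-- An injective linear map out of a finite-dimensional space is a closed embedding. In this form
integrals move to the image measure without any measurability assumption on the integrand. -/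
lemma measurableEmbedding_symOf (p : ℕ) : MeasurableEmbedding (symOf (p := p)) :=
  ((symLin p).isClosedEmbedding_of_injective
    (LinearMap.ker_eq_bot.2 (symOf_injective p))).measurableEmbedding

lemma isSymm_iff_isHermitian_real {p : ℕ} {X : Matrix (Fin p) (Fin p) ℝ} :
    X.IsHermitian ↔ X.IsSymm := by
  rw [Matrix.IsHermitian, Matrix.conjTranspose_eq_transpose_of_trivial, Matrix.IsSymm]

lemma Matrix.PosDef.isSymm {p : ℕ} {X : Matrix (Fin p) (Fin p) ℝ} (hX : X.PosDef) : X.IsSymm :=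
  isSymm_iff_isHermitian_real.1 hX.1

/-- The positive definite matrices are the closed semidefinite cone intersected with the open set of
invertible matrices. -/
lemma measurableSet_posDef (p : ℕ) : MeasurableSet {X : Matrix (Fin p) (Fin p) ℝ | X.PosDef} := by
  have h : {X : Matrix (Fin p) (Fin p) ℝ | X.PosDef} =
      {X | X.PosSemidef} ∩ {X | X.det ≠ 0} := by
    ext X
    constructor
    · exact fun h => ⟨Matrix.PosDef.posSemidef h, (Matrix.PosDef.det_pos h).ne'⟩
    · exact fun h => (Matrix.PosSemidef.posDef_iff_det_ne_zero h.1).2 h.2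
  have hc : IsClosed {X : Matrix (Fin p) (Fin p) ℝ | X.PosSemidef} := by
    have : {X : Matrix (Fin p) (Fin p) ℝ | X.PosSemidef} =
        {X | X.transpose = X} ∩ ⋂ x : Fin p → ℝ, {X | 0 ≤ x ⬝ᵥ X.mulVec x} := by
      ext X
      simp [Matrix.posSemidef_iff_dotProduct_mulVec, Matrix.IsSymm]
    rw [this]
    refine (isClosed_eq (by fun_prop) (by fun_prop)).inter
      (isClosed_iInter fun x => isClosed_le continuous_const ?_)
    exact continuous_const.dotProduct (continuous_id.matrix_mulVec continuous_const)
  rw [h]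
  refine hc.measurableSet.inter (IsOpen.measurableSet ?_)
  exact isOpen_ne_fun (by fun_prop) continuous_const

lemma measurableSet_posCone (p : ℕ) : MeasurableSet (posCone p) :=
  (continuous_symOf p).measurable (measurableSet_posDef p)

/-- The measure `dZ` on the cone of positive definite matrices. -/
noncomputable def posMeasure (p : ℕ) : Measure (Matrix (Fin p) (Fin p) ℝ) :=
  ((volume : Measure (SymCoord p)).restrict (posCone p)).map symOf

instance (p : ℕ) : SFinite (posMeasure p) := by unfold posMeasure; infer_instance

lemma posInt_eq {p : ℕ} (f : Matrix (Fin p) (Fin p) ℝ → ℂ) :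
    posInt f = ∫ Z, f Z ∂posMeasure p :=
  ((measurableEmbedding_symOf p).integral_map f).symm

lemma posIntegrable_iff {p : ℕ} (f : Matrix (Fin p) (Fin p) ℝ → ℂ) :
    PosIntegrable f ↔ Integrable f (posMeasure p) :=
  (measurableEmbedding_symOf p).integrable_map_iff.symm

lemma ae_posDef (p : ℕ) : ∀ᵐ Z ∂posMeasure p, Z.PosDef := by
  unfold posMeasure
  rw [(measurableEmbedding_symOf p).ae_map_iff]
  exact ae_restrict_mem (measurableSet_posCone p)

/-! ### Linear substitutions -/

/-- The substitution `X ↦ G X Gᵀ` in coordinates. -/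
def conjLin {p : ℕ} (G : Matrix (Fin p) (Fin p) ℝ) : SymCoord p →ₗ[ℝ] SymCoord p :=
  upperLin p ∘ₗ (LinearMap.mulRight ℝ G.transpose ∘ₗ LinearMap.mulLeft ℝ G) ∘ₗ symLin p

lemma Matrix.IsSymm.conj {p : ℕ} {X : Matrix (Fin p) (Fin p) ℝ} (hX : X.IsSymm)
    (G : Matrix (Fin p) (Fin p) ℝ) : (G * X * G.transpose).IsSymm := by
  rw [Matrix.IsSymm, Matrix.transpose_mul, Matrix.transpose_mul, Matrix.transpose_transpose, hX.eq,
    Matrix.mul_assoc]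

lemma symOf_conjLin {p : ℕ} (G : Matrix (Fin p) (Fin p) ℝ) (z : SymCoord p) :
    symOf (conjLin G z) = G * symOf z * G.transpose :=
  symOf_upperOf ((symOf_isSymm z).conj G)

lemma conjLin_mul {p : ℕ} (G H : Matrix (Fin p) (Fin p) ℝ) :
    conjLin (G * H) = conjLin G ∘ₗ conjLin H := by
  refine LinearMap.ext fun z => symOf_injective p ?_
  rw [LinearMap.comp_apply, symOf_conjLin, symOf_conjLin, symOf_conjLin, Matrix.transpose_mul]
  simp only [Matrix.mul_assoc]

lemma conjLin_one (p : ℕ) : conjLin (1 : Matrix (Fin p) (Fin p) ℝ) = LinearMap.id := by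
  refine LinearMap.ext fun z => symOf_injective p ?_
  simp [symOf_conjLin]

/-- The index `i` occurs `p - i` times as a row and `i + 1` times as a column of an upper triangular
position, hence `p + 1` times in all. -/
lemma prod_subtype_le_mul {p : ℕ} (d : Fin p → ℝ) :
    ∏ q : {q : Fin p × Fin p // q.1 ≤ q.2}, d q.1.1 * d q.1.2 = (∏ i, d i) ^ (p + 1) := by
  rw [← Finset.prod_subtype (Finset.univ.filter fun q : Fin p × Fin p => q.1 ≤ q.2) (by simp)
    fun q => d q.1 * d q.2, Finset.prod_mul_distrib]
  have h1 : ∏ q : Fin p × Fin p with q.1 ≤ q.2, d q.1 = ∏ i, d i ^ (p - (i : ℕ)) := by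
    rw [Finset.prod_filter, Fintype.prod_prod_type]
    refine Finset.prod_congr rfl fun i _ => ?_
    rw [← Finset.prod_filter]
    simp only [Finset.prod_const]
    simp [Finset.filter_le_eq_Ici]
  have h2 : ∏ q : Fin p × Fin p with q.1 ≤ q.2, d q.2 = ∏ i, d i ^ ((i : ℕ) + 1) := by
    rw [Finset.prod_filter, Fintype.prod_prod_type_right]
    refine Finset.prod_congr rfl fun i _ => ?_
    rw [← Finset.prod_filter]
    simp only [Finset.prod_const]
    simp [Finset.filter_ge_eq_Iic]
  rw [h1, h2, ← Finset.prod_mul_distrib, ← Finset.prod_pow]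
  refine Finset.prod_congr rfl fun i _ => ?_
  rw [← pow_add]
  congr 1
  omega

lemma det_conjLin_diagonal {p : ℕ} (d : Fin p → ℝ) :
    LinearMap.det (conjLin (Matrix.diagonal d)) = (∏ i, d i) ^ (p + 1) := by
  rw [← prod_subtype_le_mul, ← LinearMap.det_toMatrix', ← Matrix.det_diagonal]
  congr 1
  ext q r
  rw [LinearMap.toMatrix'_apply]
  have h : ∀ z : SymCoord p, conjLin (Matrix.diagonal d) z q = d q.1.1 * d q.1.2 * z q := by
    intro z
    have h1 := congrFun (congrFun (symOf_conjLin (Matrix.diagonal d) z) q.1.1) q.1.2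
    have h2 := congrFun (upperOf_symOf (conjLin (Matrix.diagonal d) z)) q
    have h3 := congrFun (upperOf_symOf z) q
    rw [upperOf] at h2 h3
    rw [← h2, h1, ← h3, Matrix.diagonal_transpose, Matrix.mul_diagonal, Matrix.diagonal_mul]
    ring
  rw [h, Matrix.diagonal_apply]
  simp [Pi.single_apply]

/-- The determinant `f(c)` is multiplicative in `c`, so `f(2c) = f(c)²`. Conjugation by the diagonal
matrix with a `2` in position `i` turns `c` into `2c` without changing the determinant. Thus `f(c) =
f(c)²`, and `f(c) ≠ 0`. -/
lemma det_conjLin_transvection {p : ℕ} {i j : Fin p} (hij : i ≠ j) (c : ℝ) :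
    LinearMap.det (conjLin (Matrix.transvection i j c)) = 1 := by
  have hmul : ∀ G H : Matrix (Fin p) (Fin p) ℝ, LinearMap.det (conjLin (G * H)) =
      LinearMap.det (conjLin G) * LinearMap.det (conjLin H) := fun G H => by
    rw [conjLin_mul, LinearMap.det_comp]
  have hadd : ∀ c c' : ℝ, LinearMap.det (conjLin (Matrix.transvection i j (c + c'))) =
      LinearMap.det (conjLin (Matrix.transvection i j c)) *
        LinearMap.det (conjLin (Matrix.transvection i j c')) := fun c c' => by
    rw [← hmul, Matrix.transvection_mul_transvection_same _ _ hij]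
  have hne : LinearMap.det (conjLin (Matrix.transvection i j c)) ≠ 0 := by
    have h := hadd c (-c)
    rw [add_neg_cancel, Matrix.transvection_zero, conjLin_one, LinearMap.det_id] at h
    exact left_ne_zero_of_mul (h ▸ one_ne_zero)
  set d : Fin p → ℝ := fun k => if k = i then 2 else 1 with hd
  have hcomm : Matrix.diagonal d * Matrix.transvection i j c =
      Matrix.transvection i j (c + c) * Matrix.diagonal d := by
    ext k l
    rw [Matrix.diagonal_mul, Matrix.mul_diagonal]
    simp only [Matrix.transvection, Matrix.add_apply, Matrix.one_apply, Matrix.single_apply, hd]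
    by_cases h1 : k = i <;> by_cases h2 : l = i <;> by_cases h3 : j = l <;>
      by_cases h4 : k = l <;> (simp_all [eq_comm]; try ring)
  have hdet := congrArg (fun M => LinearMap.det (conjLin M)) hcomm
  simp only [hmul, hadd] at hdet
  have hdne : LinearMap.det (conjLin (Matrix.diagonal d)) ≠ 0 := by
    rw [det_conjLin_diagonal]
    exact pow_ne_zero _ (Finset.prod_ne_zero_iff.2 fun k _ => by simp only [hd]; split_ifs <;> norm_num)
  rw [mul_comm] at hdet
  have := mul_right_cancel₀ hdne hdet
  exact (mul_right_cancel₀ hne (by rw [one_mul]; exact this)).symm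

/-- The Jacobian of `X ↦ G X Gᵀ` on symmetric matrices. -/
lemma det_conjLin {p : ℕ} (G : Matrix (Fin p) (Fin p) ℝ) (hG : G.det ≠ 0) :
    LinearMap.det (conjLin G) = G.det ^ (p + 1) := by
  refine Matrix.diagonal_transvection_induction_of_det_ne_zero
    (fun G => LinearMap.det (conjLin G) = G.det ^ (p + 1)) G hG (fun d _ => ?_) (fun t => ?_)
    fun A B hA hB iA iB => ?_
  · rw [det_conjLin_diagonal, Matrix.det_diagonal]
  · rw [Matrix.TransvectionStruct.toMatrix, det_conjLin_transvection t.hij,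
      Matrix.det_transvection_of_ne _ _ t.hij, one_pow]
  · rw [conjLin_mul, LinearMap.det_comp, iA, iB, Matrix.det_mul, mul_pow]

lemma posDef_conj_iff {p : ℕ} {G X : Matrix (Fin p) (Fin p) ℝ} (hG : G.det ≠ 0) :
    (G * X * G.transpose).PosDef ↔ X.PosDef := by
  have hu : IsUnit G := (Matrix.isUnit_iff_isUnit_det G).2 (isUnit_iff_ne_zero.2 hG)
  have := Matrix.IsUnit.posDef_star_right_conjugate_iff (x := X) hu
  rwa [Matrix.star_eq_conjTranspose, Matrix.conjTranspose_eq_transpose_of_trivial] at this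

lemma measurable_conj {p : ℕ} (G : Matrix (Fin p) (Fin p) ℝ) :
    Measurable fun Z : Matrix (Fin p) (Fin p) ℝ => G * Z * G.transpose :=
  Continuous.measurable (by fun_prop)

/-- The image of `dZ` under `Z ↦ G Z Gᵀ`. -/
lemma map_conj_posMeasure {p : ℕ} {G : Matrix (Fin p) (Fin p) ℝ} (hG : G.det ≠ 0) :
    (posMeasure p).map (fun Z => G * Z * G.transpose) =
      ENNReal.ofReal (|G.det| ^ (p + 1))⁻¹ • posMeasure p := by
  have hdet : LinearMap.det (conjLin G) ≠ 0 := by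
    rw [det_conjLin G hG]; exact pow_ne_zero _ hG
  have hm : Measurable (conjLin G) := (conjLin G).continuous_of_finiteDimensional.measurable
  have hpre : posCone p = conjLin G ⁻¹' posCone p := by
    ext z
    simp [posCone, symOf_conjLin, posDef_conj_iff hG]
  unfold posMeasure
  rw [Measure.map_map (measurable_conj G) (continuous_symOf p).measurable]
  have : (fun Z => G * Z * G.transpose) ∘ symOf = symOf ∘ conjLin G := by
    funext z; simp [symOf_conjLin]
  rw [this, ← Measure.map_map (continuous_symOf p).measurable hm]
  nth_rw 1 [hpre]
  rw [← Measure.restrict_map hm (measurableSet_posCone p),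
    Measure.map_linearMap_addHaar_eq_smul_addHaar _ hdet, det_conjLin G hG, Measure.restrict_smul,
    Measure.map_smul, abs_inv, abs_pow]

lemma measurableEmbedding_conj {p : ℕ} {G : Matrix (Fin p) (Fin p) ℝ} (hG : G.det ≠ 0) :
    MeasurableEmbedding fun Z : Matrix (Fin p) (Fin p) ℝ => G * Z * G.transpose := by
  have hu : IsUnit G.det := isUnit_iff_ne_zero.2 hG
  have hu' : IsUnit G.transpose.det := by rwa [Matrix.det_transpose]
  let e : Matrix (Fin p) (Fin p) ℝ ≃ᵐ Matrix (Fin p) (Fin p) ℝ :=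
    { toFun := fun Z => G * Z * G.transpose
      invFun := fun Z => G⁻¹ * Z * G.transpose⁻¹
      left_inv := fun Z => by
        simp only [Matrix.mul_assoc, Matrix.mul_nonsing_inv _ hu', mul_one]
        rw [← Matrix.mul_assoc, Matrix.nonsing_inv_mul _ hu, one_mul]
      right_inv := fun Z => by
        simp only [Matrix.mul_assoc, Matrix.nonsing_inv_mul _ hu', mul_one]
        rw [← Matrix.mul_assoc, Matrix.mul_nonsing_inv _ hu, one_mul]
      measurable_toFun := measurable_conj G
      measurable_invFun := Continuous.measurable
        (f := fun Z : Matrix (Fin p) (Fin p) ℝ => G⁻¹ * Z * G.transpose⁻¹) (by fun_prop) }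
  exact e.measurableEmbedding

lemma integral_conj_posMeasure {p : ℕ} {G : Matrix (Fin p) (Fin p) ℝ} (hG : G.det ≠ 0)
    (f : Matrix (Fin p) (Fin p) ℝ → ℂ) :
    ∫ Z, f (G * Z * G.transpose) ∂posMeasure p =
      ((|G.det| ^ (p + 1))⁻¹ : ℝ) • ∫ Z, f Z ∂posMeasure p := by
  rw [← (measurableEmbedding_conj hG).integral_map, map_conj_posMeasure hG, integral_smul_measure,
    ENNReal.toReal_ofReal (by positivity)]

lemma integrable_conj_posMeasure {p : ℕ} {G : Matrix (Fin p) (Fin p) ℝ} (hG : G.det ≠ 0)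
    (f : Matrix (Fin p) (Fin p) ℝ → ℂ) :
    Integrable (fun Z => f (G * Z * G.transpose)) (posMeasure p) ↔
      Integrable f (posMeasure p) := by
  rw [← Function.comp_def f, ← (measurableEmbedding_conj hG).integrable_map_iff,
    map_conj_posMeasure hG]
  refine integrable_smul_measure ?_ ENNReal.ofReal_ne_top
  exact (ENNReal.ofReal_pos.2 (by positivity)).ne'

/-! ### Generalized powers -/

/-- Lower triangular matrices. -/
def IsLowerTri {p : ℕ} (T : Matrix (Fin p) (Fin p) ℝ) : Prop := ∀ i j, i < j → T i j = 0

lemma sum_eq_sum_castLE {p n : ℕ} (h : n ≤ p) (f : Fin p → ℝ)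
    (hf : ∀ k : Fin p, n ≤ (k : ℕ) → f k = 0) : ∑ k, f k = ∑ k : Fin n, f (Fin.castLE h k) := by
  refine (Fintype.sum_of_injective (Fin.castLE h) (Fin.castLE_injective h) _ _ (fun k hk => hf k ?_)
    fun _ => rfl).symm
  by_contra hlt
  exact hk ⟨⟨k, not_le.1 hlt⟩, rfl⟩

/-- For lower triangular `T`, the leading block of `T X Tᵀ` involves only the leading blocks of `T`
and `X`. -/
lemma leadingMinor_mul_mul_transpose {p : ℕ} {T : Matrix (Fin p) (Fin p) ℝ} (hT : IsLowerTri T)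
    (X : Matrix (Fin p) (Fin p) ℝ) (j : Fin p) :
    leadingMinor (T * X * T.transpose) j = leadingMinor T j ^ 2 * leadingMinor X j := by
  unfold leadingMinor
  set e : Fin ((j : ℕ) + 1) → Fin p := Fin.castLE (Nat.succ_le_of_lt j.isLt)
  have hz : ∀ (a : Fin ((j : ℕ) + 1)) (k : Fin p), (j : ℕ) + 1 ≤ k → T (e a) k = 0 :=
    fun a k hk => hT _ _ (Fin.lt_def.2 (lt_of_lt_of_le a.isLt hk))
  have h : (T * X * T.transpose).submatrix e e =
      T.submatrix e e * X.submatrix e e * (T.submatrix e e).transpose := by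
    ext a c
    simp only [Matrix.submatrix_apply, Matrix.mul_apply, Matrix.transpose_apply]
    rw [sum_eq_sum_castLE (Nat.succ_le_of_lt j.isLt) _ fun k hk => by rw [hz c k hk, mul_zero]]
    refine Finset.sum_congr rfl fun k _ => ?_
    rw [sum_eq_sum_castLE (Nat.succ_le_of_lt j.isLt) _ fun k hk => by rw [hz a k hk, zero_mul]]
  rw [h, Matrix.det_mul, Matrix.det_mul, Matrix.det_transpose]
  ring

lemma leadingMinor_one {p : ℕ} (j : Fin p) : leadingMinor (1 : Matrix (Fin p) (Fin p) ℝ) j = 1 := by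
  rw [leadingMinor, Matrix.submatrix_one _ (Fin.castLE_injective _), Matrix.det_one]

/-- Generalized powers are multiplicative for the action of lower triangular matrices. -/
lemma genPow_mul_mul_transpose {p : ℕ} (κ : Fin p → ℕ) {T : Matrix (Fin p) (Fin p) ℝ}
    (hT : IsLowerTri T) (X : Matrix (Fin p) (Fin p) ℝ) :
    genPow κ (T * X * T.transpose) = genPow κ (T * T.transpose) * genPow κ X := by
  have h1 : T * T.transpose = T * 1 * T.transpose := by rw [mul_one]
  rw [h1]
  unfold genPow
  rw [← Finset.prod_mul_distrib]
  refine Finset.prod_congr rfl fun j _ => ?_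
  rw [leadingMinor_mul_mul_transpose hT, leadingMinor_mul_mul_transpose hT, leadingMinor_one,
    mul_one, mul_pow]

lemma genPow_zero {p : ℕ} (X : Matrix (Fin p) (Fin p) ℝ) : genPow 0 X = 1 := by
  simp [genPow]

lemma continuous_leadingMinor {p : ℕ} (j : Fin p) :
    Continuous fun X : Matrix (Fin p) (Fin p) ℝ => leadingMinor X j := by
  unfold leadingMinor
  fun_prop

lemma continuous_genPow {p : ℕ} (κ : Fin p → ℕ) :
    Continuous fun X : Matrix (Fin p) (Fin p) ℝ => genPow κ X :=
  continuous_finsetProd _ fun j _ => (continuous_leadingMinor j).pow _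

/-- The Cholesky decomposition. -/
lemma Matrix.PosDef.exists_lowerTri {p : ℕ} {Z : Matrix (Fin p) (Fin p) ℝ} (hZ : Z.PosDef) :
    ∃ T : Matrix (Fin p) (Fin p) ℝ, IsLowerTri T ∧ T.det ≠ 0 ∧ Z = T * T.transpose := by
  set M := LDL.lowerInv hZ
  set d := LDL.diagEntries hZ
  have hM : M.BlockTriangular OrderDual.toDual := fun i j hij => LDL.lowerInv_triangular hZ hij
  have hL : (M⁻¹).BlockTriangular OrderDual.toDual := Matrix.blockTriangular_inv_of_blockTriangular hM
  have hdet : M.det ≠ 0 := (Matrix.isUnit_iff_isUnit_det M).1 (isUnit_of_invertible M) |>.ne_zero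
  have hdiag : (Matrix.diagonal d).PosDef := by
    have h := LDL.diag_eq_lowerInv_conj hZ
    rw [Matrix.conjTranspose_eq_transpose_of_trivial] at h
    rw [LDL.diag] at h
    exact h.symm ▸ (posDef_conj_iff hdet).2 hZ
  have hd : ∀ i, 0 < d i := Matrix.posDef_diagonal_iff.1 hdiag
  have hZeq : M⁻¹ * Matrix.diagonal d * M⁻¹.transpose = Z := by
    have h := LDL.lower_conj_diag hZ
    rwa [Matrix.conjTranspose_eq_transpose_of_trivial] at h
  -- The Cholesky factor is the unipotent LDL factor times the square root of the diagonal part,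
  -- which is positive because it is congruent to `Z`.
  have key : Z = (M⁻¹ * Matrix.diagonal fun i => √(d i)) *
      (M⁻¹ * Matrix.diagonal fun i => √(d i)).transpose := by
    rw [Matrix.transpose_mul, Matrix.diagonal_transpose, ← hZeq, Matrix.mul_assoc M⁻¹ _ (_ * _),
      ← Matrix.mul_assoc (Matrix.diagonal _) (Matrix.diagonal _), Matrix.diagonal_mul_diagonal,
      ← Matrix.mul_assoc]
    simp only [Real.mul_self_sqrt (hd _).le]
  refine ⟨_, fun i j hij => ?_, fun h0 => ?_, key⟩
  · rw [Matrix.mul_diagonal, hL hij, zero_mul]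
  · have := hZ.det_pos
    rw [key, Matrix.det_mul, h0, zero_mul] at this
    exact this.false

/-! ### Bordered matrices -/

/-- The symmetric matrix with first row `(w, v)` and remaining block `S`. -/
def bordered {p : ℕ} (w : ℝ) (v : Fin p → ℝ) (S : Matrix (Fin p) (Fin p) ℝ) :
    Matrix (Fin (p + 1)) (Fin (p + 1)) ℝ :=
  Matrix.of (Fin.cons (Fin.cons w v) fun i => Fin.cons (v i) (S i))

section bordered
variable {p : ℕ} (w : ℝ) (v : Fin p → ℝ) (S : Matrix (Fin p) (Fin p) ℝ)

@[simp] lemma bordered_zero_zero : bordered w v S 0 0 = w := rfl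
@[simp] lemma bordered_zero_succ (j : Fin p) : bordered w v S 0 j.succ = v j := rfl
@[simp] lemma bordered_succ_zero (i : Fin p) : bordered w v S i.succ 0 = v i := rfl
@[simp] lemma bordered_succ_succ (i j : Fin p) : bordered w v S i.succ j.succ = S i j := rfl

end bordered

/-- The bordered matrix with corner `w`, border `v` and Schur complement `S`. -/
noncomputable def schurBordered {p : ℕ} (w : ℝ) (v : Fin p → ℝ) (S : Matrix (Fin p) (Fin p) ℝ) :
    Matrix (Fin (p + 1)) (Fin (p + 1)) ℝ :=
  bordered w v (S + w⁻¹ • Matrix.vecMulVec v v)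

/-- The unipotent matrix with first column `(1, u)`. -/
def unipotentCol {p : ℕ} (u : Fin p → ℝ) : Matrix (Fin (p + 1)) (Fin (p + 1)) ℝ :=
  Matrix.of (Fin.cons (Fin.cons 1 0) fun i => Fin.cons (u i) ((1 : Matrix (Fin p) (Fin p) ℝ) i))

section unipotentCol
variable {p : ℕ} (u : Fin p → ℝ)

@[simp] lemma unipotentCol_zero_zero : unipotentCol u 0 0 = 1 := rfl
@[simp] lemma unipotentCol_zero_succ (j : Fin p) : unipotentCol u 0 j.succ = 0 := rfl
@[simp] lemma unipotentCol_succ_zero (i : Fin p) : unipotentCol u i.succ 0 = u i := rfl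
@[simp] lemma unipotentCol_succ_succ (i j : Fin p) :
    unipotentCol u i.succ j.succ = (1 : Matrix (Fin p) (Fin p) ℝ) i j := rfl

lemma isLowerTri_unipotentCol : IsLowerTri (unipotentCol u) := by
  intro i j hij
  induction j using Fin.cases with
  | zero => exact absurd hij (Fin.not_lt_zero i)
  | succ j =>
    induction i using Fin.cases with
    | zero => rfl
    | succ i => simp [Matrix.one_apply_ne (Fin.succ_lt_succ_iff.1 hij).ne]

lemma leadingMinor_unipotentCol (j : Fin (p + 1)) : leadingMinor (unipotentCol u) j = 1 := by
  unfold leadingMinor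
  rw [Matrix.det_of_isLowerTriangular]
  · refine Finset.prod_eq_one fun k _ => ?_
    rw [Matrix.submatrix_apply]
    generalize Fin.castLE _ k = i
    induction i using Fin.cases <;> simp
  · exact fun a b hab => isLowerTri_unipotentCol u
      (Fin.castLE (Nat.succ_le_of_lt j.isLt) a) (Fin.castLE (Nat.succ_le_of_lt j.isLt) b) hab

lemma det_unipotentCol : (unipotentCol u).det = 1 := by
  rw [Matrix.det_of_isLowerTriangular]
  · refine Finset.prod_eq_one fun i _ => ?_
    induction i using Fin.cases <;> simp
  · exact fun a b hab => isLowerTri_unipotentCol u _ _ hab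

end unipotentCol

/-- One step of Gaussian elimination: the unipotent column clears the border, leaving the corner and
its Schur complement. -/
lemma schurBordered_eq {p : ℕ} {w : ℝ} (hw : w ≠ 0) (v : Fin p → ℝ)
    (S : Matrix (Fin p) (Fin p) ℝ) :
    schurBordered w v S = unipotentCol (w⁻¹ • v) * bordered w 0 S *
      (unipotentCol (w⁻¹ • v)).transpose := by
  ext i j
  induction i using Fin.cases <;> induction j using Fin.cases <;>
    simp [schurBordered, Matrix.mul_apply, Fin.sum_univ_succ, Matrix.one_apply, Matrix.vecMulVec_apply]
  all_goals field_simp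
  all_goals ring

lemma leadingMinor_bordered_zero {p : ℕ} (w : ℝ) (S : Matrix (Fin p) (Fin p) ℝ) :
    leadingMinor (bordered w 0 S) 0 = w := by
  exact Matrix.det_fin_one _

lemma leadingMinor_bordered_succ {p : ℕ} (w : ℝ) (S : Matrix (Fin p) (Fin p) ℝ) (j : Fin p) :
    leadingMinor (bordered w 0 S) j.succ = w * leadingMinor S j := by
  unfold leadingMinor
  have : ((j.succ : Fin (p + 1)) : ℕ) + 1 = ((j : ℕ) + 1) + 1 := by simp
  rw [Matrix.det_succ_row_zero, Fin.sum_univ_succ, Finset.sum_eq_zero]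
  · simp only [Fin.val_zero, pow_zero, one_mul, add_zero, Matrix.submatrix_apply]
    congr 1
  · intro k _
    have : bordered w 0 S (Fin.castLE (Nat.succ_le_of_lt j.succ.isLt) 0)
        (Fin.castLE (Nat.succ_le_of_lt j.succ.isLt) k.succ) = 0 := rfl
    rw [Matrix.submatrix_apply, this, mul_zero, zero_mul]

lemma det_bordered {p : ℕ} (w : ℝ) (S : Matrix (Fin p) (Fin p) ℝ) :
    (bordered w 0 S).det = w * S.det := by
  rw [Matrix.det_succ_row_zero, Fin.sum_univ_succ, Finset.sum_eq_zero]
  · simp only [Fin.val_zero, pow_zero, one_mul, add_zero]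
    congr 1
  · intro k _
    simp

lemma det_schurBordered {p : ℕ} {w : ℝ} (hw : w ≠ 0) (v : Fin p → ℝ)
    (S : Matrix (Fin p) (Fin p) ℝ) : (schurBordered w v S).det = w * S.det := by
  rw [schurBordered_eq hw, Matrix.det_mul, Matrix.det_mul, Matrix.det_transpose, det_unipotentCol,
    det_bordered, one_mul, mul_one]

lemma trace_schurBordered {p : ℕ} (w : ℝ) (v : Fin p → ℝ) (S : Matrix (Fin p) (Fin p) ℝ) :
    (schurBordered w v S).trace = w + S.trace + w⁻¹ * ∑ i, v i ^ 2 := by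
  rw [Matrix.trace, Fin.sum_univ_succ]
  simp only [schurBordered, Matrix.diag_apply, bordered_zero_zero, bordered_succ_succ,
    Matrix.add_apply, Matrix.smul_apply, Matrix.vecMulVec_apply, smul_eq_mul, Matrix.trace,
    Finset.sum_add_distrib, Finset.mul_sum, sq]
  ring

lemma posDef_bordered_iff {p : ℕ} (w : ℝ) (S : Matrix (Fin p) (Fin p) ℝ) :
    (bordered w 0 S).PosDef ↔ 0 < w ∧ S.PosDef := by
  have hq : ∀ x : Fin (p + 1) → ℝ, star x ⬝ᵥ (bordered w 0 S).mulVec x =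
      w * x 0 ^ 2 + star (fun i : Fin p => x i.succ) ⬝ᵥ S.mulVec fun i => x i.succ := by
    intro x
    simp [dotProduct, Matrix.mulVec, Fin.sum_univ_succ]
    ring
  simp only [Matrix.posDef_iff_dotProduct_mulVec, isSymm_iff_isHermitian_real, hq]
  constructor
  · rintro ⟨hs, h⟩
    refine ⟨?_, ?_, fun y hy => ?_⟩
    · have := @h (Fin.cons 1 0) (fun h0 => by simpa using congrFun h0 0)
      simpa using this
    · ext i j
      simpa using hs.apply i.succ j.succ
    · have := @h (Fin.cons 0 y) (fun h0 => hy (by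
        ext i
        simpa using congrFun h0 i.succ))
      simpa using this
  · rintro ⟨hw, hs, h⟩
    refine ⟨?_, fun x hx => ?_⟩
    · ext i j
      induction i using Fin.cases <;> induction j using Fin.cases <;> simp
      exact hs.apply _ _
    · by_cases hy : (fun i : Fin p => x i.succ) = 0
      · have h0 : x 0 ≠ 0 := fun h0 => hx (by
          ext i
          induction i using Fin.cases with
          | zero => exact h0
          | succ i => exact congrFun hy i)
        rw [hy]
        simp
        positivity
      · have := h hy
        have : 0 ≤ w * x 0 ^ 2 := by positivity
        linarith [h hy]

/-- No assumption `w ≠ 0` is needed, since each side forces `w > 0`: the corner of a positive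
definite matrix is positive. -/
lemma posDef_schurBordered_iff {p : ℕ} {w : ℝ} (v : Fin p → ℝ) (S : Matrix (Fin p) (Fin p) ℝ) :
    (schurBordered w v S).PosDef ↔ 0 < w ∧ S.PosDef := by
  have key : w ≠ 0 → ((schurBordered w v S).PosDef ↔ 0 < w ∧ S.PosDef) := fun hw => by
    rw [schurBordered_eq hw, posDef_conj_iff (by rw [det_unipotentCol]; exact one_ne_zero),
      posDef_bordered_iff]
  constructor
  · intro h
    have hw : 0 < w := h.diag_pos (i := 0)
    exact (key hw.ne').1 h
  · exact fun h => (key h.1.ne').2 h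

/-- The exponents in the generalized power telescope. -/
lemma sum_sub_next {p : ℕ} {κ : Fin (p + 1) → ℕ} (hκ : Antitone κ) :
    ∑ j : Fin (p + 1), (κ j - if h : (j : ℕ) + 1 < p + 1 then κ ⟨(j : ℕ) + 1, h⟩ else 0) = κ 0 := by
  induction p with
  | zero => simp
  | succ p ih =>
    rw [Fin.sum_univ_succ]
    have := ih (κ := fun i => κ i.succ) fun i j hij => hκ (Fin.succ_le_succ_iff.2 hij)
    have h2 : ∀ j : Fin (p + 1), (κ j.succ - if h : ((j.succ : Fin (p + 1 + 1)) : ℕ) + 1 < p + 1 + 1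
        then κ ⟨((j.succ : Fin (p + 1 + 1)) : ℕ) + 1, h⟩ else 0) =
        κ j.succ - if h : (j : ℕ) + 1 < p + 1 then κ (Fin.succ ⟨(j : ℕ) + 1, h⟩) else 0 := by
      intro j
      congr 1
      simp only [Fin.val_succ, Nat.add_lt_add_iff_right]
      rfl
    rw [Finset.sum_congr rfl fun j _ => h2 j, this]
    -- Subtraction is truncated, so the sum telescopes only because `κ` is decreasing.
    have h3 : κ (Fin.succ 0) ≤ κ 0 := hκ (Fin.zero_le _)
    simp only [Fin.val_zero, zero_add, Nat.lt_add_left_iff_pos, Nat.succ_pos, dif_pos]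
    exact Nat.sub_add_cancel h3

/-- The unipotent factor has all leading minors one, and each leading minor of the block diagonal
matrix contains exactly one factor `w`; the exponents add up to `κ 0`. -/
lemma genPow_schurBordered {p : ℕ} {κ : Fin (p + 1) → ℕ} (hκ : Antitone κ) {w : ℝ} (hw : w ≠ 0)
    (v : Fin p → ℝ) (S : Matrix (Fin p) (Fin p) ℝ) :
    genPow κ (schurBordered w v S) = w ^ κ 0 * genPow (fun i => κ i.succ) S := by
  rw [schurBordered_eq hw, ← sum_sub_next hκ, ← Finset.prod_pow_eq_pow_sum]
  unfold genPow
  simp only [leadingMinor_mul_mul_transpose (isLowerTri_unipotentCol _), leadingMinor_unipotentCol,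
    one_pow, one_mul]
  rw [Fin.prod_univ_succ, Fin.prod_univ_succ, leadingMinor_bordered_zero, mul_assoc,
    ← Finset.prod_mul_distrib]
  congr 1
  refine Finset.prod_congr rfl fun j _ => ?_
  rw [leadingMinor_bordered_succ, mul_pow]
  congr 2
  simp only [Fin.val_succ, Nat.add_lt_add_iff_right]
  rfl

/-! ### Splitting off the first row in the measure of the cone -/

/-- The coordinates of a bordered matrix. -/
noncomputable def borderEquiv (p : ℕ) :
    Fin (p + 1) ⊕ {q : Fin p × Fin p // q.1 ≤ q.2} ≃
      {q : Fin (p + 1) × Fin (p + 1) // q.1 ≤ q.2} :=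
  Equiv.ofBijective
    (Sum.elim (fun j => ⟨(0, j), Fin.zero_le j⟩)
      fun q => ⟨(q.1.1.succ, q.1.2.succ), Fin.succ_le_succ_iff.2 q.2⟩) <| by
    constructor
    · rintro (j | ⟨⟨i, j⟩, h⟩) (j' | ⟨⟨i', j'⟩, h'⟩) heq
      · simpa using heq
      · simp [Fin.ext_iff] at heq
      · simp [Fin.ext_iff] at heq
      · simpa using heq
    · rintro ⟨⟨i, j⟩, h⟩
      induction i using Fin.cases with
      | zero => exact ⟨Sum.inl j, rfl⟩
      | succ i =>
        induction j using Fin.cases with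
        | zero => exact absurd h (Fin.succ_pos i).not_ge
        | succ j => exact ⟨Sum.inr ⟨(i, j), Fin.succ_le_succ_iff.1 h⟩, rfl⟩

/-- The coordinates of the bordered matrix as a function of its corner, border and block. -/
def borderCoord (p : ℕ) (x : (ℝ × (Fin p → ℝ)) × SymCoord p) : SymCoord (p + 1) :=
  upperOf (bordered x.1.1 x.1.2 (symOf x.2))

lemma symOf_borderCoord {p : ℕ} (x : (ℝ × (Fin p → ℝ)) × SymCoord p) :
    symOf (borderCoord p x) = bordered x.1.1 x.1.2 (symOf x.2) := by
  refine symOf_upperOf ?_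
  ext i j
  induction i using Fin.cases <;> induction j using Fin.cases <;> simp
  exact (symOf_isSymm x.2).apply _ _

/-- Only a relabelling of coordinates: the first row splits into corner and border, and the
remaining entries are those of the block. -/
lemma measurePreserving_borderCoord (p : ℕ) : MeasurePreserving (borderCoord p) := by
  have h1 := volume_measurePreserving_piCongrLeft (fun _ => ℝ) (borderEquiv p)
  have h2 := volume_measurePreserving_sumPiEquivProdPi_symm
    (fun _ : Fin (p + 1) ⊕ {q : Fin p × Fin p // q.1 ≤ q.2} => ℝ)
  have h3 := (volume_preserving_piFinSuccAbove (fun _ : Fin (p + 1) => ℝ) 0).symm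
  have h4 := h1.comp (h2.comp (h3.prod (MeasurePreserving.id (volume : Measure (SymCoord p)))))
  suffices h : borderCoord p = _ from h ▸ h4
  funext x
  ext q
  obtain ⟨y, rfl⟩ := (borderEquiv p).surjective q
  rw [Function.comp_apply, MeasurableEquiv.coe_piCongrLeft, Equiv.piCongrLeft_apply_apply]
  rcases y with j | ⟨⟨i, j⟩, h⟩
  · induction j using Fin.cases <;> rfl
  · exact congrFun (upperOf_symOf x.2) ⟨(i, j), h⟩

/-- Translation of the block by the rank one matrix `w⁻¹ v vᵀ`. -/
noncomputable def schurShear (p : ℕ) (x : (ℝ × (Fin p → ℝ)) × SymCoord p) :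
    (ℝ × (Fin p → ℝ)) × SymCoord p :=
  (x.1, x.2 + upperOf (x.1.1⁻¹ • Matrix.vecMulVec x.1.2 x.1.2))

/-- For fixed corner and border the block is merely translated, so passing to the Schur complement
has Jacobian one. -/
lemma measurePreserving_schurShear (p : ℕ) : MeasurePreserving (schurShear p) := by
  have hm : Measurable fun y : ℝ × (Fin p → ℝ) =>
      upperOf (y.1⁻¹ • Matrix.vecMulVec y.2 y.2) := by
    refine (continuous_upperOf p).measurable.comp ?_
    refine measurable_pi_lambda _ fun i => measurable_pi_lambda _ fun j => ?_
    simp only [Matrix.smul_apply, Matrix.vecMulVec_apply, smul_eq_mul]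
    fun_prop
  refine MeasurePreserving.skew_product (f := id)
    (g := fun (y : ℝ × (Fin p → ℝ)) s => s + upperOf (y.1⁻¹ • Matrix.vecMulVec y.2 y.2))
    (MeasurePreserving.id _) ?_ (ae_of_all _ fun y => ?_)
  · exact measurable_snd.add (hm.comp measurable_fst)
  · exact map_add_right_eq_self _ _

lemma symOf_borderCoord_schurShear {p : ℕ} (x : (ℝ × (Fin p → ℝ)) × SymCoord p) :
    symOf (borderCoord p (schurShear p x)) = schurBordered x.1.1 x.1.2 (symOf x.2) := by
  rw [symOf_borderCoord, schurBordered]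
  congr 1
  have h := (symLin p).map_add x.2 (upperOf (x.1.1⁻¹ • Matrix.vecMulVec x.1.2 x.1.2))
  refine h.trans (congrArg (symOf x.2 + ·) (symOf_upperOf ?_))
  ext i j
  simp [Matrix.vecMulVec_apply, mul_comm]

lemma measurable_schurBordered (p : ℕ) :
    Measurable fun x : (ℝ × (Fin p → ℝ)) × Matrix (Fin p) (Fin p) ℝ =>
      schurBordered x.1.1 x.1.2 x.2 := by
  refine measurable_pi_lambda _ fun i => measurable_pi_lambda _ fun j => ?_
  have hS : ∀ a b : Fin p, Measurable fun x : (ℝ × (Fin p → ℝ)) × Matrix (Fin p) (Fin p) ℝ =>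
      x.2 a b := fun a b =>
    (measurable_pi_apply b).comp ((measurable_pi_apply a).comp measurable_snd)
  induction i using Fin.cases <;> induction j using Fin.cases <;>
    simp only [schurBordered, bordered_zero_zero, bordered_zero_succ, bordered_succ_zero,
      bordered_succ_succ, Matrix.add_apply, Matrix.smul_apply, Matrix.vecMulVec_apply, smul_eq_mul]
  · fun_prop
  · fun_prop
  · fun_prop
  · exact (hS _ _).add (by fun_prop)

/-- The measure of the cone in terms of the corner, the border and the Schur complement. -/
lemma posMeasure_succ (p : ℕ) :
    posMeasure (p + 1) =
      ((((volume : Measure ℝ).restrict (Set.Ioi 0)).prod (volume : Measure (Fin p → ℝ))).prod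
        (posMeasure p)).map fun x => schurBordered x.1.1 x.1.2 x.2 := by
  have hmp := (measurePreserving_borderCoord p).comp (measurePreserving_schurShear p)
  have hpre : (borderCoord p ∘ schurShear p) ⁻¹' posCone (p + 1) =
      (Set.Ioi (0 : ℝ) ×ˢ (Set.univ : Set (Fin p → ℝ))) ×ˢ posCone p := by
    ext x
    simp [posCone, symOf_borderCoord_schurShear, posDef_schurBordered_iff]
  have hsym := (continuous_symOf (p + 1)).measurable
  unfold posMeasure
  conv_lhs => rw [← hmp.map_eq]
  rw [Measure.restrict_map hmp.measurable (measurableSet_posCone _), hpre,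
    Measure.map_map hsym hmp.measurable]
  have h1 : symOf ∘ borderCoord p ∘ schurShear p =
      (fun x : (ℝ × (Fin p → ℝ)) × Matrix (Fin p) (Fin p) ℝ => schurBordered x.1.1 x.1.2 x.2) ∘
        Prod.map id symOf := by
    funext x
    exact symOf_borderCoord_schurShear x
  rw [h1, ← Measure.map_map (measurable_schurBordered p)
    (measurable_id.prodMap (continuous_symOf p).measurable)]
  congr 1
  rw [Measure.volume_eq_prod, ← Measure.prod_restrict, Measure.volume_eq_prod,
    ← Measure.prod_restrict, Measure.restrict_univ,
    ← Measure.map_prod_map _ _ measurable_id (continuous_symOf p).measurable, Measure.map_id]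

/-! ### The gamma integral -/

lemma Complex.Gamma_mul_ascPochhammer {b : ℂ} (hb : 0 < b.re) (n : ℕ) :
    Complex.Gamma b * (ascPochhammer ℂ n).eval b = Complex.Gamma (b + n) := by
  induction n with
  | zero => simp
  | succ n ih =>
    have h : b + n ≠ 0 := fun h => by
      have := congrArg Complex.re h
      simp at this
      linarith [(Nat.cast_nonneg n : (0 : ℝ) ≤ n)]
    rw [ascPochhammer_succ_eval, ← mul_assoc, ih, Nat.cast_succ, ← add_assoc, Complex.Gamma_add_one _ h,
      mul_comm]

lemma pochP_succ {p : ℕ} (b : ℂ) (κ : Fin (p + 1) → ℕ) :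
    pochP b κ = (ascPochhammer ℂ (κ 0)).eval b * pochP (b - 1 / 2) fun i : Fin p => κ i.succ := by
  rw [pochP, Fin.prod_univ_succ, pochP]
  congr 1
  · simp
  · refine Finset.prod_congr rfl fun i _ => ?_
    congr 1
    push_cast [Fin.val_succ]
    ring

/-- The factor `π^{p/2}` gained here is the one produced by the Gaussian integral over the border,
and the shift by `1/2` is the one felt by the Schur complement. -/
lemma gammaP_succ (p : ℕ) (b : ℂ) :
    gammaP (p + 1) b = (Real.pi : ℂ) ^ ((p : ℂ) / 2) * Complex.Gamma b * gammaP p (b - 1 / 2) := by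
  have hpi : (Real.pi : ℂ) ≠ 0 := by exact_mod_cast Real.pi_ne_zero
  have h1 : ∏ i : Fin p, Complex.Gamma (b - (((i.succ : Fin (p + 1)) : ℕ) : ℂ) / 2) =
      ∏ i : Fin p, Complex.Gamma (b - 1 / 2 - ((i : ℕ) : ℂ) / 2) := by
    refine Finset.prod_congr rfl fun i _ => ?_
    congr 1
    push_cast [Fin.val_succ]
    ring
  have h2 : (Real.pi : ℂ) ^ (((p + 1 : ℕ) : ℂ) * (((p + 1 : ℕ) : ℂ) - 1) / 4) =
      (Real.pi : ℂ) ^ ((p : ℂ) / 2) * (Real.pi : ℂ) ^ ((p : ℂ) * ((p : ℂ) - 1) / 4) := by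
    rw [← Complex.cpow_add _ _ hpi]
    congr 1
    push_cast
    ring
  rw [gammaP, Fin.prod_univ_succ, h1, h2, gammaP]
  simp only [Fin.val_zero, Nat.cast_zero, zero_div, sub_zero]
  ring

/-- A product of `p` one-dimensional Gaussians. The power `w^{p/2}` is later absorbed by the gamma
integral over the corner. -/
lemma gaussian_pi {p : ℕ} {w : ℝ} (hw : 0 < w) :
    Integrable (fun v : Fin p → ℝ => Complex.exp (-(w⁻¹ * ∑ i, v i ^ 2 : ℝ))) ∧
    ∫ v : Fin p → ℝ, Complex.exp (-(w⁻¹ * ∑ i, v i ^ 2 : ℝ)) =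
      (Real.pi : ℂ) ^ ((p : ℂ) / 2) * (w : ℂ) ^ ((p : ℂ) / 2) := by
  have hw' : 0 < w⁻¹ := inv_pos.2 hw
  have h1 : (fun v : Fin p → ℝ => Complex.exp (-(w⁻¹ * ∑ i, v i ^ 2 : ℝ))) =
      fun v => ∏ i, ((Real.exp (-w⁻¹ * v i ^ 2) : ℝ) : ℂ) := by
    funext v
    rw [← Complex.ofReal_prod, ← Real.exp_sum, ← Finset.mul_sum, ← Complex.ofReal_neg,
      ← Complex.ofReal_exp, neg_mul]
  rw [h1]
  refine ⟨Integrable.fintype_prod (f := fun _ x => ((Real.exp (-w⁻¹ * x ^ 2) : ℝ) : ℂ))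
    fun _ => (integrable_exp_neg_mul_sq hw').ofReal, ?_⟩
  rw [integral_fintype_prod_volume_eq_pow (fun x : ℝ => ((Real.exp (-w⁻¹ * x ^ 2) : ℝ) : ℂ)),
    integral_complex_ofReal, integral_gaussian, Fintype.card_fin, div_inv_eq_mul,
    Real.sqrt_eq_rpow, ← Complex.ofReal_pow, ← Real.rpow_natCast, ← Real.rpow_mul (by positivity),
    Real.mul_rpow Real.pi_pos.le hw.le]
  push_cast [Complex.ofReal_cpow Real.pi_pos.le, Complex.ofReal_cpow hw.le]
  congr 2 <;> ring

/-- The integral over the corner and the border. -/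
lemma corner_integral (p : ℕ) {s : ℂ} (hs : -1 < (s + p / 2).re) :
    Integrable (fun x : ℝ × (Fin p → ℝ) =>
      (x.1 : ℂ) ^ s * Complex.exp (-x.1) * Complex.exp (-(x.1⁻¹ * ∑ i, x.2 i ^ 2 : ℝ)))
      (((volume : Measure ℝ).restrict (Set.Ioi 0)).prod volume) ∧
    ∫ x : ℝ × (Fin p → ℝ),
      (x.1 : ℂ) ^ s * Complex.exp (-x.1) * Complex.exp (-(x.1⁻¹ * ∑ i, x.2 i ^ 2 : ℝ))
      ∂(((volume : Measure ℝ).restrict (Set.Ioi 0)).prod volume) =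
      (Real.pi : ℂ) ^ ((p : ℂ) / 2) * Complex.Gamma (s + p / 2 + 1) := by
  have hG : 0 < (s + p / 2 + 1).re := by
    rw [Complex.add_re, Complex.one_re]; linarith
  have hconv := Complex.GammaIntegral_convergent hG
  have hnorm : ∀ w : ℝ, 0 < w → ∀ v : Fin p → ℝ,
      ‖(w : ℂ) ^ s * Complex.exp (-w) * Complex.exp (-(w⁻¹ * ∑ i, v i ^ 2 : ℝ))‖ =
        ‖(w : ℂ) ^ s * Complex.exp (-w)‖ * Real.exp (-(w⁻¹ * ∑ i, v i ^ 2)) := by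
    intro w _ v
    rw [norm_mul, Complex.norm_exp (-_), Complex.neg_re, Complex.ofReal_re]
  -- The Gaussian factor is positive, so its integral equals the norm of the complex value; the
  -- iterated integral of the modulus thereby reduces to an Euler gamma integral.
  have hgauss : ∀ w : ℝ, 0 < w → ∫ v : Fin p → ℝ, Real.exp (-(w⁻¹ * ∑ i, v i ^ 2)) =
      ‖(Real.pi : ℂ) ^ ((p : ℂ) / 2) * (w : ℂ) ^ ((p : ℂ) / 2)‖ := by
    intro w hw
    rw [← (gaussian_pi hw).2]
    simp_rw [← Complex.ofReal_neg, ← Complex.ofReal_exp]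
    rw [integral_complex_ofReal, Complex.norm_real, Real.norm_of_nonneg]
    exact integral_nonneg fun _ => (Real.exp_pos _).le
  have hint : Integrable (fun x : ℝ × (Fin p → ℝ) =>
      (x.1 : ℂ) ^ s * Complex.exp (-x.1) * Complex.exp (-(x.1⁻¹ * ∑ i, x.2 i ^ 2 : ℝ)))
      (((volume : Measure ℝ).restrict (Set.Ioi 0)).prod volume) := by
    rw [integrable_prod_iff (Measurable.aestronglyMeasurable (by fun_prop))]
    constructor
    · filter_upwards [ae_restrict_mem measurableSet_Ioi] with w hw
      exact (gaussian_pi hw).1.const_mul _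
    · have h := (hconv.norm).const_mul ‖(Real.pi : ℂ) ^ ((p : ℂ) / 2)‖
      refine Integrable.congr h ?_
      filter_upwards [ae_restrict_mem measurableSet_Ioi] with w hw
      have hw0 : (w : ℂ) ≠ 0 := by exact_mod_cast (ne_of_gt hw)
      simp only [hnorm w hw]
      rw [integral_const_mul, hgauss w hw]
      simp only [norm_mul]
      have : ‖(w : ℂ) ^ (s + p / 2 + 1 - 1)‖ = ‖(w : ℂ) ^ s‖ * ‖(w : ℂ) ^ ((p : ℂ) / 2)‖ := by
        rw [add_sub_cancel_right, Complex.cpow_add _ _ hw0, norm_mul]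
      rw [this, ← Complex.ofReal_neg, ← Complex.ofReal_exp]
      ring
  refine ⟨hint, ?_⟩
  rw [integral_prod _ hint, Complex.Gamma_eq_integral hG, Complex.GammaIntegral,
    ← integral_const_mul]
  refine setIntegral_congr_fun measurableSet_Ioi fun w hw => ?_
  have hw0 : (w : ℂ) ≠ 0 := by exact_mod_cast (ne_of_gt hw)
  simp only
  rw [integral_const_mul, (gaussian_pi hw).2, add_sub_cancel_right, Complex.cpow_add _ _ hw0]
  push_cast
  ring

lemma measurable_detPow {p : ℕ} (s : ℂ) :
    Measurable fun Z : Matrix (Fin p) (Fin p) ℝ => detPow Z s := by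
  have : Measurable fun Z : Matrix (Fin p) (Fin p) ℝ => (Z.det : ℂ) :=
    Continuous.measurable (by fun_prop)
  exact this.pow_const s

lemma continuous_etr {p : ℕ} : Continuous fun Z : Matrix (Fin p) (Fin p) ℝ => etr Z := by
  unfold etr
  have : Continuous fun Z : Matrix (Fin p) (Fin p) ℝ => Z.trace := by fun_prop
  fun_prop

/-- The integrand of the gamma integral. -/
noncomputable def gammaIntegrand {p : ℕ} (b : ℂ) (κ : Fin p → ℕ) (Z : Matrix (Fin p) (Fin p) ℝ) :
    ℂ :=
  detPow Z (b - ((p : ℂ) + 1) / 2) * etr (-Z) * (genPow κ Z : ℂ)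

lemma measurable_gammaIntegrand {p : ℕ} (b : ℂ) (κ : Fin p → ℕ) :
    Measurable (gammaIntegrand b κ) :=
  ((measurable_detPow _).mul (continuous_etr.comp continuous_neg).measurable).mul
    (Complex.continuous_ofReal.comp (continuous_genPow κ)).measurable

/-- The inductive step of the gamma integral: determinant, trace and generalized power all separate
in the variables `(w, v)` and `S`. The exponent of `|S|` has the right form for size `p` after `b`
is replaced by `b - 1/2`. -/
lemma gammaIntegrand_schurBordered {p : ℕ} (b : ℂ) {κ : Fin (p + 1) → ℕ} (hκ : Antitone κ)
    {w : ℝ} (hw : 0 < w) (v : Fin p → ℝ) {S : Matrix (Fin p) (Fin p) ℝ} (hS : S.PosDef) :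
    gammaIntegrand b κ (schurBordered w v S) =
      ((w : ℂ) ^ (b + κ 0 - ((p : ℂ) + 2) / 2) * Complex.exp (-w) *
        Complex.exp (-(w⁻¹ * ∑ i, v i ^ 2 : ℝ))) *
      gammaIntegrand (b - 1 / 2) (fun i => κ i.succ) S := by
  have hw0 : (w : ℂ) ≠ 0 := by exact_mod_cast hw.ne'
  unfold gammaIntegrand detPow etr
  rw [det_schurBordered hw.ne', genPow_schurBordered hκ hw.ne', Matrix.trace_neg,
    trace_schurBordered, Complex.ofReal_mul, Complex.mul_cpow_ofReal_nonneg hw.le hS.det_pos.le,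
    Matrix.trace_neg]
  have h1 : (w : ℂ) ^ (b + κ 0 - ((p : ℂ) + 2) / 2) =
      (w : ℂ) ^ (b - (((p + 1 : ℕ) : ℂ) + 1) / 2) * (w : ℂ) ^ κ 0 := by
    rw [← Complex.cpow_natCast, ← Complex.cpow_add _ _ hw0]
    congr 1
    push_cast
    ring
  have h2 : b - (((p + 1 : ℕ) : ℂ) + 1) / 2 = b - 1 / 2 - ((p : ℂ) + 1) / 2 := by
    push_cast
    ring
  have h3 : Complex.exp ((-(w + S.trace + w⁻¹ * ∑ i, v i ^ 2) : ℝ) : ℂ) =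
      Complex.exp (-w) * Complex.exp ((-S.trace : ℝ) : ℂ) *
        Complex.exp (-(w⁻¹ * ∑ i, v i ^ 2 : ℝ)) := by
    rw [← Complex.exp_add, ← Complex.exp_add]
    congr 1
    push_cast
    ring
  rw [h1, h3, ← h2]
  push_cast
  ring

/-- The gamma integral with a generalized power. -/
lemma gamma_integral {p : ℕ} {b : ℂ} (hb : ((p : ℝ) - 1) / 2 < b.re) {κ : Fin p → ℕ}
    (hκ : Antitone κ) :
    Integrable (gammaIntegrand b κ) (posMeasure p) ∧
      ∫ Z, gammaIntegrand b κ Z ∂posMeasure p = gammaP p b * pochP b κ := by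
  induction p generalizing b with
  | zero =>
    have h1 : gammaIntegrand b κ = fun _ => (1 : ℂ) := by
      funext Z
      simp [gammaIntegrand, detPow, etr, genPow, Matrix.trace]
    -- With no coordinates the cone is a single point of mass one.
    have h2 : posMeasure 0 Set.univ = 1 := by
      rw [posMeasure, Measure.map_apply (continuous_symOf 0).measurable MeasurableSet.univ,
        Set.preimage_univ, Measure.restrict_apply_univ]
      have : posCone 0 = Set.univ := by
        ext z
        have h : (symOf z).PosDef := Subsingleton.elim 1 (symOf z) ▸ Matrix.PosDef.one
        exact iff_of_true h trivial
      rw [this]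
      simp [volume_pi]
    have : IsProbabilityMeasure (posMeasure 0) := ⟨h2⟩
    rw [h1]
    exact ⟨integrable_const _, by simp [gammaP, pochP]⟩
  | succ p ih =>
    have hb1 : ((p : ℝ) - 1) / 2 < (b - 1 / 2).re := by
      have : (b - 1 / 2).re = b.re - 1 / 2 := by
        rw [Complex.sub_re]; norm_num
      push_cast at hb
      rw [this]
      linarith
    have hb0 : 0 < b.re := by
      push_cast at hb
      have : (0 : ℝ) ≤ p := Nat.cast_nonneg p
      linarith
    obtain ⟨hi, hv⟩ := ih hb1 (κ := fun i => κ i.succ)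
      fun i j hij => hκ (Fin.succ_le_succ_iff.2 hij)
    have hs : b + κ 0 - ((p : ℂ) + 2) / 2 + p / 2 = b + κ 0 - 1 := by ring
    obtain ⟨ci, cv⟩ := corner_integral p (s := b + κ 0 - ((p : ℂ) + 2) / 2) (by
      rw [hs]
      simp only [Complex.sub_re, Complex.add_re, Complex.natCast_re, Complex.one_re]
      have : (0 : ℝ) ≤ κ 0 := Nat.cast_nonneg _
      linarith)
    rw [hs, sub_add_cancel] at cv
    have hae : (fun x : (ℝ × (Fin p → ℝ)) × Matrix (Fin p) (Fin p) ℝ =>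
        ((x.1.1 : ℂ) ^ (b + κ 0 - ((p : ℂ) + 2) / 2) * Complex.exp (-x.1.1) *
          Complex.exp (-(x.1.1⁻¹ * ∑ i, x.1.2 i ^ 2 : ℝ))) *
        gammaIntegrand (b - 1 / 2) (fun i => κ i.succ) x.2) =ᵐ[
          (((volume : Measure ℝ).restrict (Set.Ioi 0)).prod (volume : Measure (Fin p → ℝ))).prod
            (posMeasure p)]
        fun x => gammaIntegrand b κ (schurBordered x.1.1 x.1.2 x.2) := by
      have h1 : ∀ᵐ y ∂((volume : Measure ℝ).restrict (Set.Ioi 0)).prod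
          (volume : Measure (Fin p → ℝ)), y.1 ∈ Set.Ioi (0 : ℝ) :=
        Measure.quasiMeasurePreserving_fst.ae (ae_restrict_mem measurableSet_Ioi)
      filter_upwards [Measure.quasiMeasurePreserving_fst.ae h1,
        Measure.quasiMeasurePreserving_snd.ae (ae_posDef p)] with x hx1 hx2
      exact (gammaIntegrand_schurBordered b hκ hx1 x.1.2 hx2).symm
    have hms := (measurable_schurBordered p)
    rw [posMeasure_succ, integrable_map_measure (measurable_gammaIntegrand b κ).aestronglyMeasurable
      hms.aemeasurable, integral_map hms.aemeasurable
      (measurable_gammaIntegrand b κ).aestronglyMeasurable]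
    refine ⟨(ci.mul_prod hi).congr hae, ?_⟩
    have hprod := integral_prod_mul
      (μ := ((volume : Measure ℝ).restrict (Set.Ioi 0)).prod (volume : Measure (Fin p → ℝ)))
      (ν := posMeasure p)
      (fun x : ℝ × (Fin p → ℝ) => (x.1 : ℂ) ^ (b + κ 0 - ((p : ℂ) + 2) / 2) *
        Complex.exp (-x.1) * Complex.exp (-(x.1⁻¹ * ∑ i, x.2 i ^ 2 : ℝ)))
      (gammaIntegrand (b - 1 / 2) fun i => κ i.succ)
    rw [← integral_congr_ae hae, hprod, cv, hv, gammaP_succ, pochP_succ,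
      ← Complex.Gamma_mul_ascPochhammer hb0]
    ring

/-! ### Traces, powers of determinants and bounds -/

/-- With `Z = T Tᵀ` the trace is that of the semidefinite matrix `Tᵀ P T`. -/
lemma trace_mul_nonneg_of_posSemidef {p : ℕ} {P Z : Matrix (Fin p) (Fin p) ℝ} (hP : P.PosSemidef)
    (hZ : Z.PosDef) : 0 ≤ (P * Z).trace := by
  obtain ⟨T, -, -, rfl⟩ := hZ.exists_lowerTri
  have h := (hP.conjTranspose_mul_mul_same T).trace_nonneg
  rw [Matrix.conjTranspose_eq_transpose_of_trivial] at h
  rwa [← Matrix.mul_assoc, Matrix.trace_mul_comm, ← Matrix.mul_assoc]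

/-- With `Z = T Tᵀ`, the arithmetic-geometric mean inequality bounds an entry by half the sum of two
diagonal entries. -/
lemma abs_apply_le_trace {p : ℕ} {Z : Matrix (Fin p) (Fin p) ℝ} (hZ : Z.PosDef) (i j : Fin p) :
    |Z i j| ≤ Z.trace := by
  obtain ⟨T, -, -, rfl⟩ := hZ.exists_lowerTri
  simp only [Matrix.trace, Matrix.diag_apply, Matrix.mul_apply, Matrix.transpose_apply]
  have h : ∀ i, ∑ k, T i k * T i k ≤ ∑ l, ∑ k, T l k * T l k := fun i =>
    Finset.single_le_sum (f := fun l => ∑ k, T l k * T l k)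
      (fun l _ => Finset.sum_nonneg fun k _ => mul_self_nonneg _) (Finset.mem_univ i)
  have h2 : |∑ k, T i k * T j k| ≤ ∑ k, (T i k * T i k + T j k * T j k) / 2 := by
    refine (Finset.abs_sum_le_sum_abs _ _).trans (Finset.sum_le_sum fun k _ => ?_)
    rw [abs_le]
    constructor <;> nlinarith [sq_nonneg (T i k + T j k), sq_nonneg (T i k - T j k)]
  rw [← Finset.sum_div, Finset.sum_add_distrib] at h2
  linarith [h i, h j]

/-- Expand each leading minor of size `m` over permutations: it is at most `m! tᵐ`. -/
lemma abs_genPow_le {p : ℕ} (κ : Fin p → ℕ) : ∃ A : ℝ, ∃ n : ℕ, 0 ≤ A ∧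
    ∀ Z : Matrix (Fin p) (Fin p) ℝ, ∀ t : ℝ, (∀ i j, |Z i j| ≤ t) → |genPow κ Z| ≤ A * t ^ n := by
  set e : Fin p → ℕ := fun j =>
    κ j - if h : (j : ℕ) + 1 < p then κ ⟨(j : ℕ) + 1, h⟩ else 0 with he
  refine ⟨∏ j : Fin p, (((j : ℕ) + 1).factorial : ℝ) ^ e j, ∑ j : Fin p, ((j : ℕ) + 1) * e j,
    by positivity, fun Z t ht => ?_⟩
  rw [← Finset.prod_pow_eq_pow_sum, ← Finset.prod_mul_distrib, genPow, Finset.abs_prod]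
  refine Finset.prod_le_prod (fun j _ => abs_nonneg _) fun j _ => ?_
  rw [pow_mul, ← mul_pow, abs_pow]
  refine pow_le_pow_left₀ (abs_nonneg _) ?_ _
  have h := Matrix.det_le (A := Z.submatrix (Fin.castLE (Nat.succ_le_of_lt j.isLt))
    (Fin.castLE (Nat.succ_le_of_lt j.isLt))) (abv := AbsoluteValue.abs) (x := t)
    fun a b => ht _ _
  simpa [leadingMinor] using h

/-- Polynomial growth costs only an arbitrarily small part of an exponential weight; this is how
generalized powers are handled in every integrability argument below. -/
lemma abs_genPow_le_exp {p : ℕ} (κ : Fin p → ℕ) {ε : ℝ} (hε : 0 < ε) : ∃ A : ℝ,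
    ∀ Z : Matrix (Fin p) (Fin p) ℝ, Z.PosDef → |genPow κ Z| ≤ A * Real.exp (ε * Z.trace) := by
  obtain ⟨A, n, hA, h⟩ := abs_genPow_le κ
  refine ⟨A * (n.factorial / ε ^ n), fun Z hZ => (h Z _ (abs_apply_le_trace hZ)).trans ?_⟩
  rw [mul_assoc]
  refine mul_le_mul_of_nonneg_left ?_ hA
  have ht : 0 ≤ Z.trace := hZ.posSemidef.trace_nonneg
  have := Real.pow_div_factorial_le_exp (ε * Z.trace) (by positivity) n
  rw [div_le_iff₀ (by positivity), mul_pow] at this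
  rw [div_mul_eq_mul_div, le_div_iff₀ (by positivity)]
  linarith

lemma detPow_mul {p : ℕ} {X Y : Matrix (Fin p) (Fin p) ℝ} (hX : 0 ≤ X.det) (hY : 0 ≤ Y.det) (s : ℂ) :
    detPow (X * Y) s = detPow X s * detPow Y s := by
  rw [detPow, Matrix.det_mul, Complex.ofReal_mul, Complex.mul_cpow_ofReal_nonneg hX hY]
  rfl

lemma detPow_add {p : ℕ} {X : Matrix (Fin p) (Fin p) ℝ} (hX : X.PosDef) (s t : ℂ) :
    detPow X (s + t) = detPow X s * detPow X t :=
  Complex.cpow_add _ _ (by exact_mod_cast hX.det_pos.ne')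

lemma detPow_inv {p : ℕ} {X : Matrix (Fin p) (Fin p) ℝ} (hX : X.PosDef) (s : ℂ) :
    detPow X⁻¹ s = detPow X (-s) := by
  rw [detPow, Matrix.det_nonsing_inv, Ring.inverse_eq_inv', Complex.ofReal_inv, detPow,
    Complex.inv_cpow, Complex.cpow_neg]
  rw [Complex.arg_ofReal_of_nonneg hX.det_pos.le]
  exact Real.pi_pos.ne

lemma norm_detPow {p : ℕ} {X : Matrix (Fin p) (Fin p) ℝ} (hX : X.PosDef) (s : ℂ) :
    ‖detPow X s‖ = X.det ^ s.re :=
  Complex.norm_cpow_eq_rpow_re_of_pos hX.det_pos s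

lemma detPow_ofReal {p : ℕ} {X : Matrix (Fin p) (Fin p) ℝ} (hX : X.PosDef) (s : ℝ) :
    detPow X (s : ℂ) = ((X.det ^ s : ℝ) : ℂ) := by
  rw [detPow, Complex.ofReal_cpow hX.det_pos.le]

lemma detPow_ne_zero {p : ℕ} {X : Matrix (Fin p) (Fin p) ℝ} (hX : X.PosDef) (s : ℂ) :
    detPow X s ≠ 0 := by
  rw [detPow, Complex.cpow_ne_zero_iff]
  exact Or.inl (by exact_mod_cast hX.det_pos.ne')

lemma detPow_zero {p : ℕ} (X : Matrix (Fin p) (Fin p) ℝ) : detPow X 0 = 1 := Complex.cpow_zero _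

lemma norm_etr {p : ℕ} (X : Matrix (Fin p) (Fin p) ℝ) : ‖etr X‖ = Real.exp X.trace := by
  rw [etr, Complex.norm_exp, Complex.ofReal_re]

lemma etr_add {p : ℕ} (X Y : Matrix (Fin p) (Fin p) ℝ) : etr (X + Y) = etr X * etr Y := by
  rw [etr, Matrix.trace_add, Complex.ofReal_add, Complex.exp_add]
  rfl

lemma etr_mul_comm {p : ℕ} (X Y : Matrix (Fin p) (Fin p) ℝ) : etr (-(X * Y)) = etr (-(Y * X)) := by
  rw [etr, Matrix.trace_neg, Matrix.trace_mul_comm, ← Matrix.trace_neg]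
  rfl

/-- The Jacobian `|det T|^{p+1}` as a power of `|T Tᵀ|`. -/
lemma abs_det_pow_eq_detPow {p : ℕ} (T : Matrix (Fin p) (Fin p) ℝ) :
    ((|T.det| ^ (p + 1) : ℝ) : ℂ) = detPow (T * T.transpose) (((p : ℂ) + 1) / 2) := by
  have h : (T * T.transpose).det = |T.det| ^ 2 := by
    rw [Matrix.det_mul, Matrix.det_transpose, sq_abs, sq]
  have h2 : (((p : ℂ) + 1) / 2) = (((p : ℝ) + 1) / 2 : ℝ) := by push_cast; rfl
  rw [detPow, h, h2, ← Complex.ofReal_cpow (by positivity), ← Real.rpow_natCast,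
    ← Real.rpow_natCast, ← Real.rpow_mul (abs_nonneg _)]
  congr 2
  push_cast
  ring

lemma integral_congr_posDef {p : ℕ} {f g : Matrix (Fin p) (Fin p) ℝ → ℂ}
    (h : ∀ Z : Matrix (Fin p) (Fin p) ℝ, Z.PosDef → f Z = g Z) :
    ∫ Z, f Z ∂posMeasure p = ∫ Z, g Z ∂posMeasure p :=
  integral_congr_ae ((ae_posDef p).mono fun Z hZ => h Z hZ)

/-! ### Laplace transforms of generalized powers -/

/-- The integrand of the Laplace transform of a generalized power. -/
noncomputable def laplaceGen {p : ℕ} (b : ℂ) (κ : Fin p → ℕ) (S Z : Matrix (Fin p) (Fin p) ℝ) : ℂ :=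
  detPow Z (b - ((p : ℂ) + 1) / 2) * etr (-(S * Z)) * (genPow κ Z : ℂ)

lemma measurable_laplaceGen {p : ℕ} (b : ℂ) (κ : Fin p → ℕ) (S : Matrix (Fin p) (Fin p) ℝ) :
    Measurable (laplaceGen b κ S) :=
  ((measurable_detPow _).mul (continuous_etr.comp (by fun_prop)).measurable).mul
    (Complex.continuous_ofReal.comp (continuous_genPow κ)).measurable

/-- Write `S⁻¹ = T Tᵀ` with `T` lower triangular and substitute `Z ↦ T Z Tᵀ`: then `tr(SZ)` becomes
`tr Z`, and `Δ_κ` splits off `Δ_κ(S⁻¹)`, so the gamma integral remains. It is `S⁻¹` that is factored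
because `Δ_κ` is multiplicative only for lower triangular congruences. -/
lemma laplace_gen {p : ℕ} {b : ℂ} (hb : ((p : ℝ) - 1) / 2 < b.re) {κ : Fin p → ℕ}
    (hκ : Antitone κ) {S : Matrix (Fin p) (Fin p) ℝ} (hS : S.PosDef) :
    Integrable (laplaceGen b κ S) (posMeasure p) ∧
      ∫ Z, laplaceGen b κ S Z ∂posMeasure p =
        gammaP p b * pochP b κ * detPow S (-b) * (genPow κ S⁻¹ : ℂ) := by
  obtain ⟨T, hT, hdet, hST⟩ := hS.inv.exists_lowerTri
  obtain ⟨gi, gv⟩ := gamma_integral hb hκ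
  have hTT : T.transpose * S * T = 1 := by
    have h1 : S * (T * T.transpose) = 1 := by
      rw [← hST, Matrix.mul_nonsing_inv _ hS.det_pos.ne'.isUnit]
    have hTu : IsUnit T.det := isUnit_iff_ne_zero.2 hdet
    have h2 : (S * T) * T.transpose = 1 := by rw [Matrix.mul_assoc, h1]
    have h3 := mul_eq_one_comm.1 h2
    rwa [← Matrix.mul_assoc] at h3
  have hpt : ∀ Z : Matrix (Fin p) (Fin p) ℝ, Z.PosDef → laplaceGen b κ S (T * Z * T.transpose) =
      detPow S⁻¹ (b - ((p : ℂ) + 1) / 2) * (genPow κ S⁻¹ : ℂ) * gammaIntegrand b κ Z := by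
    intro Z hZ
    have h1 : detPow (T * Z * T.transpose) (b - ((p : ℂ) + 1) / 2) =
        detPow S⁻¹ (b - ((p : ℂ) + 1) / 2) * detPow Z (b - ((p : ℂ) + 1) / 2) := by
      rw [← detPow_mul hS.inv.det_pos.le hZ.det_pos.le, hST, detPow, detPow]
      congr 2
      simp only [Matrix.det_mul]
      ring
    have h2 : etr (-(S * (T * Z * T.transpose))) = etr (-Z) := by
      rw [etr_mul_comm, Matrix.mul_assoc (T * Z), etr_mul_comm, ← Matrix.mul_assoc, hTT, one_mul]
    rw [laplaceGen, h1, h2, genPow_mul_mul_transpose κ hT, ← hST, gammaIntegrand]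
    push_cast
    ring
  have hc := integral_conj_posMeasure hdet (laplaceGen b κ S)
  constructor
  · rw [← integrable_conj_posMeasure hdet]
    exact (gi.const_mul _).congr ((ae_posDef p).mono fun Z hZ => (hpt Z hZ).symm)
  · rw [integral_congr_posDef hpt, integral_const_mul, gv, Complex.real_smul, Complex.ofReal_inv,
      abs_det_pow_eq_detPow, ← hST] at hc
    rw [eq_comm, inv_mul_eq_iff_eq_mul₀ (detPow_ne_zero hS.inv _)] at hc
    rw [hc, ← detPow_inv hS]
    have : detPow S⁻¹ b = detPow S⁻¹ (((p : ℂ) + 1) / 2) * detPow S⁻¹ (b - ((p : ℂ) + 1) / 2) := by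
      rw [← detPow_add hS.inv]; ring_nf
    rw [this]
    ring

lemma laplace_gen_zero {p : ℕ} {b : ℂ} (hb : ((p : ℝ) - 1) / 2 < b.re)
    {S : Matrix (Fin p) (Fin p) ℝ} (hS : S.PosDef) :
    Integrable (fun Z => detPow Z (b - ((p : ℂ) + 1) / 2) * etr (-(S * Z))) (posMeasure p) ∧
      ∫ Z, detPow Z (b - ((p : ℂ) + 1) / 2) * etr (-(S * Z)) ∂posMeasure p =
        gammaP p b * detPow S (-b) := by
  have h := laplace_gen hb (κ := 0) antitone_const hS
  have hp : pochP b (0 : Fin p → ℕ) = 1 := by simp [pochP]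
  have hf : laplaceGen b 0 S = fun Z => detPow Z (b - ((p : ℂ) + 1) / 2) * etr (-(S * Z)) := by
    funext Z
    rw [laplaceGen, genPow_zero, Complex.ofReal_one, mul_one]
  rw [hf] at h
  simpa [hp, genPow_zero] using h

/-- On the cone, taking the modulus replaces the exponent by its real part, so the formula for real
`b` applies. -/
lemma laplace_gen_norm {p : ℕ} {b : ℂ} (hb : ((p : ℝ) - 1) / 2 < b.re)
    {S : Matrix (Fin p) (Fin p) ℝ} (hS : S.PosDef) :
    ∫ Z, ‖detPow Z (b - ((p : ℂ) + 1) / 2) * etr (-(S * Z))‖ ∂posMeasure p =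
      ‖gammaP p (b.re : ℂ)‖ * S.det ^ (-b.re) := by
  have h := congrArg norm (laplace_gen_zero (b := (b.re : ℂ)) (by simpa using hb) hS).2
  have h1 : ∀ Z : Matrix (Fin p) (Fin p) ℝ, Z.PosDef →
      detPow Z ((b.re : ℂ) - ((p : ℂ) + 1) / 2) * etr (-(S * Z)) =
        ((‖detPow Z (b - ((p : ℂ) + 1) / 2) * etr (-(S * Z))‖ : ℝ) : ℂ) := by
    intro Z hZ
    have h2 : (b.re : ℂ) - ((p : ℂ) + 1) / 2 = ((b - ((p : ℂ) + 1) / 2).re : ℝ) := by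
      have : (((p : ℂ) + 1) / 2) = (((p : ℝ) + 1) / 2 : ℝ) := by push_cast; rfl
      rw [this, Complex.sub_re, Complex.ofReal_re]
      push_cast
      rfl
    rw [norm_mul, norm_detPow hZ, norm_etr, h2, detPow_ofReal hZ, etr]
    push_cast
    rfl
  rw [integral_congr_posDef h1, integral_complex_ofReal, Complex.norm_real, norm_mul,
    norm_detPow hS, Complex.neg_re, Complex.ofReal_re, Real.norm_of_nonneg] at h
  · exact h
  · exact integral_nonneg fun _ => norm_nonneg _

/-! ### Beta integrals of the second kind -/

lemma re_sub_half_natCast_pos {p : ℕ} {b : ℂ} (hb : ((p : ℝ) - 1) / 2 < b.re) (i : Fin p) :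
    0 < (b - ((i : ℕ) : ℂ) / 2).re := by
  have h1 : ((i : ℕ) : ℝ) + 1 ≤ p := by exact_mod_cast i.isLt
  have h2 : (b - ((i : ℕ) : ℂ) / 2).re = b.re - ((i : ℕ) : ℝ) / 2 := by
    have : ((i : ℕ) : ℂ) / 2 = ((((i : ℕ) : ℝ) / 2 : ℝ) : ℂ) := by push_cast; rfl
    rw [this, Complex.sub_re, Complex.ofReal_re]
  rw [h2]
  linarith

lemma gammaP_ne_zero {p : ℕ} {b : ℂ} (hb : ((p : ℝ) - 1) / 2 < b.re) : gammaP p b ≠ 0 := by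
  refine mul_ne_zero ?_ (Finset.prod_ne_zero_iff.2 fun i _ =>
    Complex.Gamma_ne_zero_of_re_pos (re_sub_half_natCast_pos hb i))
  rw [Complex.cpow_ne_zero_iff]
  exact Or.inl (by exact_mod_cast Real.pi_ne_zero)

lemma pochP_ne_zero {p : ℕ} {b : ℂ} (hb : ((p : ℝ) - 1) / 2 < b.re) (κ : Fin p → ℕ) :
    pochP b κ ≠ 0 := by
  refine Finset.prod_ne_zero_iff.2 fun i _ h => ?_
  have h0 := re_sub_half_natCast_pos hb i
  have h1 := Complex.Gamma_mul_ascPochhammer h0 (κ i)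
  rw [h, mul_zero] at h1
  refine Complex.Gamma_ne_zero_of_re_pos ?_ h1.symm
  rw [Complex.add_re, Complex.natCast_re]
  positivity

lemma measurable_detPow_one_add {p : ℕ} (s : ℂ) :
    Measurable fun X : Matrix (Fin p) (Fin p) ℝ => detPow (1 + X) s :=
  (measurable_detPow s).comp (measurable_const.add measurable_id)

lemma continuous_etr_neg_mul {p : ℕ} :
    Continuous fun x : Matrix (Fin p) (Fin p) ℝ × Matrix (Fin p) (Fin p) ℝ => etr (-(x.1 * x.2)) :=
  continuous_etr.comp (by fun_prop)

lemma ae_prod_posDef (p : ℕ) : ∀ᵐ x ∂(posMeasure p).prod (posMeasure p),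
    x.1.PosDef ∧ x.2.PosDef :=
  (Measure.quasiMeasurePreserving_fst.ae (ae_posDef p)).and
    (Measure.quasiMeasurePreserving_snd.ae (ae_posDef p))

lemma etr_neg_one_add_mul {p : ℕ} (X V : Matrix (Fin p) (Fin p) ℝ) :
    etr (-((1 + X) * V)) = etr (-V) * etr (-(V * X)) := by
  rw [etr_mul_comm V X, ← etr_add]
  congr 1
  noncomm_ring

/-- The integrand of the beta integral of the second kind. -/
noncomputable def betaIntegrand {p : ℕ} (μ c : ℂ) (κ : Fin p → ℕ) (X : Matrix (Fin p) (Fin p) ℝ) :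
    ℂ :=
  detPow X (μ - ((p : ℂ) + 1) / 2) * detPow (1 + X) (-c) * (genPow κ (1 + X)⁻¹ : ℂ)

/-- Integrate `|V|^{c-(p+1)/2} Δ_κ(V) e^{-tr V} |X|^{μ-(p+1)/2} e^{-tr(VX)}` in both orders. Over
`V` it is a Laplace transform at `I + X` and gives the beta integrand; over `X` it gives `Γ_p(μ)
|V|^{-μ}`, leaving a gamma integral with `c - μ`. -/
lemma beta_integral {p : ℕ} {μ c : ℂ} (hμ : ((p : ℝ) - 1) / 2 < μ.re)
    (hcμ : ((p : ℝ) - 1) / 2 < (c - μ).re) (hc : ((p : ℝ) - 1) / 2 < c.re) {κ : Fin p → ℕ}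
    (hκ : Antitone κ) :
    Integrable (betaIntegrand μ c κ) (posMeasure p) ∧
      gammaP p c * pochP c κ * ∫ X, betaIntegrand μ c κ X ∂posMeasure p =
        gammaP p μ * (gammaP p (c - μ) * pochP (c - μ) κ) := by
  set F : Matrix (Fin p) (Fin p) ℝ → Matrix (Fin p) (Fin p) ℝ → ℂ := fun V X =>
    gammaIntegrand c κ V * (detPow X (μ - ((p : ℂ) + 1) / 2) * etr (-(V * X))) with hF
  have hFm : Measurable (Function.uncurry F) :=
    ((measurable_gammaIntegrand c κ).comp measurable_fst).mul
      (((measurable_detPow _).comp measurable_snd).mul continuous_etr_neg_mul.measurable)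
  have hγ : ∀ V : Matrix (Fin p) (Fin p) ℝ, V.PosDef →
      gammaIntegrand (c - μ) κ V = gammaIntegrand c κ V * detPow V (-μ) := by
    intro V hV
    have : c - μ - ((p : ℂ) + 1) / 2 = (c - ((p : ℂ) + 1) / 2) + -μ := by ring
    rw [gammaIntegrand, this, detPow_add hV, gammaIntegrand]
    ring
  have hint : Integrable (Function.uncurry F) ((posMeasure p).prod (posMeasure p)) := by
    rw [integrable_prod_iff hFm.aestronglyMeasurable]
    constructor
    · filter_upwards [ae_posDef p] with V hV
      exact (laplace_gen_zero hμ hV).1.const_mul (gammaIntegrand c κ V)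
    -- After integrating the modulus over `X`, a constant multiple of the modulus of the gamma
    -- integrand with parameter `c - μ` is left.
    · refine (((gamma_integral hcμ hκ).1.norm).const_mul ‖gammaP p (μ.re : ℂ)‖).congr ?_
      filter_upwards [ae_posDef p] with V hV
      simp only [Function.uncurry_apply_pair, hF, norm_mul (gammaIntegrand c κ V)]
      rw [integral_const_mul, laplace_gen_norm hμ hV, hγ V hV, norm_mul, norm_detPow hV,
        Complex.neg_re]
      ring
  have hV : ∀ X : Matrix (Fin p) (Fin p) ℝ, X.PosDef → ∫ V, F V X ∂posMeasure p =
      gammaP p c * pochP c κ * betaIntegrand μ c κ X := by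
    intro X hX
    have h := (laplace_gen hc hκ (S := 1 + X) (Matrix.PosDef.one.add hX)).2
    have h2 : ∀ V, F V X = detPow X (μ - ((p : ℂ) + 1) / 2) * laplaceGen c κ (1 + X) V := by
      intro V
      simp only [hF, gammaIntegrand, laplaceGen]
      rw [etr_neg_one_add_mul]
      ring
    simp only [h2]
    rw [integral_const_mul, h, betaIntegrand]
    ring
  have hX : ∀ V : Matrix (Fin p) (Fin p) ℝ, V.PosDef → ∫ X, F V X ∂posMeasure p =
      gammaP p μ * gammaIntegrand (c - μ) κ V := by
    intro V hV
    simp only [hF]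
    rw [integral_const_mul, (laplace_gen_zero hμ hV).2, hγ V hV]
    ring
  have hne : gammaP p c * pochP c κ ≠ 0 := mul_ne_zero (gammaP_ne_zero hc) (pochP_ne_zero hc κ)
  constructor
  · have h := hint.integral_prod_right.const_mul (gammaP p c * pochP c κ)⁻¹
    refine h.congr ((ae_posDef p).mono fun X hX' => ?_)
    simp only [Function.uncurry_apply_pair]
    rw [hV X hX', inv_mul_cancel_left₀ hne]
  · have h := integral_integral_swap hint
    rw [integral_congr_posDef hX, integral_congr_posDef hV, integral_const_mul, integral_const_mul,
      (gamma_integral hcμ hκ).2] at h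
    exact h.symm

/-! ### The double integral -/

/-- The `X`-dependent factor `|X|^{μ-(p+1)/2} |I+X|^e`. -/
noncomputable def confluentWeight {p : ℕ} (μ e : ℂ) (X : Matrix (Fin p) (Fin p) ℝ) : ℂ :=
  detPow X (μ - ((p : ℂ) + 1) / 2) * detPow (1 + X) e

lemma measurable_confluentWeight {p : ℕ} (μ e : ℂ) :
    Measurable (confluentWeight (p := p) μ e) :=
  (measurable_detPow _).mul (measurable_detPow_one_add _)

lemma confluentM_eq {p : ℕ} (μ e : ℂ) (Z : Matrix (Fin p) (Fin p) ℝ) :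
    confluentM μ (e + ((p : ℂ) + 1) / 2) Z =
      ∫ X, confluentWeight μ e X * etr (-(Z * X)) ∂posMeasure p := by
  rw [confluentM, posInt_eq]
  simp only [add_sub_cancel_right, confluentWeight]

/-- The integrand of the double integral. -/
noncomputable def doubleKernel {p : ℕ} (b μ e : ℂ) (κ : Fin p → ℕ) (D : Matrix (Fin p) (Fin p) ℝ)
    (Z X : Matrix (Fin p) (Fin p) ℝ) : ℂ :=
  laplaceGen b κ D Z * (confluentWeight μ e X * etr (-(Z * X)))

lemma measurable_doubleKernel {p : ℕ} (b μ e : ℂ) (κ : Fin p → ℕ)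
    (D : Matrix (Fin p) (Fin p) ℝ) :
    Measurable (Function.uncurry (doubleKernel b μ e κ D)) :=
  ((measurable_laplaceGen b κ D).comp measurable_fst).mul
    (((measurable_confluentWeight μ e).comp measurable_snd).mul continuous_etr_neg_mul.measurable)

lemma det_smul_one_add {p : ℕ} {δ : ℝ} {X : Matrix (Fin p) (Fin p) ℝ} :
    (δ • (1 + X)).det = δ ^ p * (1 + X).det := by
  rw [Matrix.det_smul, Fintype.card_fin]

/-- Integrating the modulus over the first variable gives a constant times `|I+X|^{-Re b}`, which
combines with the weight to the modulus of a beta integrand with `κ = 0`. -/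
lemma integrable_dominating_kernel {p : ℕ} {b μ c : ℂ} (hb : ((p : ℝ) - 1) / 2 < b.re)
    (hμ : ((p : ℝ) - 1) / 2 < μ.re) (hcμ : ((p : ℝ) - 1) / 2 < (c - μ).re)
    (hc : ((p : ℝ) - 1) / 2 < c.re) {δ : ℝ} (hδ : 0 < δ) :
    Integrable (fun x : Matrix (Fin p) (Fin p) ℝ × Matrix (Fin p) (Fin p) ℝ =>
      detPow x.1 (b - ((p : ℂ) + 1) / 2) * etr (-((δ • (1 + x.2)) * x.1)) *
        confluentWeight μ (b - c) x.2) ((posMeasure p).prod (posMeasure p)) := by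
  have hm : Measurable (fun x : Matrix (Fin p) (Fin p) ℝ × Matrix (Fin p) (Fin p) ℝ =>
      detPow x.1 (b - ((p : ℂ) + 1) / 2) * etr (-((δ • (1 + x.2)) * x.1)) *
        confluentWeight μ (b - c) x.2) := by
    refine (((measurable_detPow _).comp measurable_fst).mul ?_).mul
      ((measurable_confluentWeight μ _).comp measurable_snd)
    exact (continuous_etr.comp (by fun_prop)).measurable
  have hS : ∀ X : Matrix (Fin p) (Fin p) ℝ, X.PosDef → (δ • (1 + X)).PosDef := fun X hX =>
    (Matrix.PosDef.one.add hX).smul hδ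
  rw [integrable_prod_iff' hm.aestronglyMeasurable]
  constructor
  · filter_upwards [ae_posDef p] with X hX
    exact (laplace_gen_zero hb (hS X hX)).1.mul_const _
  · have h := ((beta_integral hμ hcμ hc (κ := 0) antitone_const).1.norm).const_mul
      (‖gammaP p (b.re : ℂ)‖ * (δ ^ p) ^ (-b.re))
    refine h.congr ((ae_posDef p).mono fun X hX => ?_)
    have hX1 : (1 + X).PosDef := Matrix.PosDef.one.add hX
    simp only [norm_mul _ (confluentWeight μ (b - c) X)]
    rw [integral_mul_const, laplace_gen_norm hb (hS X hX), det_smul_one_add,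
      Real.mul_rpow (by positivity) hX1.det_pos.le, betaIntegrand, confluentWeight, genPow_zero,
      Complex.ofReal_one, mul_one, norm_mul, norm_mul, norm_detPow hX1, norm_detPow hX1]
    have : (1 + X).det ^ (-c).re = (1 + X).det ^ (-b.re) * (1 + X).det ^ (b - c).re := by
      rw [← Real.rpow_add hX1.det_pos, Complex.neg_re, Complex.sub_re]
      congr 1
      ring
    rw [this]
    ring

/-- Since `tr(DZ) ≥ δ tr Z`, part of the exponential decay can pay for the growth of `Δ_κ` while the
rest dominates the kernel as in `integrable_dominating_kernel`. -/
lemma integrable_doubleKernel {p : ℕ} {b μ c : ℂ} (hb : ((p : ℝ) - 1) / 2 < b.re)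
    (hμ : ((p : ℝ) - 1) / 2 < μ.re) (hcμ : ((p : ℝ) - 1) / 2 < (c - μ).re)
    (hc : ((p : ℝ) - 1) / 2 < c.re) (κ : Fin p → ℕ) {D : Matrix (Fin p) (Fin p) ℝ} {δ : ℝ}
    (hδ : 0 < δ) (hδ1 : δ ≤ 1) (hD : (D - δ • 1).PosSemidef) :
    Integrable (Function.uncurry (doubleKernel b μ (b - c) κ D))
      ((posMeasure p).prod (posMeasure p)) := by
  -- One half of `δ` absorbs the generalized power; the other half stays in the dominating kernel.
  obtain ⟨A, hA⟩ := abs_genPow_le_exp κ (half_pos hδ)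
  have h := (integrable_dominating_kernel hb hμ hcμ hc (half_pos hδ)).norm.const_mul A
  refine h.mono' (measurable_doubleKernel b μ (b - c) κ D).aestronglyMeasurable
    ((ae_prod_posDef p).mono ?_)
  rintro ⟨Z, X⟩ ⟨hZ, hX⟩
  simp only at hZ hX
  have h1 : δ * Z.trace ≤ (D * Z).trace := by
    have := trace_mul_nonneg_of_posSemidef hD hZ
    rw [Matrix.sub_mul, Matrix.trace_sub, Matrix.smul_mul, one_mul, Matrix.trace_smul,
      smul_eq_mul] at this
    linarith
  -- The bound `δ ≤ 1` enters here: the dominating kernel keeps only the fraction `δ/2` of `tr(ZX)`.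
  have h2 : δ / 2 * (Z * X).trace ≤ (Z * X).trace := by
    have := trace_mul_nonneg_of_posSemidef hZ.posSemidef hX
    nlinarith
  have h3 : (-((δ / 2) • (1 + X) * Z)).trace = -(δ / 2 * Z.trace) - δ / 2 * (Z * X).trace := by
    rw [Matrix.trace_neg, Matrix.smul_mul, Matrix.trace_smul, Matrix.add_mul, Matrix.trace_add,
      one_mul, Matrix.trace_mul_comm X Z, smul_eq_mul]
    ring
  have h4 : |genPow κ Z| * (Real.exp (-(D * Z).trace) * Real.exp (-(Z * X).trace)) ≤
      A * Real.exp (-((δ / 2) • (1 + X) * Z)).trace := by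
    have hA0 := hA Z hZ
    have hAnn : 0 ≤ A := by
      by_contra hneg
      have := abs_nonneg (genPow κ Z)
      have := mul_neg_of_neg_of_pos (not_le.1 hneg) (Real.exp_pos (δ / 2 * Z.trace))
      linarith
    calc |genPow κ Z| * (Real.exp (-(D * Z).trace) * Real.exp (-(Z * X).trace))
        ≤ (A * Real.exp (δ / 2 * Z.trace)) *
          (Real.exp (-(D * Z).trace) * Real.exp (-(Z * X).trace)) := by gcongr
      _ = A * Real.exp (δ / 2 * Z.trace - (D * Z).trace - (Z * X).trace) := by
          rw [mul_assoc, ← Real.exp_add, ← Real.exp_add]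
          ring_nf
      _ ≤ _ := by
          rw [h3]
          gcongr
          linarith
  simp only [Function.uncurry_apply_pair, doubleKernel, laplaceGen, norm_mul, norm_etr,
    Matrix.trace_neg, Complex.norm_real, Real.norm_eq_abs] at h4 ⊢
  calc _ = ‖detPow Z (b - ((p : ℂ) + 1) / 2)‖ * ‖confluentWeight μ (b - c) X‖ *
        (|genPow κ Z| * (Real.exp (-(D * Z).trace) * Real.exp (-(Z * X).trace))) := by ring
    _ ≤ ‖detPow Z (b - ((p : ℂ) + 1) / 2)‖ * ‖confluentWeight μ (b - c) X‖ *
        (A * Real.exp (-((δ / 2) • (1 + X) * Z).trace)) := by gcongr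
    _ = _ := by ring

/-- The weighted confluent function `|Z|^{b-(p+1)/2} e^{-tr(DZ)} M(μ, ν; Z)`. -/
noncomputable def confluentDensity {p : ℕ} (b μ e : ℂ) (D Z : Matrix (Fin p) (Fin p) ℝ) : ℂ :=
  detPow Z (b - ((p : ℂ) + 1) / 2) * etr (-(D * Z)) * confluentM μ (e + ((p : ℂ) + 1) / 2) Z

lemma integral_doubleKernel_right {p : ℕ} (b μ e : ℂ) (κ : Fin p → ℕ)
    (D Z : Matrix (Fin p) (Fin p) ℝ) :
    ∫ X, doubleKernel b μ e κ D Z X ∂posMeasure p =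
      confluentDensity b μ e D Z * (genPow κ Z : ℂ) := by
  simp only [doubleKernel]
  rw [integral_const_mul, confluentDensity, confluentM_eq, laplaceGen]
  ring

/-- Fubini: for fixed `X` the two exponentials merge, and the integral over `Z` is the Laplace
transform of a generalized power at `D + X`. -/
lemma confluentDensity_integral {p : ℕ} {b μ c : ℂ} (hb : ((p : ℝ) - 1) / 2 < b.re)
    (hμ : ((p : ℝ) - 1) / 2 < μ.re) (hcμ : ((p : ℝ) - 1) / 2 < (c - μ).re)
    (hc : ((p : ℝ) - 1) / 2 < c.re) {κ : Fin p → ℕ} (hκ : Antitone κ)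
    {D : Matrix (Fin p) (Fin p) ℝ} {δ : ℝ}
    (hδ : 0 < δ) (hδ1 : δ ≤ 1) (hD : (D - δ • 1).PosSemidef) :
    Integrable (fun Z => confluentDensity b μ (b - c) D Z * (genPow κ Z : ℂ)) (posMeasure p) ∧
    ∫ Z, confluentDensity b μ (b - c) D Z * (genPow κ Z : ℂ) ∂posMeasure p =
      gammaP p b * pochP b κ * ∫ X, confluentWeight μ (b - c) X *
        (detPow (D + X) (-b) * (genPow κ (D + X)⁻¹ : ℂ)) ∂posMeasure p := by
  have hint := integrable_doubleKernel hb hμ hcμ hc κ hδ hδ1 hD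
  have hDp : D.PosDef := by
    have := (Matrix.PosDef.one.smul hδ).add_posSemidef hD
    simpa using this
  constructor
  · simpa only [Function.uncurry_apply_pair, integral_doubleKernel_right] using
      hint.integral_prod_left
  · have h := integral_integral_swap hint
    simp only [integral_doubleKernel_right] at h
    rw [h, ← integral_const_mul]
    refine integral_congr_posDef fun X hX => ?_
    have h1 : ∀ Z, doubleKernel b μ (b - c) κ D Z X =
        confluentWeight μ (b - c) X * laplaceGen b κ (D + X) Z := by
      intro Z
      have h2 : etr (-((D + X) * Z)) = etr (-(D * Z)) * etr (-(Z * X)) := by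
        rw [etr_mul_comm Z X, ← etr_add]
        congr 1
        noncomm_ring
      rw [doubleKernel, laplaceGen, laplaceGen, h2]
      ring
    simp only [h1]
    rw [integral_const_mul, (laplace_gen hb hκ (hDp.add hX)).2]
    ring

lemma confluentDensity_integral_zero {p : ℕ} {b μ c : ℂ} (hb : ((p : ℝ) - 1) / 2 < b.re)
    (hμ : ((p : ℝ) - 1) / 2 < μ.re) (hcμ : ((p : ℝ) - 1) / 2 < (c - μ).re)
    (hc : ((p : ℝ) - 1) / 2 < c.re) {D : Matrix (Fin p) (Fin p) ℝ} {δ : ℝ}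
    (hδ : 0 < δ) (hδ1 : δ ≤ 1) (hD : (D - δ • 1).PosSemidef) :
    Integrable (confluentDensity b μ (b - c) D) (posMeasure p) ∧
    ∫ Z, confluentDensity b μ (b - c) D Z ∂posMeasure p =
      gammaP p b * ∫ X, confluentWeight μ (b - c) X * detPow (D + X) (-b) ∂posMeasure p := by
  have h := confluentDensity_integral hb hμ hcμ hc (κ := 0) antitone_const hδ hδ1 hD
  have hp : pochP b (0 : Fin p → ℕ) = 1 := by simp [pochP]
  simpa only [genPow_zero, Complex.ofReal_one, mul_one, hp] using h

/-- Integrals of the confluent function against generalized powers. -/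
lemma confluentDensity_integral_genPow {p : ℕ} {b μ c : ℂ} (hb : ((p : ℝ) - 1) / 2 < b.re)
    (hμ : ((p : ℝ) - 1) / 2 < μ.re) (hcμ : ((p : ℝ) - 1) / 2 < (c - μ).re)
    (hc : ((p : ℝ) - 1) / 2 < c.re) {κ : Fin p → ℕ} (hκ : Antitone κ) :
    ∫ Z, confluentDensity b μ (b - c) 1 Z * (genPow κ Z : ℂ) ∂posMeasure p =
      gammaP p b * gammaP p μ * gammaP p (c - μ) / gammaP p c *
        (pochP (c - μ) κ * pochP b κ / pochP c κ) := by
  have h := (confluentDensity_integral hb hμ hcμ hc hκ (D := 1) one_pos le_rfl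
    (by simpa using Matrix.PosSemidef.zero)).2
  have hbeta := (beta_integral hμ hcμ hc hκ).2
  have h1 : ∀ X : Matrix (Fin p) (Fin p) ℝ, X.PosDef → confluentWeight μ (b - c) X *
      (detPow (1 + X) (-b) * (genPow κ (1 + X)⁻¹ : ℂ)) = betaIntegrand μ c κ X := by
    intro X hX
    have : -c = (b - c) + -b := by ring
    rw [betaIntegrand, this, detPow_add (Matrix.PosDef.one.add hX), confluentWeight]
    ring
  rw [h, integral_congr_posDef h1]
  have hc1 := gammaP_ne_zero hc
  have hc2 := pochP_ne_zero hc κ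
  field_simp
  linear_combination (gammaP p b * pochP b κ) * hbeta

/-! ### The substitution `X ↦ X⁻¹` -/

/-- Inversion of symmetric matrices in coordinates. -/
noncomputable def invCoord {p : ℕ} (z : SymCoord p) : SymCoord p := upperOf (symOf z)⁻¹

lemma Matrix.IsSymm.inv_real {p : ℕ} {X : Matrix (Fin p) (Fin p) ℝ} (hX : X.IsSymm) :
    X⁻¹.IsSymm := by
  rw [Matrix.IsSymm, Matrix.transpose_nonsing_inv, hX.eq]

lemma symOf_invCoord {p : ℕ} (z : SymCoord p) : symOf (invCoord z) = (symOf z)⁻¹ :=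
  symOf_upperOf (symOf_isSymm z).inv_real

section
attribute [local instance] Matrix.linftyOpNormedRing Matrix.linftyOpNormedAlgebra

/-- The derivative of inversion at `X` is `Y ↦ -X⁻¹ Y X⁻¹`, a congruence because `X⁻¹` is symmetric.
The local norm on matrices serves only to differentiate the ring inverse. -/
lemma hasFDerivAt_invCoord {p : ℕ} {z : SymCoord p} (hz : z ∈ posCone p) :
    HasFDerivAt invCoord (-LinearMap.toContinuousLinearMap (conjLin (symOf z)⁻¹)) z := by
  have hz' : (symOf z).PosDef := hz
  have hu : IsUnit (symOf z) := (Matrix.isUnit_iff_isUnit_det _).2 hz'.det_pos.ne'.isUnit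
  obtain ⟨u, hu⟩ := hu
  have huinv : ((u⁻¹ : (Matrix (Fin p) (Fin p) ℝ)ˣ) : Matrix (Fin p) (Fin p) ℝ) =
      (symOf z)⁻¹ := by rw [Matrix.coe_units_inv, hu]
  have h1 := (LinearMap.toContinuousLinearMap (symLin p)).hasFDerivAt (x := z)
  have h2 := hasFDerivAt_ringInverse (𝕜 := ℝ) u
  rw [hu] at h2
  have h3 := (LinearMap.toContinuousLinearMap (upperLin p)).hasFDerivAt
    (x := Ring.inverse (symOf z))
  have h4 := h3.comp z (h2.comp z h1)
  have hfun : (⇑(LinearMap.toContinuousLinearMap (upperLin p)) ∘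
      (Ring.inverse ∘ symOf)) = invCoord := by
    funext y
    simp only [Function.comp_apply, invCoord, Matrix.nonsing_inv_eq_ringInverse]
    rfl
  rw [hfun] at h4
  refine h4.congr_fderiv ?_
  refine ContinuousLinearMap.ext fun y => ?_
  have ht : ((symOf z)⁻¹).transpose = (symOf z)⁻¹ := (symOf_isSymm z).inv_real
  have h5 : conjLin (symOf z)⁻¹ y = upperOf ((symOf z)⁻¹ * symOf y * (symOf z)⁻¹) := by
    rw [← upperOf_symOf (conjLin (symOf z)⁻¹ y), symOf_conjLin, ht]
  simp only [neg_apply, huinv, LinearMap.coe_toContinuousLinearMap', h5]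
  rfl

end

lemma invCoord_involutive_on {p : ℕ} {z : SymCoord p} (hz : z ∈ posCone p) :
    invCoord (invCoord z) = z := by
  have hz' : (symOf z).PosDef := hz
  refine symOf_injective p ?_
  rw [symOf_invCoord, symOf_invCoord, Matrix.nonsing_inv_nonsing_inv _ hz'.det_pos.ne'.isUnit]

lemma invCoord_mem {p : ℕ} {z : SymCoord p} (hz : z ∈ posCone p) : invCoord z ∈ posCone p := by
  have hz' : (symOf z).PosDef := hz
  change (symOf (invCoord z)).PosDef
  rw [symOf_invCoord]
  exact hz'.inv

/-- Inversion is an involution of the cone, and its Jacobian is that of the congruence by `X⁻¹`, up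
to a sign that disappears in the absolute value. -/
lemma integral_inv_posMeasure {p : ℕ} (f : Matrix (Fin p) (Fin p) ℝ → ℂ) :
    ∫ X, f X ∂posMeasure p = ∫ X, ((X.det ^ (p + 1))⁻¹ : ℝ) • f X⁻¹ ∂posMeasure p := by
  have himg : invCoord '' posCone p = posCone p := by
    ext z
    constructor
    · rintro ⟨y, hy, rfl⟩
      exact invCoord_mem hy
    · exact fun hz => ⟨_, invCoord_mem hz, invCoord_involutive_on hz⟩
  have hinj : Set.InjOn (invCoord (p := p)) (posCone p) := fun y hy z hz h => by
    rw [← invCoord_involutive_on hy, h, invCoord_involutive_on hz]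
  have h := integral_image_eq_integral_abs_det_fderiv_smul volume (measurableSet_posCone p)
    (fun z hz => (hasFDerivAt_invCoord hz).hasFDerivWithinAt) hinj fun z => f (symOf z)
  rw [himg] at h
  unfold posMeasure
  rw [(measurableEmbedding_symOf p).integral_map, (measurableEmbedding_symOf p).integral_map, h]
  refine setIntegral_congr_fun (measurableSet_posCone p) fun z hz => ?_
  have hz' : (symOf z).PosDef := hz
  have hdet : |(-LinearMap.toContinuousLinearMap (conjLin (symOf z)⁻¹)).det| =
      ((symOf z).det ^ (p + 1))⁻¹ := by
    have h1 : ((-LinearMap.toContinuousLinearMap (conjLin (symOf z)⁻¹) :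
        SymCoord p →L[ℝ] SymCoord p) : SymCoord p →ₗ[ℝ] SymCoord p) =
        (-1 : ℝ) • conjLin (symOf z)⁻¹ := by
      ext; simp
    rw [ContinuousLinearMap.det, h1, LinearMap.det_smul, abs_mul, abs_pow, abs_neg, abs_one,
      one_pow, one_mul, det_conjLin _ hz'.inv.det_pos.ne', Matrix.det_nonsing_inv,
      Ring.inverse_eq_inv', inv_pow, abs_of_pos (inv_pos.2 (pow_pos hz'.det_pos _))]
  rw [hdet, symOf_invCoord]

/-- Kummer's transformation for the double integral. -/
lemma integral_confluentWeight_inv {p : ℕ} (b μ c : ℂ) {D : Matrix (Fin p) (Fin p) ℝ}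
    (hD : D.PosDef) :
    ∫ X, confluentWeight μ (b - c) X * detPow (D + X) (-b) ∂posMeasure p =
      detPow D (-b) * ∫ X, confluentWeight (c - μ) (b - c) X * detPow (D⁻¹ + X) (-b)
        ∂posMeasure p := by
  rw [integral_inv_posMeasure, ← integral_const_mul]
  refine integral_congr_posDef fun X hX => ?_
  have hX1 : (1 + X).PosDef := Matrix.PosDef.one.add hX
  have hDX : (D⁻¹ + X).PosDef := hD.inv.add hX
  have hXX : X * X⁻¹ = 1 := Matrix.mul_nonsing_inv _ hX.det_pos.ne'.isUnit
  have hDD : D * D⁻¹ = 1 := Matrix.mul_nonsing_inv _ hD.det_pos.ne'.isUnit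
  have h1 : (((X.det ^ (p + 1))⁻¹ : ℝ) : ℂ) = detPow X (-((p : ℂ) + 1)) := by
    rw [detPow, Complex.cpow_neg]
    push_cast
    congr 1
    exact_mod_cast (Complex.cpow_natCast (X.det : ℂ) (p + 1)).symm
  have h2 : detPow (1 + X⁻¹) (b - c) = detPow (1 + X) (b - c) * detPow X (-(b - c)) := by
    have : 1 + X⁻¹ = (1 + X) * X⁻¹ := by rw [add_mul, one_mul, hXX, add_comm]
    rw [this, detPow_mul hX1.det_pos.le hX.inv.det_pos.le, detPow_inv hX]
  have h3 : detPow (D + X⁻¹) (-b) = detPow D (-b) * detPow (D⁻¹ + X) (-b) * detPow X b := by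
    have : D + X⁻¹ = D * (D⁻¹ + X) * X⁻¹ := by
      rw [mul_add, hDD, add_mul, one_mul, Matrix.mul_assoc, hXX, mul_one, add_comm]
    have hpos : 0 ≤ (D * (D⁻¹ + X)).det := by
      rw [Matrix.det_mul]
      exact (mul_pos hD.det_pos hDX.det_pos).le
    rw [this, detPow_mul hpos hX.inv.det_pos.le, detPow_mul hD.det_pos.le hDX.det_pos.le,
      detPow_inv hX, neg_neg]
  -- The powers of `|X|` from the Jacobian, `|X⁻¹|`, `|I+X⁻¹|` and `|D+X⁻¹|` add up to the original
  -- exponent with `c - μ` in place of `μ`.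
  have h4 : detPow X (c - μ - ((p : ℂ) + 1) / 2) =
      detPow X (-((p : ℂ) + 1)) * detPow X (-(μ - ((p : ℂ) + 1) / 2)) *
        detPow X (-(b - c)) * detPow X b := by
    rw [← detPow_add hX, ← detPow_add hX, ← detPow_add hX]
    congr 1
    ring
  rw [Complex.real_smul, h1, confluentWeight, confluentWeight, h2, h3, h4, detPow_inv hX]
  ring

/-! ### Spherical polynomials -/

instance (p : ℕ) : SecondCountableTopology (Matrix.orthogonalGroup (Fin p) ℝ) :=
  TopologicalSpace.Subtype.secondCountableTopology _

instance (p : ℕ) : (orthHaar p).IsHaarMeasure := by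
  unfold orthHaar
  infer_instance

instance (p : ℕ) : IsProbabilityMeasure (orthHaar p) := by
  refine ⟨?_⟩
  have h := Measure.haarMeasure_self
    (K₀ := (⊤ : TopologicalSpace.PositiveCompacts (Matrix.orthogonalGroup (Fin p) ℝ)))
  simpa [orthHaar] using h

/-- Compact groups are unimodular: a right translate of the Haar probability measure is again one,
hence the same. -/
instance (p : ℕ) : (orthHaar p).IsMulRightInvariant := by
  refine ⟨fun g => ?_⟩
  have : IsProbabilityMeasure ((orthHaar p).map (· * g)) :=
    Measure.isProbabilityMeasure_map (measurable_mul_const g).aemeasurable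
  exact Measure.isHaarMeasure_eq_of_isProbabilityMeasure _ _

lemma orth_mul_transpose {p : ℕ} (H : Matrix.orthogonalGroup (Fin p) ℝ) :
    (H : Matrix (Fin p) (Fin p) ℝ) * (H : Matrix (Fin p) (Fin p) ℝ).transpose = 1 :=
  (Matrix.mem_orthogonalGroup_iff (Fin p) ℝ).1 H.2

lemma orth_transpose_mul {p : ℕ} (H : Matrix.orthogonalGroup (Fin p) ℝ) :
    (H : Matrix (Fin p) (Fin p) ℝ).transpose * (H : Matrix (Fin p) (Fin p) ℝ) = 1 :=
  (Matrix.mem_orthogonalGroup_iff' (Fin p) ℝ).1 H.2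

lemma orth_det_sq {p : ℕ} (H : Matrix.orthogonalGroup (Fin p) ℝ) :
    (H : Matrix (Fin p) (Fin p) ℝ).det ^ 2 = 1 := by
  have := congrArg Matrix.det (orth_mul_transpose H)
  rwa [Matrix.det_mul, Matrix.det_transpose, Matrix.det_one, ← sq] at this

lemma orth_det_ne_zero {p : ℕ} (H : Matrix.orthogonalGroup (Fin p) ℝ) :
    (H : Matrix (Fin p) (Fin p) ℝ).det ≠ 0 := fun h => by
  have := orth_det_sq H
  simp [h] at this

lemma abs_orth_det {p : ℕ} (H : Matrix.orthogonalGroup (Fin p) ℝ) :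
    |(H : Matrix (Fin p) (Fin p) ℝ).det| = 1 := by
  have h := orth_det_sq H
  rw [← sq_abs] at h
  exact (pow_eq_one_iff_of_nonneg (abs_nonneg _) two_ne_zero).1 h

/-- The conjugate `H X Hᵀ`. -/
def orthConj {p : ℕ} (H : Matrix.orthogonalGroup (Fin p) ℝ) (X : Matrix (Fin p) (Fin p) ℝ) :
    Matrix (Fin p) (Fin p) ℝ :=
  (H : Matrix (Fin p) (Fin p) ℝ) * X * (H : Matrix (Fin p) (Fin p) ℝ).transpose

lemma orthConj_mul {p : ℕ} (H K : Matrix.orthogonalGroup (Fin p) ℝ)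
    (X : Matrix (Fin p) (Fin p) ℝ) : orthConj (H * K) X = orthConj H (orthConj K X) := by
  simp only [orthConj, Submonoid.coe_mul, Matrix.transpose_mul, Matrix.mul_assoc]

lemma trace_orthConj {p : ℕ} (H : Matrix.orthogonalGroup (Fin p) ℝ)
    (X : Matrix (Fin p) (Fin p) ℝ) : (orthConj H X).trace = X.trace := by
  rw [orthConj, Matrix.trace_mul_comm, ← Matrix.mul_assoc, orth_transpose_mul, one_mul]

lemma det_orthConj {p : ℕ} (H : Matrix.orthogonalGroup (Fin p) ℝ)
    (X : Matrix (Fin p) (Fin p) ℝ) : (orthConj H X).det = X.det := by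
  rw [orthConj, Matrix.det_mul, Matrix.det_mul, Matrix.det_transpose]
  linear_combination X.det * orth_det_sq H

lemma orthConj_one_mat {p : ℕ} (H : Matrix.orthogonalGroup (Fin p) ℝ) :
    orthConj H (1 : Matrix (Fin p) (Fin p) ℝ) = 1 := by
  rw [orthConj, mul_one, orth_mul_transpose]

lemma orthConj_add {p : ℕ} (H : Matrix.orthogonalGroup (Fin p) ℝ)
    (X Y : Matrix (Fin p) (Fin p) ℝ) : orthConj H (X + Y) = orthConj H X + orthConj H Y := by
  simp only [orthConj, mul_add, add_mul]

lemma orthConj_matMul {p : ℕ} (H : Matrix.orthogonalGroup (Fin p) ℝ)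
    (X Y : Matrix (Fin p) (Fin p) ℝ) : orthConj H (X * Y) = orthConj H X * orthConj H Y := by
  have h : (H : Matrix (Fin p) (Fin p) ℝ) * X * (H : Matrix (Fin p) (Fin p) ℝ).transpose *
      (H * Y * (H : Matrix (Fin p) (Fin p) ℝ).transpose) =
      H * X * ((H : Matrix (Fin p) (Fin p) ℝ).transpose * H) * Y *
        (H : Matrix (Fin p) (Fin p) ℝ).transpose := by
    simp only [Matrix.mul_assoc]
  rw [orthConj, orthConj, orthConj, h, orth_transpose_mul, mul_one, ← Matrix.mul_assoc]

lemma posDef_orthConj {p : ℕ} (H : Matrix.orthogonalGroup (Fin p) ℝ)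
    {X : Matrix (Fin p) (Fin p) ℝ} (hX : X.PosDef) : (orthConj H X).PosDef :=
  (posDef_conj_iff (orth_det_ne_zero H)).2 hX

@[fun_prop] lemma continuous_orthConj {p : ℕ} :
    Continuous fun x : Matrix.orthogonalGroup (Fin p) ℝ × Matrix (Fin p) (Fin p) ℝ =>
      orthConj x.1 x.2 := by
  unfold orthConj
  fun_prop

lemma integrable_orthHaar {p : ℕ} {f : Matrix.orthogonalGroup (Fin p) ℝ → ℝ} (hf : Continuous f) :
    Integrable f (orthHaar p) :=
  hf.integrable_of_hasCompactSupport (HasCompactSupport.of_compactSpace f)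

lemma continuous_genPow_orthConj {p : ℕ} (κ : Fin p → ℕ) (X : Matrix (Fin p) (Fin p) ℝ) :
    Continuous fun H : Matrix.orthogonalGroup (Fin p) ℝ => genPow κ (orthConj H X) :=
  (continuous_genPow κ).comp (continuous_orthConj.comp (by fun_prop : Continuous fun H => (H, X)))

lemma sphericalPoly_eq {p : ℕ} (κ : Fin p → ℕ) (X : Matrix (Fin p) (Fin p) ℝ) :
    sphericalPoly κ X = ∫ H, genPow κ (orthConj H X) ∂orthHaar p := rfl

lemma sphericalPoly_orthConj {p : ℕ} (κ : Fin p → ℕ) (Q : Matrix.orthogonalGroup (Fin p) ℝ)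
    (X : Matrix (Fin p) (Fin p) ℝ) : sphericalPoly κ (orthConj Q X) = sphericalPoly κ X := by
  simp only [sphericalPoly_eq, ← orthConj_mul]
  exact integral_mul_right_eq_self (fun H => genPow κ (orthConj H X)) Q

/-- The functional equation of spherical functions. -/
lemma integral_sphericalPoly_split {p : ℕ} (κ : Fin p → ℕ) (N : Matrix (Fin p) (Fin p) ℝ)
    {G : Matrix (Fin p) (Fin p) ℝ} (hG : G.det ≠ 0) :
    ∫ H, sphericalPoly κ (G * orthConj H N * G.transpose) ∂orthHaar p =
      sphericalPoly κ N * sphericalPoly κ (G * G.transpose) := by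
  simp only [sphericalPoly_eq κ (G * _), sphericalPoly_eq κ (G * _ * _)]
  rw [integral_integral_swap, ← integral_const_mul]
  · refine integral_congr_ae (ae_of_all _ fun K => ?_)
    simp only
    -- After exchanging the averages, factor `K G = T Q` with `T` lower triangular and `Q`
    -- orthogonal. Then `T` splits off `Δ_κ(T Tᵀ) = Δ_κ(K G Gᵀ Kᵀ)`, and `Q` disappears by left
    -- invariance of the average over `H`.
    set M : Matrix (Fin p) (Fin p) ℝ := (K : Matrix (Fin p) (Fin p) ℝ) * G with hM
    have hMdet : M.det ≠ 0 := by
      rw [hM, Matrix.det_mul]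
      exact mul_ne_zero (orth_det_ne_zero K) hG
    have hMM : (M * M.transpose).PosDef := by
      have := (posDef_conj_iff hMdet (X := 1)).2 Matrix.PosDef.one
      rwa [mul_one] at this
    obtain ⟨T, hT, hTdet, hTT⟩ := hMM.exists_lowerTri
    have hTu : IsUnit T.det := isUnit_iff_ne_zero.2 hTdet
    have hQ : T⁻¹ * M ∈ Matrix.orthogonalGroup (Fin p) ℝ := by
      rw [Matrix.mem_orthogonalGroup_iff]
      change T⁻¹ * M * (T⁻¹ * M).transpose = 1
      rw [Matrix.transpose_mul, Matrix.mul_assoc, ← Matrix.mul_assoc M, hTT,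
        ← Matrix.mul_assoc, ← Matrix.mul_assoc, Matrix.nonsing_inv_mul _ hTu, one_mul,
        ← Matrix.transpose_mul, Matrix.nonsing_inv_mul _ hTu, Matrix.transpose_one]
    have hMT : M = T * (T⁻¹ * M) := by
      rw [← Matrix.mul_assoc, Matrix.mul_nonsing_inv _ hTu, one_mul]
    obtain ⟨Q, hQM⟩ : ∃ Q : Matrix.orthogonalGroup (Fin p) ℝ,
        M = T * (Q : Matrix (Fin p) (Fin p) ℝ) := ⟨⟨_, hQ⟩, hMT⟩
    have h1 : orthConj K (G * G.transpose) = T * T.transpose := by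
      rw [← hTT, hM, orthConj, Matrix.transpose_mul]
      simp only [Matrix.mul_assoc]
    have h2 : ∀ H, genPow κ (orthConj K (G * orthConj H N * G.transpose)) =
        genPow κ (T * T.transpose) *
          genPow κ (orthConj (Q * H) N) := by
      intro H
      rw [← genPow_mul_mul_transpose κ hT, orthConj_mul]
      congr 1
      have : orthConj K (G * orthConj H N * G.transpose) =
          M * orthConj H N * M.transpose := by
        rw [hM, orthConj, Matrix.transpose_mul]
        simp only [Matrix.mul_assoc]
      rw [this, hQM, orthConj, orthConj]
      simp only [Matrix.transpose_mul, Matrix.mul_assoc]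
    simp only [h1, h2]
    rw [integral_const_mul, integral_mul_left_eq_self (fun H => genPow κ (orthConj H N)),
      ← sphericalPoly_eq, mul_comm]
  · refine Continuous.integrable_of_hasCompactSupport ?_ (HasCompactSupport.of_compactSpace _)
    refine (continuous_genPow κ).comp ?_
    unfold orthConj
    fun_prop

/-! ### Growth of spherical polynomials on diagonal matrices -/

/-- The exponent of the `j`-th leading minor in the generalized power. -/
def minorExp {p : ℕ} (κ : Fin p → ℕ) (j : Fin p) : ℕ :=
  κ j - if h : (j : ℕ) + 1 < p then κ ⟨(j : ℕ) + 1, h⟩ else 0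

lemma genPow_eq {p : ℕ} (κ : Fin p → ℕ) (X : Matrix (Fin p) (Fin p) ℝ) :
    genPow κ X = ∏ j, leadingMinor X j ^ minorExp κ j := rfl

/-- The product of the first `j + 1` entries. -/
def headProd {M : Type*} [CommMonoid M] {p : ℕ} (x : Fin p → M) (j : Fin p) : M :=
  ∏ i : Fin ((j : ℕ) + 1), x (Fin.castLE (Nat.succ_le_of_lt j.isLt) i)

lemma headProd_zero {M : Type*} [CommMonoid M] {p : ℕ} (x : Fin (p + 1) → M) :
    headProd x 0 = x 0 := by
  have : headProd x 0 = ∏ i : Fin 1, x (Fin.castLE (by omega) i) := rfl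
  rw [this, Fin.prod_univ_one]
  rfl

lemma headProd_succ {M : Type*} [CommMonoid M] {p : ℕ} (x : Fin (p + 1) → M) (j : Fin p) :
    headProd x j.succ = x 0 * headProd (fun i => x i.succ) j := by
  have : headProd x j.succ = ∏ i : Fin (((j : ℕ) + 1) + 1), x (Fin.castLE (by omega) i) := rfl
  rw [this, Fin.prod_univ_succ]
  rfl

lemma minorExp_succ {p : ℕ} (κ : Fin (p + 1) → ℕ) (j : Fin p) :
    minorExp κ j.succ = minorExp (fun i => κ i.succ) j := by
  unfold minorExp
  simp only [Fin.val_succ, Nat.add_lt_add_iff_right]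
  rfl

/-- Summation by parts in multiplicative form: `x i` occurs in the head products from index `i` on,
and their exponents telescope to `κ i`. -/
lemma prod_headProd_pow {M : Type*} [CommMonoid M] {p : ℕ} (x : Fin p → M) {κ : Fin p → ℕ}
    (hκ : Antitone κ) : ∏ j, headProd x j ^ minorExp κ j = ∏ i, x i ^ κ i := by
  induction p with
  | zero => simp
  | succ p ih =>
    have h := sum_sub_next hκ
    change ∑ j, minorExp κ j = κ 0 at h
    rw [Fin.sum_univ_succ] at h
    rw [Fin.prod_univ_succ, Fin.prod_univ_succ, headProd_zero, ← h, pow_add, mul_assoc]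
    congr 1
    simp only [headProd_succ, mul_pow, Finset.prod_mul_distrib, minorExp_succ]
    rw [Finset.prod_pow_eq_pow_sum,
      ih (fun i => x i.succ) fun i j hij => hκ (Fin.succ_le_succ_iff.2 hij)]

/-- Put every `x i = 2` in `prod_headProd_pow` and compare exponents. This is the degree of the
generalized power. -/
lemma sum_mul_minorExp {p : ℕ} {κ : Fin p → ℕ} (hκ : Antitone κ) :
    ∑ j : Fin p, ((j : ℕ) + 1) * minorExp κ j = ∑ i, κ i := by
  have h := prod_headProd_pow (fun _ : Fin p => (2 : ℕ)) hκ
  simp only [headProd, Finset.prod_const, Finset.card_univ, Fintype.card_fin, ← pow_mul,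
    Finset.prod_pow_eq_pow_sum] at h
  exact Nat.pow_right_injective le_rfl h

lemma headProd_pos {p : ℕ} {x : Fin p → ℝ} (hx : ∀ i, 0 < x i) (j : Fin p) : 0 < headProd x j :=
  Finset.prod_pos fun _ _ => hx _

/-- Every eigenvalue of `1 + Q` is at least one, by its Rayleigh quotient at a unit eigenvector. -/
lemma one_le_det_one_add {n : ℕ} {Q : Matrix (Fin n) (Fin n) ℝ} (hQ : Q.PosSemidef) :
    1 ≤ (1 + Q).det := by
  have hH : (1 + Q).IsHermitian := Matrix.isHermitian_one.add hQ.1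
  rw [hH.det_eq_prod_eigenvalues]
  rw [← Finset.prod_const_one (s := (Finset.univ : Finset (Fin n)))]
  refine Finset.prod_le_prod (fun _ _ => zero_le_one) fun i _ => ?_
  have h1 := hH.eigenvalues_eq i
  rw [Matrix.add_mulVec, Matrix.one_mulVec, dotProduct_add] at h1
  have h2 := (Matrix.posSemidef_iff_dotProduct_mulVec.1 hQ).2 (hH.eigenvectorBasis i).ofLp
  have h3 : star (hH.eigenvectorBasis i).ofLp ⬝ᵥ (hH.eigenvectorBasis i).ofLp = 1 := by
    have := hH.eigenvectorBasis.orthonormal.1 i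
    have h4 := real_inner_self_eq_norm_sq (hH.eigenvectorBasis i)
    rw [this, EuclideanSpace.inner_eq_star_dotProduct] at h4
    simpa [dotProduct, mul_comm] using h4
  rw [h3] at h1
  simp only [map_add, RCLike.one_re, RCLike.re_to_real] at h1
  rw [h1]
  simpa using h2

/-- For invertible `B` pull out `B` and `Bᵀ`, leaving `1` plus a semidefinite matrix; for singular
`B` only nonnegativity is claimed. -/
lemma sq_det_le_det_add {n : ℕ} (B : Matrix (Fin n) (Fin n) ℝ) {Q : Matrix (Fin n) (Fin n) ℝ}
    (hQ : Q.PosSemidef) : B.det ^ 2 ≤ (B * B.transpose + Q).det := by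
  by_cases hB : B.det = 0
  · rw [hB, zero_pow two_ne_zero]
    have h1 : (B * B.transpose).PosSemidef := by
      have := Matrix.posSemidef_self_mul_conjTranspose B
      rwa [Matrix.conjTranspose_eq_transpose_of_trivial] at this
    exact (h1.add hQ).det_nonneg
  · have hu : IsUnit B.det := isUnit_iff_ne_zero.2 hB
    have hut : IsUnit B.transpose.det := by rwa [Matrix.det_transpose]
    have hQ' : (B⁻¹ * Q * B⁻¹.transpose).PosSemidef := by
      have := hQ.mul_mul_conjTranspose_same B⁻¹
      rwa [Matrix.conjTranspose_eq_transpose_of_trivial] at this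
    have h : B * B.transpose + Q = B * (1 + B⁻¹ * Q * B⁻¹.transpose) * B.transpose := by
      rw [mul_add, add_mul, mul_one, Matrix.transpose_nonsing_inv]
      congr 1
      rw [← Matrix.mul_assoc, ← Matrix.mul_assoc, Matrix.mul_nonsing_inv _ hu, one_mul,
        Matrix.mul_assoc, Matrix.nonsing_inv_mul _ hut, mul_one]
    rw [h, Matrix.det_mul, Matrix.det_mul, Matrix.det_transpose]
    nlinarith [one_le_det_one_add hQ', sq_nonneg B.det]

lemma leadingMinor_nonneg {p : ℕ} {X : Matrix (Fin p) (Fin p) ℝ} (hX : X.PosSemidef) (j : Fin p) :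
    0 ≤ leadingMinor X j :=
  (hX.submatrix _).det_nonneg

/-- Lower bound for the leading minors of `H diag(x) Hᵀ`. -/
lemma sq_leadingMinor_mul_le {p : ℕ} (H : Matrix.orthogonalGroup (Fin p) ℝ) {x : Fin p → ℝ}
    (hx : ∀ i, 0 < x i) (j : Fin p) :
    leadingMinor (H : Matrix (Fin p) (Fin p) ℝ) j ^ 2 * headProd x j ≤
      leadingMinor (orthConj H (Matrix.diagonal x)) j := by
  set e : Fin ((j : ℕ) + 1) → Fin p := Fin.castLE (Nat.succ_le_of_lt j.isLt) with he
  set A : Matrix (Fin p) (Fin p) ℝ := (H : Matrix (Fin p) (Fin p) ℝ) with hA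
  set B : Matrix (Fin ((j : ℕ) + 1)) (Fin ((j : ℕ) + 1)) ℝ :=
    A.submatrix e e * Matrix.diagonal fun i => √(x (e i)) with hB
  -- Split the diagonal after its first `j + 1` entries: the head yields `B Bᵀ`, the tail `y` a
  -- semidefinite remainder that can only increase the determinant.
  set y : Fin p → ℝ := fun l => if (l : ℕ) < (j : ℕ) + 1 then 0 else x l with hy
  have hQ : ((A * Matrix.diagonal y * A.transpose).submatrix e e).PosSemidef := by
    have h0 : (Matrix.diagonal y).PosSemidef := Matrix.posSemidef_diagonal_iff.2 fun l => by
      simp only [hy]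
      split_ifs
      exacts [le_rfl, (hx l).le]
    have := h0.mul_mul_conjTranspose_same A
    rw [Matrix.conjTranspose_eq_transpose_of_trivial] at this
    exact this.submatrix e
  have hsum : (A * Matrix.diagonal x * A.transpose).submatrix e e =
      B * B.transpose + (A * Matrix.diagonal y * A.transpose).submatrix e e := by
    ext a c
    simp only [Matrix.add_apply, Matrix.submatrix_apply]
    have hmul : ∀ z : Fin p → ℝ, (A * Matrix.diagonal z * A.transpose) (e a) (e c) =
        ∑ l, A (e a) l * z l * A (e c) l := by
      intro z
      simp [Matrix.mul_apply, Matrix.diagonal_apply]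
    rw [hmul, hmul, ← sub_eq_iff_eq_add, ← Finset.sum_sub_distrib,
      sum_eq_sum_castLE (Nat.succ_le_of_lt j.isLt) _ fun k hk => by
        simp only [hy, if_neg (not_lt.2 hk), sub_self]]
    rw [Matrix.mul_apply]
    refine Finset.sum_congr rfl fun i _ => ?_
    have : y (e i) = 0 := by simp only [hy, he, Fin.val_castLE, i.isLt, if_true]
    change A (e a) (e i) * x (e i) * A (e c) (e i) - A (e a) (e i) * y (e i) * A (e c) (e i) = _
    rw [this, Matrix.transpose_apply, hB, Matrix.mul_diagonal, Matrix.mul_diagonal,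
      Matrix.submatrix_apply, Matrix.submatrix_apply]
    have := Real.mul_self_sqrt (hx (e i)).le
    linear_combination -(A (e a) (e i) * A (e c) (e i)) * this
  have hdet : B.det ^ 2 = leadingMinor A j ^ 2 * headProd x j := by
    rw [hB, Matrix.det_mul, Matrix.det_diagonal, mul_pow, ← Finset.prod_pow]
    simp only [Real.sq_sqrt (hx _).le]
    rfl
  rw [← hdet]
  have : leadingMinor (orthConj H (Matrix.diagonal x)) j =
      ((A * Matrix.diagonal x * A.transpose).submatrix e e).det := rfl
  rw [this, hsum]
  exact sq_det_le_det_add B hQ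

/-- Multilinearity in the rows: the Cauchy–Binet expansion before terms are grouped by their set of
indices. -/
lemma det_mul_eq_sum {n p : ℕ} (A : Matrix (Fin n) (Fin p) ℝ) (M : Matrix (Fin p) (Fin n) ℝ) :
    (A * M).det = ∑ r : Fin n → Fin p, (∏ i, A i (r i)) * (M.submatrix r id).det := by
  have h1 : A * M = fun i => ∑ l, A i l • M l := by
    funext i
    ext c
    simp [Matrix.mul_apply, Finset.sum_apply]
  have h2 := (Matrix.detRowAlternating (R := ℝ) (n := Fin n)).toMultilinearMap.map_sum
    fun i l => A i l • M l
  change Matrix.detRowAlternating (A * M) = _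
  rw [h1]
  refine h2.trans (Finset.sum_congr rfl fun r _ => ?_)
  exact (Matrix.detRowAlternating (R := ℝ) (n := Fin n)).toMultilinearMap.map_smul_univ
    (fun i => A i (r i)) fun i => M (r i)

/-- List the chosen indices increasingly; the `i`-th is at least `i`, so the decreasing sequence `x`
is no larger there. -/
lemma prod_comp_le_prod {n p : ℕ} (h : n ≤ p) {x : Fin p → ℝ} (hx : ∀ i, 0 < x i)
    (hanti : Antitone x) {r : Fin n → Fin p} (hr : Function.Injective r) :
    ∏ i, x (r i) ≤ ∏ i : Fin n, x (Fin.castLE h i) := by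
  set s : Finset (Fin p) := Finset.univ.image r with hs
  have hcard : s.card = n := by
    rw [hs, Finset.card_image_of_injective _ hr, Finset.card_univ, Fintype.card_fin]
  have h1 : ∏ i, x (r i) = ∏ l ∈ s, x l := by
    rw [hs, Finset.prod_image fun a _ b _ hab => hr hab]
  have h2 : ∏ l ∈ s, x l = ∏ i : Fin n, x (s.orderEmbOfFin hcard i) := by
    rw [← Finset.prod_image (f := x) (g := s.orderEmbOfFin hcard)
      fun a _ b _ hab => (s.orderEmbOfFin hcard).injective hab]
    exact congrArg (fun t => ∏ l ∈ t, x l) (Finset.image_orderEmbOfFin_univ s hcard).symm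
  rw [h1, h2]
  refine Finset.prod_le_prod (fun i _ => (hx _).le) fun i _ => hanti ?_
  rw [Fin.le_def, Fin.val_castLE]
  have hm : StrictMono fun i : Fin n => ((s.orderEmbOfFin hcard i : Fin p) : ℕ) :=
    fun a b hab => (s.orderEmbOfFin hcard).strictMono hab
  obtain ⟨i, hi⟩ := i
  induction i with
  | zero => exact Nat.zero_le _
  | succ i ih =>
    exact Nat.succ_le_of_lt ((ih (by omega) (Finset.mem_univ _)).trans_lt
      (hm (a := ⟨i, by omega⟩) (b := ⟨i + 1, hi⟩) (Fin.mk_lt_mk.2 (Nat.lt_succ_self i))))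

/-- Upper bound for the leading minors of `H diag(x) Hᵀ`. -/
lemma leadingMinor_orthConj_diagonal_le {p : ℕ} (j : Fin p) : ∃ C : ℝ, 0 ≤ C ∧
    ∀ (H : Matrix.orthogonalGroup (Fin p) ℝ) (x : Fin p → ℝ), (∀ i, 0 < x i) → Antitone x →
      leadingMinor (orthConj H (Matrix.diagonal x)) j ≤ C * headProd x j := by
  set n := (j : ℕ) + 1 with hn
  refine ⟨∑ _r : Fin n → Fin p, (n.factorial : ℝ), by positivity, fun H x hx hanti => ?_⟩
  set e : Fin n → Fin p := Fin.castLE (Nat.succ_le_of_lt j.isLt) with he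
  set A : Matrix (Fin p) (Fin p) ℝ := (H : Matrix (Fin p) (Fin p) ℝ) with hA
  have hent : ∀ i l, |A i l| ≤ 1 := fun i l => entry_norm_bound_of_unitary (𝕜 := ℝ) H.2 i l
  have h1 : leadingMinor (orthConj H (Matrix.diagonal x)) j =
      ((A.submatrix e id) * (Matrix.diagonal x * A.transpose).submatrix id e).det := by
    have : (orthConj H (Matrix.diagonal x)).submatrix e e =
        (A.submatrix e id) * (Matrix.diagonal x * A.transpose).submatrix id e := by
      rw [orthConj, Matrix.mul_assoc]
      rfl
    exact congrArg Matrix.det this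
  rw [h1, det_mul_eq_sum, Finset.sum_mul]
  refine Finset.sum_le_sum fun r _ => ?_
  have hhp : 0 < headProd x j := headProd_pos hx j
  -- A non-injective choice repeats a row and contributes zero; an injective one carries at most the
  -- product of the largest entries of `x`.
  by_cases hr : Function.Injective r
  · have h2 : (((Matrix.diagonal x * A.transpose).submatrix id e).submatrix r id) =
        Matrix.diagonal (fun i => x (r i)) * (A.transpose.submatrix r e) := by
      ext a c
      simp [Matrix.diagonal_mul]
    rw [h2, Matrix.det_mul, Matrix.det_diagonal]
    have h3 : |∏ i, A.submatrix e id i (r i)| ≤ 1 := by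
      rw [Finset.abs_prod]
      exact Finset.prod_le_one (fun _ _ => abs_nonneg _) fun i _ => hent _ _
    have h4 : |(A.transpose.submatrix r e).det| ≤ n.factorial := by
      have := Matrix.det_le (A := A.transpose.submatrix r e) (abv := AbsoluteValue.abs) (x := 1)
        fun a b => hent _ _
      simpa using this
    have h5 : ∏ i, x (r i) ≤ headProd x j := prod_comp_le_prod _ hx hanti hr
    have h6 : 0 < ∏ i, x (r i) := Finset.prod_pos fun _ _ => hx _
    calc _ ≤ |(∏ i, A.submatrix e id i (r i)) *
          ((∏ i, x (r i)) * (A.transpose.submatrix r e).det)| := le_abs_self _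
      _ = |∏ i, A.submatrix e id i (r i)| *
          ((∏ i, x (r i)) * |(A.transpose.submatrix r e).det|) := by
          rw [abs_mul, abs_mul, abs_of_pos h6]
      _ ≤ 1 * (headProd x j * n.factorial) := by gcongr
      _ = _ := by ring
  · rw [Function.Injective] at hr
    push Not at hr
    obtain ⟨a, c, hac, hne⟩ := hr
    have h2 : (((Matrix.diagonal x * A.transpose).submatrix id e).submatrix r id).det = 0 := by
      refine Matrix.det_zero_of_row_eq hne ?_
      funext l
      simp only [Matrix.submatrix_apply, hac]
    rw [h2, mul_zero]
    positivity

lemma posDef_orthConj_diagonal {p : ℕ} (H : Matrix.orthogonalGroup (Fin p) ℝ) {x : Fin p → ℝ}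
    (hx : ∀ i, 0 < x i) : (orthConj H (Matrix.diagonal x)).PosDef :=
  posDef_orthConj H (Matrix.posDef_diagonal_iff.2 hx)

/-- Spherical polynomials grow like monomials in the Weyl chamber. -/
lemma sphericalPoly_diagonal_bounds {p : ℕ} {κ : Fin p → ℕ} (hκ : Antitone κ) :
    ∃ c C : ℝ, 0 < c ∧ 0 ≤ C ∧ ∀ x : Fin p → ℝ, (∀ i, 0 < x i) → Antitone x →
      c * ∏ i, x i ^ κ i ≤ sphericalPoly κ (Matrix.diagonal x) ∧
      sphericalPoly κ (Matrix.diagonal x) ≤ C * ∏ i, x i ^ κ i := by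
  choose B hB0 hB using leadingMinor_orthConj_diagonal_le (p := p)
  set f : Matrix.orthogonalGroup (Fin p) ℝ → ℝ := fun H =>
    ∏ j, (leadingMinor (H : Matrix (Fin p) (Fin p) ℝ) j ^ 2) ^ minorExp κ j with hf
  have hfc : Continuous f :=
    continuous_finsetProd _ fun j _ =>
      (((continuous_leadingMinor j).comp continuous_subtype_val).pow 2).pow _
  have hf0 : ∀ H, 0 ≤ f H := fun H => Finset.prod_nonneg fun j _ => by positivity
  -- The lower constant is positive because `f` is continuous, nonnegative and equal to one at the
  -- identity.
  refine ⟨∫ H, f H ∂orthHaar p, ∏ j, B j ^ minorExp κ j, ?_, ?_, fun x hx hanti => ⟨?_, ?_⟩⟩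
  · refine hfc.integral_pos_of_hasCompactSupport_nonneg_nonzero
      (HasCompactSupport.of_compactSpace _) hf0 (x := 1) ?_
    have : f 1 = 1 := by
      refine Finset.prod_eq_one fun j _ => ?_
      have : ((1 : Matrix.orthogonalGroup (Fin p) ℝ) : Matrix (Fin p) (Fin p) ℝ) = 1 := rfl
      rw [this, leadingMinor_one, one_pow, one_pow]
    rw [this]
    exact one_ne_zero
  · exact Finset.prod_nonneg fun j _ => pow_nonneg (hB0 j) _
  · rw [sphericalPoly_eq, ← integral_mul_const]
    refine integral_mono ((integrable_orthHaar hfc).mul_const _)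
      (integrable_orthHaar (continuous_genPow_orthConj κ _)) fun H => ?_
    simp only [hf]
    rw [← prod_headProd_pow x hκ, ← Finset.prod_mul_distrib, genPow_eq]
    refine Finset.prod_le_prod (fun j _ => ?_) fun j _ => ?_
    · have := (headProd_pos hx j).le
      positivity
    · rw [← mul_pow]
      have := (headProd_pos hx j).le
      exact pow_le_pow_left₀ (by positivity) (sq_leadingMinor_mul_le H hx j) _
  · rw [sphericalPoly_eq]
    have h1 : ∀ H : Matrix.orthogonalGroup (Fin p) ℝ,
        genPow κ (orthConj H (Matrix.diagonal x)) ≤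
          (∏ j, B j ^ minorExp κ j) * ∏ i, x i ^ κ i := by
      intro H
      rw [← prod_headProd_pow x hκ, ← Finset.prod_mul_distrib, genPow_eq]
      refine Finset.prod_le_prod (fun j _ => ?_) fun j _ => ?_
      · exact pow_nonneg (leadingMinor_nonneg (posDef_orthConj_diagonal H hx).posSemidef j) _
      · rw [← mul_pow]
        exact pow_le_pow_left₀
          (leadingMinor_nonneg (posDef_orthConj_diagonal H hx).posSemidef j) (hB j H x hx hanti) _
    have := integral_mono (μ := orthHaar p)
      (integrable_orthHaar (continuous_genPow_orthConj κ (Matrix.diagonal x)))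
      (integrable_const _) h1
    simpa using this

/-! ### Existence of the zonal normalization -/

lemma mem_partsOf {p k : ℕ} {κ : Fin p → ℕ} : κ ∈ partsOf p k ↔ ∑ i, κ i = k ∧ Antitone κ := by
  simp [partsOf, Finset.mem_piAntidiag]

/-- A weight that orders partitions lexicographically. -/
def lexWeight {p : ℕ} (k : ℕ) (κ : Fin p → ℕ) : ℕ := ∑ i : Fin p, κ i * (k + 1) ^ (i.rev : ℕ)

/-- The parts are at most `k`, so they are the digits of the weight in base `k + 1`. -/
lemma lexWeight_injOn (p k : ℕ) : Set.InjOn (lexWeight (p := p) k) (partsOf p k) := by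
  have hlt : ∀ κ : Fin p → ℕ, κ ∈ partsOf p k → ∀ i, κ i < k + 1 := fun κ hκ i => by
    rw [← (mem_partsOf.1 hκ).1]
    exact Nat.lt_succ_of_le (Finset.single_le_sum (fun _ _ => Nat.zero_le _) (Finset.mem_univ i))
  have hw : ∀ (κ : Fin p → ℕ) (hκ : κ ∈ partsOf p k), lexWeight k κ =
      (finFunctionFinEquiv (fun i : Fin p => (⟨κ i.rev, hlt κ hκ _⟩ : Fin (k + 1))) : ℕ) := by
    intro κ hκ
    rw [finFunctionFinEquiv_apply, lexWeight, ← Equiv.sum_comp Fin.revPerm]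
    simp
  intro κ hκ κ' hκ' h
  rw [hw κ hκ, hw κ' hκ'] at h
  have h2 := finFunctionFinEquiv.injective (Fin.ext h)
  funext i
  have h3 := congrArg Fin.val (congrFun h2 i.rev)
  simpa using h3

/-- The spherical polynomials of a given degree as functions of the eigenvalues. -/
noncomputable def sphericalDiag {p k : ℕ} (κ : partsOf p k) (x : Fin p → ℝ) : ℝ :=
  sphericalPoly κ.1 (Matrix.diagonal x)

/-- Along a suitable curve in the Weyl chamber each spherical polynomial is, up to constants, a
power of `t` whose exponent is the weight of `κ`. The weights are distinct, so in a vanishing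
combination the term of largest weight would dominate as `t → ∞`. -/
lemma linearIndependent_sphericalDiag (p k : ℕ) :
    LinearIndependent ℝ (sphericalDiag (p := p) (k := k)) := by
  classical
  rw [Fintype.linearIndependent_iff]
  intro g hg
  by_contra! hne
  obtain ⟨κ₁, hκ₁⟩ := hne
  obtain ⟨κ₀, hκ₀, hmax⟩ := Finset.exists_max_image (Finset.univ.filter fun κ => g κ ≠ 0)
    (fun κ => lexWeight k κ.1) ⟨κ₁, by simpa using hκ₁⟩
  rw [Finset.mem_filter] at hκ₀
  choose c C hc hC hbd using fun κ : partsOf p k =>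
    sphericalPoly_diagonal_bounds (mem_partsOf.1 κ.2).2
  set M := ∑ κ, |g κ| * C κ with hM
  have hM0 : 0 ≤ M := Finset.sum_nonneg fun κ _ => mul_nonneg (abs_nonneg _) (hC κ)
  have hpos : 0 < |g κ₀| * c κ₀ := mul_pos (abs_pos.2 hκ₀.2) (hc κ₀)
  have key : ∀ t : ℝ, 1 ≤ t → |g κ₀| * c κ₀ * t ≤ M := by
    intro t ht
    have ht0 : 0 < t := by linarith
    -- The entries are chosen so that the monomial `x^κ` equals `t ^ lexWeight k κ`, while `x` stays
    -- decreasing for `t ≥ 1`.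
    set x : Fin p → ℝ := fun i => t ^ ((k + 1) ^ (i.rev : ℕ)) with hx
    have hx0 : ∀ i, 0 < x i := fun i => by positivity
    have hxa : Antitone x := fun i j hij =>
      pow_le_pow_right₀ ht (Nat.pow_le_pow_right (Nat.succ_pos k) (Fin.rev_le_rev.2 hij))
    have hprod : ∀ κ : Fin p → ℕ, ∏ i, x i ^ κ i = t ^ lexWeight k κ := by
      intro κ
      simp only [hx, lexWeight, ← pow_mul, Finset.prod_pow_eq_pow_sum]
      congr 1
      exact Finset.sum_congr rfl fun i _ => mul_comm _ _
    have hge : ∀ κ : partsOf p k, 0 ≤ sphericalDiag κ x := fun κ =>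
      le_trans (mul_nonneg (hc κ).le (Finset.prod_nonneg fun i _ => pow_nonneg (hx0 i).le _))
        (hbd κ x hx0 hxa).1
    have hsum : ∑ κ, g κ * sphericalDiag κ x = 0 := by
      have := congrFun hg x
      simpa [Finset.sum_apply] using this
    rw [← Finset.add_sum_erase _ _ (Finset.mem_univ κ₀)] at hsum
    have h1 : |g κ₀| * sphericalDiag κ₀ x ≤
        ∑ κ ∈ Finset.univ.erase κ₀, |g κ| * sphericalDiag κ x := by
      rw [← abs_of_nonneg (hge κ₀), ← abs_mul, eq_neg_of_add_eq_zero_left hsum, abs_neg]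
      refine (Finset.abs_sum_le_sum_abs _ _).trans (Finset.sum_le_sum fun κ _ => ?_)
      rw [abs_mul, abs_of_nonneg (hge κ)]
    have h2 : ∀ κ ∈ Finset.univ.erase κ₀, t * (|g κ| * sphericalDiag κ x) ≤
        |g κ| * C κ * t ^ lexWeight k κ₀.1 := by
      intro κ hκ
      by_cases h0 : g κ = 0
      · simp [h0]
      · have hlt : lexWeight k κ.1 < lexWeight k κ₀.1 := by
          refine lt_of_le_of_ne (hmax κ (by simpa using h0)) fun heq => ?_
          exact (Finset.mem_erase.1 hκ).1 (Subtype.ext (lexWeight_injOn p k κ.2 κ₀.2 heq))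
        have h3 := (hbd κ x hx0 hxa).2
        rw [hprod] at h3
        have h4 : t * t ^ lexWeight k κ.1 ≤ t ^ lexWeight k κ₀.1 := by
          rw [← pow_succ']
          exact pow_le_pow_right₀ ht hlt
        calc t * (|g κ| * sphericalDiag κ x) ≤ t * (|g κ| * (C κ * t ^ lexWeight k κ.1)) := by
              gcongr
              exact h3
          _ = |g κ| * C κ * (t * t ^ lexWeight k κ.1) := by ring
          _ ≤ _ := mul_le_mul_of_nonneg_left h4 (mul_nonneg (abs_nonneg _) (hC κ))
    have h5 : |g κ₀| * c κ₀ * t * t ^ lexWeight k κ₀.1 ≤ M * t ^ lexWeight k κ₀.1 := by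
      have h6 := (hbd κ₀ x hx0 hxa).1
      rw [hprod] at h6
      calc |g κ₀| * c κ₀ * t * t ^ lexWeight k κ₀.1
          = t * (|g κ₀| * (c κ₀ * t ^ lexWeight k κ₀.1)) := by ring
        _ ≤ t * (|g κ₀| * sphericalDiag κ₀ x) := by
            gcongr
            exact h6
        _ ≤ t * ∑ κ ∈ Finset.univ.erase κ₀, |g κ| * sphericalDiag κ x := by gcongr
        _ ≤ ∑ κ ∈ Finset.univ.erase κ₀, |g κ| * C κ * t ^ lexWeight k κ₀.1 := by
            rw [Finset.mul_sum]
            exact Finset.sum_le_sum h2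
        _ ≤ ∑ κ, |g κ| * C κ * t ^ lexWeight k κ₀.1 :=
            Finset.sum_le_sum_of_subset_of_nonneg (Finset.erase_subset _ _) fun κ _ _ =>
              mul_nonneg (mul_nonneg (abs_nonneg _) (hC κ)) (by positivity)
        _ = M * t ^ lexWeight k κ₀.1 := by rw [hM, Finset.sum_mul]
    exact le_of_mul_le_mul_right h5 (by positivity)
  -- For this `t` the left side exceeds `M` by `|g κ₀| * c κ₀ > 0`.
  have h := key (M / (|g κ₀| * c κ₀) + 1) (by
    have := div_nonneg hM0 hpos.le
    linarith)
  rw [mul_add, mul_div_cancel₀ _ hpos.ne'] at h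
  linarith

/-- The monomial symmetric functions, up to a factor. -/
noncomputable def monomialSym {p : ℕ} (e : Fin p → ℕ) (x : Fin p → ℝ) : ℝ :=
  ∑ σ : Equiv.Perm (Fin p), ∏ i, x (σ i) ^ e i

lemma monomialSym_comp {p : ℕ} (e : Fin p → ℕ) (τ : Equiv.Perm (Fin p)) :
    monomialSym (e ∘ τ) = monomialSym e := by
  funext x
  unfold monomialSym
  rw [← Equiv.sum_comp (Equiv.mulRight τ)]
  refine Finset.sum_congr rfl fun σ _ => ?_
  exact Equiv.prod_comp τ fun i => x (σ i) ^ e i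

/-- The symmetric homogeneous polynomial functions of degree `k`. -/
noncomputable def symSpace (p k : ℕ) : Submodule ℝ ((Fin p → ℝ) → ℝ) :=
  Submodule.span ℝ (Set.range fun κ : partsOf p k => monomialSym κ.1)

lemma monomialSym_mem {p k : ℕ} {e : Fin p → ℕ} (he : ∑ i, e i = k) :
    monomialSym e ∈ symSpace p k := by
  set τ := Tuple.sort (OrderDual.toDual ∘ e) with hτ
  have hm : Antitone (e ∘ τ) := fun i j hij => Tuple.monotone_sort (OrderDual.toDual ∘ e) hij
  rw [← monomialSym_comp e τ]
  refine Submodule.subset_span ⟨⟨e ∘ τ, mem_partsOf.2 ⟨?_, hm⟩⟩, rfl⟩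
  rw [← he]
  exact Equiv.sum_comp τ e

/-- Averaging over permutations does not change `P` but turns each monomial into a multiple of a
monomial symmetric function. -/
lemma eval_mem_symSpace {p k : ℕ} {P : MvPolynomial (Fin p) ℝ} (hP : P.IsHomogeneous k)
    (hsymm : ∀ (σ : Equiv.Perm (Fin p)) (x : Fin p → ℝ),
      MvPolynomial.eval (fun i => x (σ i)) P = MvPolynomial.eval x P) :
    (fun x => MvPolynomial.eval x P) ∈ symSpace p k := by
  have hcard : ((Fintype.card (Equiv.Perm (Fin p)) : ℕ) : ℝ) ≠ 0 := by
    exact_mod_cast Fintype.card_ne_zero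
  have h : (fun x => MvPolynomial.eval x P) = (Fintype.card (Equiv.Perm (Fin p)) : ℝ)⁻¹ •
      ∑ d ∈ P.support, P.coeff d • monomialSym d := by
    funext x
    rw [Pi.smul_apply, smul_eq_mul, eq_inv_mul_iff_mul_eq₀ hcard]
    have h1 : (Fintype.card (Equiv.Perm (Fin p)) : ℝ) * MvPolynomial.eval x P =
        ∑ σ : Equiv.Perm (Fin p), MvPolynomial.eval (fun i => x (σ i)) P := by
      simp [hsymm]
    rw [h1]
    simp only [MvPolynomial.eval_eq']
    rw [Finset.sum_comm, Finset.sum_apply]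
    refine Finset.sum_congr rfl fun d _ => ?_
    rw [← Finset.mul_sum]
    rfl
  rw [h]
  refine Submodule.smul_mem _ _ (Submodule.sum_mem _ fun d hd => Submodule.smul_mem _ _ ?_)
  refine monomialSym_mem ?_
  by_contra hne
  rw [← Finsupp.degree_eq_sum] at hne
  exact MvPolynomial.mem_support_iff.1 hd (hP.coeff_eq_zero hne)

/-- The matrix of a permutation as an orthogonal matrix. -/
def permOrth {p : ℕ} (σ : Equiv.Perm (Fin p)) : Matrix.orthogonalGroup (Fin p) ℝ :=
  ⟨Matrix.of fun i j => if σ i = j then 1 else 0, by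
    rw [Matrix.mem_orthogonalGroup_iff]
    ext i j
    change ((Matrix.of fun i j => if σ i = j then (1 : ℝ) else 0) *
      (Matrix.of fun i j => if σ i = j then (1 : ℝ) else 0).transpose) i j = _
    simp [Matrix.mul_apply, Matrix.one_apply, eq_comm]⟩

lemma orthConj_permOrth {p : ℕ} (σ : Equiv.Perm (Fin p)) (x : Fin p → ℝ) :
    orthConj (permOrth σ) (Matrix.diagonal x) = Matrix.diagonal fun i => x (σ i) := by
  ext i j
  change ((Matrix.of fun i j => if σ i = j then (1 : ℝ) else 0) * Matrix.diagonal x *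
      (Matrix.of fun i j => if σ i = j then (1 : ℝ) else 0).transpose) i j = _
  rw [Matrix.mul_apply]
  by_cases h : i = j <;> simp [Matrix.mul_diagonal, eq_comm, h]

/-- The matrix entries of `O(p)` as continuous functions. -/
def orthEntry {p : ℕ} (i j : Fin p) : C(Matrix.orthogonalGroup (Fin p) ℝ, ℝ) :=
  ⟨fun H => (H : Matrix (Fin p) (Fin p) ℝ) i j,
    (continuous_apply j).comp ((continuous_apply i).comp continuous_subtype_val)⟩

/-- The generic matrix `H diag(X) Hᵀ`. -/
noncomputable def genericConj (p : ℕ) :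
    Matrix (Fin p) (Fin p) (MvPolynomial (Fin p) C(Matrix.orthogonalGroup (Fin p) ℝ, ℝ)) :=
  Matrix.of fun i l => ∑ s, MvPolynomial.C (orthEntry i s * orthEntry l s) * MvPolynomial.X s

/-- The generic generalized power of `H diag(X) Hᵀ`. -/
noncomputable def genericGenPow {p : ℕ} (κ : Fin p → ℕ) :
    MvPolynomial (Fin p) C(Matrix.orthogonalGroup (Fin p) ℝ, ℝ) :=
  ∏ j : Fin p, ((genericConj p).submatrix (Fin.castLE (Nat.succ_le_of_lt j.isLt))
    (Fin.castLE (Nat.succ_le_of_lt j.isLt))).det ^ minorExp κ j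

lemma genericGenPow_isHomogeneous {p : ℕ} {κ : Fin p → ℕ} (hκ : Antitone κ) :
    (genericGenPow κ).IsHomogeneous (∑ i, κ i) := by
  rw [← sum_mul_minorExp hκ]
  refine MvPolynomial.IsHomogeneous.prod _ _ _ fun j _ => MvPolynomial.IsHomogeneous.pow ?_ _
  rw [Matrix.det_apply]
  refine MvPolynomial.IsHomogeneous.sum _ _ _ fun σ _ => ?_
  have h1 : (∏ i : Fin ((j : ℕ) + 1), (genericConj p).submatrix
      (Fin.castLE (Nat.succ_le_of_lt j.isLt)) (Fin.castLE (Nat.succ_le_of_lt j.isLt))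
      (σ i) i).IsHomogeneous (∑ _i : Fin ((j : ℕ) + 1), 1) := by
    refine MvPolynomial.IsHomogeneous.prod _ _ _ fun i _ => ?_
    rw [Matrix.submatrix_apply, genericConj, Matrix.of_apply]
    refine MvPolynomial.IsHomogeneous.sum _ _ _ fun s _ => ?_
    have h2 : ∀ r : C(Matrix.orthogonalGroup (Fin p) ℝ, ℝ),
        (MvPolynomial.C r * MvPolynomial.X s : MvPolynomial (Fin p) _).IsHomogeneous 1 := fun r => by
      simpa using (MvPolynomial.isHomogeneous_C (Fin p) r).mul (MvPolynomial.isHomogeneous_X _ s)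
    exact h2 _
  rw [Finset.sum_const, Finset.card_univ, Fintype.card_fin, smul_eq_mul, mul_one] at h1
  rcases Int.units_eq_one_or (Equiv.Perm.sign σ) with h | h
  · rwa [h, one_smul]
  · rw [h, Units.neg_smul, one_smul]
    exact h1.neg

lemma eval_genericGenPow {p : ℕ} (κ : Fin p → ℕ) (H : Matrix.orthogonalGroup (Fin p) ℝ)
    (x : Fin p → ℝ) :
    MvPolynomial.eval₂Hom (ContinuousMap.evalAlgHom ℝ ℝ H).toRingHom x (genericGenPow κ) =
      genPow κ (orthConj H (Matrix.diagonal x)) := by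
  rw [genericGenPow, map_prod, genPow_eq]
  refine Finset.prod_congr rfl fun j _ => ?_
  rw [map_pow, RingHom.map_det]
  congr 2
  ext a b
  rw [RingHom.mapMatrix_apply, Matrix.map_apply, Matrix.submatrix_apply, genericConj,
    Matrix.of_apply, map_sum, Matrix.submatrix_apply, orthConj, Matrix.mul_apply]
  refine Finset.sum_congr rfl fun s _ => ?_
  rw [map_mul, MvPolynomial.coe_eval₂Hom, MvPolynomial.eval₂_C, MvPolynomial.eval₂_X,
    Matrix.mul_diagonal, Matrix.transpose_apply]
  change (H : Matrix (Fin p) (Fin p) ℝ) _ s * (H : Matrix (Fin p) (Fin p) ℝ) _ s * x s = _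
  ring

/-- As a polynomial in the eigenvalues, `Δ_κ(H diag(x) Hᵀ)` has coefficients continuous in `H`.
Integrating these over `O(p)` gives a homogeneous polynomial, symmetric because permuting the
eigenvalues is conjugation by a permutation matrix. -/
lemma sphericalDiag_mem {p k : ℕ} (κ : partsOf p k) : sphericalDiag κ ∈ symSpace p k := by
  obtain ⟨hk, hκ⟩ := mem_partsOf.1 κ.2
  set P := genericGenPow κ.1 with hP
  have hhom : P.IsHomogeneous k := hk ▸ genericGenPow_isHomogeneous hκ
  set Q : MvPolynomial (Fin p) ℝ :=
    ∑ d ∈ P.support, MvPolynomial.monomial d (∫ H, P.coeff d H ∂orthHaar p) with hQ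
  have heval : ∀ x, MvPolynomial.eval x Q = sphericalDiag κ x := by
    intro x
    rw [sphericalDiag, sphericalPoly_eq]
    simp only [← eval_genericGenPow, MvPolynomial.coe_eval₂Hom, MvPolynomial.eval₂_eq']
    rw [integral_finsetSum _ fun d _ => ?_, hQ, map_sum]
    · refine Finset.sum_congr rfl fun d _ => ?_
      rw [integral_mul_const, MvPolynomial.eval_monomial, Finsupp.prod_fintype _ _ (by simp)]
      rfl
    · exact (integrable_orthHaar (P.coeff d).continuous).mul_const _
  have hQhom : Q.IsHomogeneous k := by
    refine MvPolynomial.IsHomogeneous.sum _ _ _ fun d hd => MvPolynomial.isHomogeneous_monomial _ ?_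
    by_contra hne
    exact MvPolynomial.mem_support_iff.1 hd (hhom.coeff_eq_zero hne)
  have := eval_mem_symSpace hQhom fun σ x => by
    rw [heval, heval, sphericalDiag, ← orthConj_permOrth, sphericalPoly_orthConj]
    rfl
  simpa only [heval] using this

lemma powerSum_mem (p k : ℕ) : (fun x : Fin p → ℝ => (∑ i, x i) ^ k) ∈ symSpace p k := by
  have hhom : ((∑ i : Fin p, MvPolynomial.X i : MvPolynomial (Fin p) ℝ) ^ k).IsHomogeneous k := by
    have := (MvPolynomial.IsHomogeneous.sum Finset.univ
      (fun i : Fin p => (MvPolynomial.X i : MvPolynomial (Fin p) ℝ)) 1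
      fun i _ => MvPolynomial.isHomogeneous_X _ i).pow k
    rwa [one_mul] at this
  have := eval_mem_symSpace hhom fun σ x => by
    simp only [map_pow, map_sum, MvPolynomial.eval_X]
    rw [Equiv.sum_comp σ x]
  simpa using this

lemma exists_orthConj_diagonal {p : ℕ} {X : Matrix (Fin p) (Fin p) ℝ} (hX : X.IsSymm) :
    ∃ (H : Matrix.orthogonalGroup (Fin p) ℝ) (x : Fin p → ℝ),
      X = orthConj H (Matrix.diagonal x) := by
  have hH := isSymm_iff_isHermitian_real.2 hX
  refine ⟨hH.eigenvectorUnitary, hH.eigenvalues, ?_⟩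
  have := hH.spectral_theorem
  rw [Unitary.conjStarAlgAut_apply] at this
  exact this

/-- The spherical polynomials are independent and lie in a space spanned by equally many functions,
so they span it; `(∑ x i)^k` belongs to that space. Invariance under `O(p)` extends the identity
from diagonal to symmetric matrices. This existence is what gives meaning to the choice in
`zonalCoeff`. -/
lemma exists_isZonalNormalization (p k : ℕ) : ∃ c, IsZonalNormalization p k c := by
  have hfd : FiniteDimensional ℝ (symSpace p k) :=
    FiniteDimensional.span_of_finite ℝ (Set.finite_range _)
  have hle : Submodule.span ℝ (Set.range (sphericalDiag (p := p) (k := k))) ≤ symSpace p k :=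
    Submodule.span_le.2 (by rintro _ ⟨κ, rfl⟩; exact sphericalDiag_mem κ)
  have heq := Submodule.eq_of_le_of_finrank_le hle (by
    rw [finrank_span_eq_card (linearIndependent_sphericalDiag p k)]
    exact finrank_range_le_card _)
  have hmem := powerSum_mem p k
  rw [← heq, Submodule.mem_span_range_iff_exists_fun] at hmem
  obtain ⟨c, hc⟩ := hmem
  classical
  -- The value off the partitions of `k` is immaterial, since the normalization sums over partitions
  -- only.
  refine ⟨fun κ => if h : κ ∈ partsOf p k then c ⟨κ, h⟩ else 0, fun X hX => ?_⟩
  obtain ⟨H, x, rfl⟩ := exists_orthConj_diagonal hX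
  rw [trace_orthConj, Matrix.trace_diagonal]
  have h1 := congrFun hc x
  rw [← h1, Finset.sum_apply, ← Finset.sum_coe_sort]
  refine Finset.sum_congr rfl fun κ _ => ?_
  rw [sphericalPoly_orthConj]
  simp only [dif_pos κ.2]
  rfl

lemma sum_zonalCoeff_mul_sphericalPoly {p k : ℕ} {X : Matrix (Fin p) (Fin p) ℝ} (hX : X.IsSymm) :
    ∑ κ ∈ partsOf p k, zonalCoeff p k κ * sphericalPoly κ X = X.trace ^ k :=
  Classical.epsilon_spec (exists_isZonalNormalization p k) X hX

/-! ### The spectral norm -/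

lemma specNorm_orthConj {p : ℕ} (H : Matrix.orthogonalGroup (Fin p) ℝ)
    (X : Matrix (Fin p) (Fin p) ℝ) : specNorm (orthConj H X) ≤ specNorm X := by
  have h : ∀ K : Matrix.orthogonalGroup (Fin p) ℝ,
      ‖Matrix.toEuclideanCLM (n := Fin p) (𝕜 := ℝ) (K : Matrix (Fin p) (Fin p) ℝ)‖ ≤ 1 := by
    intro K
    refine ContinuousLinearMap.opNorm_le_bound _ zero_le_one fun v => ?_
    rw [one_mul]
    refine le_of_eq ((sq_eq_sq₀ (norm_nonneg _) (norm_nonneg _)).1 ?_)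
    rw [EuclideanSpace.real_norm_sq_eq, EuclideanSpace.real_norm_sq_eq]
    have h1 : ∀ u : EuclideanSpace ℝ (Fin p), ∑ i, u i ^ 2 = dotProduct u.ofLp u.ofLp := fun u =>
      Finset.sum_congr rfl fun i _ => sq _
    rw [h1, h1, Matrix.ofLp_toEuclideanCLM, Matrix.dotProduct_mulVec, Matrix.vecMul_mulVec,
      orth_transpose_mul, Matrix.vecMul_one]
  have hT : (H : Matrix (Fin p) (Fin p) ℝ).transpose = ((H⁻¹ : Matrix.orthogonalGroup (Fin p) ℝ) :
    Matrix (Fin p) (Fin p) ℝ) := rfl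
  rw [specNorm, orthConj, hT, map_mul, map_mul]
  calc _ ≤ 1 * specNorm X * 1 :=
        (norm_mul_le _ _).trans (mul_le_mul ((norm_mul_le _ _).trans
          (mul_le_mul_of_nonneg_right (h H) (norm_nonneg _))) (h _) (norm_nonneg _)
          (by rw [one_mul]; exact norm_nonneg _))
    _ = _ := by ring

lemma specNorm_diagonal_le {p : ℕ} (x : Fin p → ℝ) : specNorm (Matrix.diagonal x) ≤ ‖x‖ := by
  refine ContinuousLinearMap.opNorm_le_bound _ (norm_nonneg _) fun v => ?_
  refine (sq_le_sq₀ (norm_nonneg _) (by positivity)).1 ?_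
  rw [mul_pow, EuclideanSpace.real_norm_sq_eq, EuclideanSpace.real_norm_sq_eq, Finset.mul_sum]
  refine Finset.sum_le_sum fun i _ => ?_
  rw [Matrix.ofLp_toEuclideanCLM, Matrix.mulVec_diagonal, mul_pow]
  refine mul_le_mul_of_nonneg_right ?_ (sq_nonneg _)
  rw [← sq_abs (x i)]
  exact pow_le_pow_left₀ (abs_nonneg _) (norm_le_pi_norm x i) 2

lemma orthConj_sub {p : ℕ} (H : Matrix.orthogonalGroup (Fin p) ℝ)
    (X Y : Matrix (Fin p) (Fin p) ℝ) : orthConj H (X - Y) = orthConj H X - orthConj H Y := by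
  rw [eq_sub_iff_add_eq, ← orthConj_add, sub_add_cancel]

/-- After diagonalization the two conditions place every eigenvalue in the interval `(-1, 1)`. -/
lemma specNorm_lt_one {p : ℕ} {C : Matrix (Fin p) (Fin p) ℝ} (hC : C.IsSymm)
    (h1 : (1 - C).PosDef) (h2 : (1 + C).PosDef) : specNorm C < 1 := by
  obtain ⟨H, x, rfl⟩ := exists_orthConj_diagonal hC
  refine (specNorm_orthConj H _).trans_lt ((specNorm_diagonal_le x).trans_lt ?_)
  have hd : ∀ Y : Matrix (Fin p) (Fin p) ℝ, (orthConj H Y).PosDef → Y.PosDef := fun Y hY =>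
    (posDef_conj_iff (orth_det_ne_zero H)).1 hY
  have h1' := hd (1 - Matrix.diagonal x) (by rwa [orthConj_sub, orthConj_one_mat])
  have h2' := hd (1 + Matrix.diagonal x) (by rwa [orthConj_add, orthConj_one_mat])
  rw [pi_norm_lt_iff one_pos]
  intro i
  have a1 := h1'.diag_pos (i := i)
  have a2 := h2'.diag_pos (i := i)
  simp only [Matrix.sub_apply, Matrix.add_apply, Matrix.one_apply_eq, Matrix.diagonal_apply_eq]
    at a1 a2
  rw [Real.norm_eq_abs, abs_lt]
  constructor <;> linarith

lemma specNorm_neg {p : ℕ} (C : Matrix (Fin p) (Fin p) ℝ) : specNorm (-C) = specNorm C := by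
  rw [specNorm, map_neg, norm_neg, specNorm]

/-- Cauchy–Schwarz bounds the quadratic form of `C` by its operator norm. -/
lemma posSemidef_specNorm_sub {p : ℕ} {C : Matrix (Fin p) (Fin p) ℝ} (hC : C.IsSymm) :
    (specNorm C • (1 : Matrix (Fin p) (Fin p) ℝ) - C).PosSemidef := by
  refine Matrix.PosSemidef.of_dotProduct_mulVec_nonneg ?_ fun v => ?_
  · exact isSymm_iff_isHermitian_real.2 ((Matrix.isSymm_one.smul _).sub hC)
  · have h := real_inner_le_norm (WithLp.toLp 2 v)
      (Matrix.toEuclideanCLM (n := Fin p) (𝕜 := ℝ) C (WithLp.toLp 2 v))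
    have h2 := (Matrix.toEuclideanCLM (n := Fin p) (𝕜 := ℝ) C).le_opNorm (WithLp.toLp 2 v)
    have h3 : inner ℝ (WithLp.toLp 2 v) (Matrix.toEuclideanCLM (n := Fin p) (𝕜 := ℝ) C
        (WithLp.toLp 2 v)) = dotProduct v (C.mulVec v) := by
      rw [EuclideanSpace.inner_eq_star_dotProduct, Matrix.ofLp_toEuclideanCLM, dotProduct_comm]
      rfl
    have h4 : ‖WithLp.toLp 2 v‖ ^ 2 = dotProduct v v := by
      rw [EuclideanSpace.real_norm_sq_eq]
      exact Finset.sum_congr rfl fun i _ => sq _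
    rw [Matrix.sub_mulVec, Matrix.smul_mulVec, Matrix.one_mulVec, dotProduct_sub, dotProduct_smul,
      star_trivial, smul_eq_mul, sub_nonneg, ← h3, ← h4]
    refine h.trans ((mul_le_mul_of_nonneg_left h2 (norm_nonneg _)).trans (le_of_eq ?_))
    rw [specNorm]
    ring

lemma abs_trace_mul_le {p : ℕ} {N Z : Matrix (Fin p) (Fin p) ℝ} (hN : N.IsSymm) (hZ : Z.PosDef) :
    |(N * Z).trace| ≤ specNorm N * Z.trace := by
  have h1 := trace_mul_nonneg_of_posSemidef (posSemidef_specNorm_sub hN) hZ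
  have h2 := trace_mul_nonneg_of_posSemidef (posSemidef_specNorm_sub hN.neg) hZ
  simp only [specNorm_neg, Matrix.sub_mul, Matrix.smul_mul, one_mul, Matrix.trace_sub,
    Matrix.trace_smul, Matrix.neg_mul, Matrix.trace_neg, smul_eq_mul] at h1 h2
  rw [abs_le]
  constructor <;> linarith

/-! ### Averaging over the orthogonal group -/

lemma continuous_sphericalPoly {p : ℕ} (κ : Fin p → ℕ) :
    Continuous (sphericalPoly (p := p) κ) := by
  have h : Continuous (Function.uncurry fun (X : Matrix (Fin p) (Fin p) ℝ)
      (H : Matrix.orthogonalGroup (Fin p) ℝ) => genPow κ (orthConj H X)) :=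
    (continuous_genPow κ).comp (continuous_orthConj.comp continuous_swap)
  have : LocallyCompactSpace (Matrix (Fin p) (Fin p) ℝ) :=
    inferInstanceAs (LocallyCompactSpace (Fin p → Fin p → ℝ))
  have h2 := continuous_parametric_integral_of_continuous (μ := orthHaar p) h isCompact_univ
  simp only [Measure.restrict_univ] at h2
  exact h2

/-- With `G = Z^{1/2}` the trace is that of the symmetric matrix `G (H N Hᵀ) G`. Expand its power in
zonal polynomials and apply the functional equation `integral_sphericalPoly_split` to each term. -/
lemma integral_trace_pow_orthConj {p : ℕ} (k : ℕ) {N Z : Matrix (Fin p) (Fin p) ℝ} (hN : N.IsSymm)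
    (hZ : Z.PosDef) :
    ∫ H, (orthConj H N * Z).trace ^ k ∂orthHaar p =
      ∑ κ ∈ partsOf p k, zonalCoeff p k κ * (sphericalPoly κ N * sphericalPoly κ Z) := by
  set G := CFC.sqrt Z with hGdef
  have hGs : G.PosSemidef := Matrix.nonneg_iff_posSemidef.1 (CFC.sqrt_nonneg Z)
  have hGG : G * G = Z := CFC.sqrt_mul_sqrt_self Z (Matrix.nonneg_iff_posSemidef.2 hZ.posSemidef)
  have hGt : G.transpose = G := isSymm_iff_isHermitian_real.1 hGs.isHermitian
  have hG : G.det ≠ 0 := fun h => hZ.det_pos.ne' (by rw [← hGG, Matrix.det_mul, h, zero_mul])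
  have hsymm : ∀ H, (G * orthConj H N * G.transpose).IsSymm := by
    intro H
    have hN' : N.transpose = N := hN
    simp only [Matrix.IsSymm, orthConj, Matrix.transpose_mul, Matrix.transpose_transpose, hGt, hN',
      Matrix.mul_assoc]
  have h1 : ∀ H, (orthConj H N * Z).trace ^ k = ∑ κ ∈ partsOf p k,
      zonalCoeff p k κ * sphericalPoly κ (G * orthConj H N * G.transpose) := by
    intro H
    rw [sum_zonalCoeff_mul_sphericalPoly (hsymm H), hGt, Matrix.trace_mul_comm _ G, ← Matrix.mul_assoc,
      hGG, Matrix.trace_mul_comm]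
  simp only [h1]
  have hcont : ∀ κ : Fin p → ℕ, Integrable
      (fun H => sphericalPoly κ (G * orthConj H N * G.transpose)) (orthHaar p) := by
    intro κ
    refine integrable_orthHaar ((continuous_sphericalPoly κ).comp ?_)
    exact (continuous_const.mul (continuous_orthConj.comp
      (by fun_prop : Continuous fun H => (H, N)))).mul continuous_const
  rw [integral_finsetSum _ fun κ _ => (hcont κ).const_mul _]
  refine Finset.sum_congr rfl fun κ _ => ?_
  rw [integral_const_mul, integral_sphericalPoly_split κ N hG, hGt, hGG]

/-- Averaging against a function of the eigenvalues. -/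
lemma integral_mul_orthAverage {p : ℕ} {h : Matrix (Fin p) (Fin p) ℝ → ℂ}
    (hinv : ∀ H Z, h (orthConj H Z) = h Z) {g w : Matrix (Fin p) (Fin p) ℝ → ℝ} (hg : Continuous g)
    (hgw : ∀ Z, Z.PosDef → |g Z| ≤ w Z) (hw : ∀ H Z, w (orthConj H Z) = w Z)
    (hm : AEStronglyMeasurable h (posMeasure p))
    (hint : Integrable (fun Z => h Z * (w Z : ℂ)) (posMeasure p))
    {φ : Matrix.orthogonalGroup (Fin p) ℝ → Matrix.orthogonalGroup (Fin p) ℝ}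
    (hφ : Continuous φ) :
    ∫ Z, h Z * (g Z : ℂ) ∂posMeasure p =
      ∫ Z, h Z * ((∫ H, g (orthConj (φ H) Z) ∂orthHaar p : ℝ) : ℂ) ∂posMeasure p := by
  have hgc : Continuous fun x : Matrix (Fin p) (Fin p) ℝ × Matrix.orthogonalGroup (Fin p) ℝ =>
      g (orthConj (φ x.2) x.1) :=
    hg.comp (continuous_orthConj.comp ((hφ.comp continuous_snd).prodMk continuous_fst))
  have hprod : Integrable (Function.uncurry fun (Z : Matrix (Fin p) (Fin p) ℝ)
      (H : Matrix.orthogonalGroup (Fin p) ℝ) => h Z * (g (orthConj (φ H) Z) : ℂ))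
      ((posMeasure p).prod (orthHaar p)) := by
    refine (hint.mul_prod (integrable_const (1 : ℂ))).mono
      ((hm.comp_quasiMeasurePreserving Measure.quasiMeasurePreserving_fst).mul
        (Complex.continuous_ofReal.comp hgc).aestronglyMeasurable) ?_
    filter_upwards [Measure.quasiMeasurePreserving_fst.ae (ae_posDef p)] with x hx
    simp only [Function.uncurry, mul_one, norm_mul, Complex.norm_real, Real.norm_eq_abs]
    refine mul_le_mul_of_nonneg_left ?_ (norm_nonneg _)
    exact ((hgw _ (posDef_orthConj _ hx)).trans_eq (hw _ _)).trans (le_abs_self _)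
  -- Neither `dZ` nor `h` sees a rotation, so the integral does not depend on `H`. The map `φ`
  -- covers both the identity, used for `Δ_κ`, and inversion, used to move a rotation from `Z` to
  -- `N`.
  have h1 : ∀ H, ∫ Z, h Z * (g (orthConj (φ H) Z) : ℂ) ∂posMeasure p =
      ∫ Z, h Z * (g Z : ℂ) ∂posMeasure p := by
    intro H
    have := integral_conj_posMeasure (orth_det_ne_zero (φ H)) fun Z => h Z * (g Z : ℂ)
    rw [abs_orth_det, one_pow, inv_one, one_smul] at this
    rw [← this]
    refine integral_congr_posDef fun Z _ => ?_
    rw [← hinv (φ H) Z]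
    rfl
  have h2 := integral_integral_swap hprod
  simp only [h1, integral_const, probReal_univ, one_smul] at h2
  rw [← h2]
  refine integral_congr_posDef fun Z _ => ?_
  rw [integral_const_mul, integral_complex_ofReal]

/-! ### The zonal expansion -/

/-- Zonal expansion of the Laplace transform of an orthogonally invariant function. -/
lemma hasSum_zonal_laplace {p : ℕ} {h : Matrix (Fin p) (Fin p) ℝ → ℂ}
    (hinv : ∀ H Z, h (orthConj H Z) = h Z)
    (hint : ∀ r : ℝ, 0 ≤ r → r < 1 →
      Integrable (fun Z => h Z * (Real.exp (r * Z.trace) : ℂ)) (posMeasure p))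
    {N : Matrix (Fin p) (Fin p) ℝ} (hN : N.IsSymm) (hN1 : specNorm N < 1) :
    HasSum (fun k : ℕ => ∑ κ ∈ partsOf p k,
        (∫ Z, h Z * (genPow κ Z : ℂ) ∂posMeasure p) * (zonal κ N : ℂ) / (k.factorial : ℂ))
      (∫ Z, h Z * etr (N * Z) ∂posMeasure p) := by
  have hN0 : 0 ≤ specNorm N := norm_nonneg _
  have hm : AEStronglyMeasurable h (posMeasure p) := by
    simpa using (hint 0 le_rfl one_pos).aestronglyMeasurable
  -- Against an invariant `h`, the generalized power and its spherical average have the same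
  -- integral.
  have hgen : ∀ κ : Fin p → ℕ, ∫ Z, h Z * (genPow κ Z : ℂ) ∂posMeasure p =
      ∫ Z, h Z * (sphericalPoly κ Z : ℂ) ∂posMeasure p := by
    intro κ
    obtain ⟨A, hA⟩ := abs_genPow_le_exp κ (half_pos (one_pos (α := ℝ)))
    rw [integral_mul_orthAverage hinv (continuous_genPow κ) hA
      (fun H Z => by rw [trace_orthConj]) hm ?_ continuous_id]
    · rfl
    · refine ((hint (1 / 2) (by norm_num) (by norm_num)).mul_const (A : ℂ)).congr (ae_of_all _ ?_)
      intro Z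
      push_cast
      ring
  have hpoly : ∀ κ : Fin p → ℕ,
      Integrable (fun Z => h Z * (sphericalPoly κ Z : ℂ)) (posMeasure p) := by
    intro κ
    obtain ⟨A, hA⟩ := abs_genPow_le_exp κ (half_pos (one_pos (α := ℝ)))
    refine ((hint (1 / 2) (by norm_num) (by norm_num)).mul_const (A : ℂ)).mono
      (hm.mul (Complex.continuous_ofReal.comp (continuous_sphericalPoly κ)).aestronglyMeasurable)
      ((ae_posDef p).mono fun Z hZ => ?_)
    rw [norm_mul, mul_assoc, norm_mul, ← Complex.ofReal_mul, Complex.norm_real, Complex.norm_real,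
      mul_comm (Real.exp _)]
    refine mul_le_mul_of_nonneg_left ?_ (norm_nonneg _)
    refine le_trans ?_ (le_abs_self _)
    rw [sphericalPoly_eq]
    refine (norm_integral_le_of_norm_le_const (C := A * Real.exp (1 / 2 * Z.trace))
      (ae_of_all _ fun H => ?_)).trans_eq (by simp)
    have := hA _ (posDef_orthConj H hZ)
    rwa [trace_orthConj] at this
  -- Averaging over `H⁻¹` acting on `Z` is averaging over `H` acting on `N`, which brings in
  -- `integral_trace_pow_orthConj`.
  have hpow : ∀ k : ℕ, ∫ Z, h Z * (((N * Z).trace ^ k : ℝ) : ℂ) ∂posMeasure p =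
      ∑ κ ∈ partsOf p k, (∫ Z, h Z * (genPow κ Z : ℂ) ∂posMeasure p) * (zonal κ N : ℂ) := by
    intro k
    rw [integral_mul_orthAverage hinv (g := fun Z => (N * Z).trace ^ k)
      (w := fun Z => k.factorial * Real.exp (specNorm N * Z.trace)) (by fun_prop)
      (fun Z hZ => ?_) (fun H Z => by rw [trace_orthConj]) hm ?_ continuous_inv]
    · have h1 : ∀ Z : Matrix (Fin p) (Fin p) ℝ, Z.PosDef →
          h Z * ((∫ H, (N * orthConj H⁻¹ Z).trace ^ k ∂orthHaar p : ℝ) : ℂ) =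
          ∑ κ ∈ partsOf p k, h Z * (sphericalPoly κ Z : ℂ) * (zonal κ N : ℂ) := by
        intro Z hZ
        have h2 : ∀ H : Matrix.orthogonalGroup (Fin p) ℝ,
            (N * orthConj H⁻¹ Z).trace = (orthConj H N * Z).trace := by
          intro H
          rw [← trace_orthConj H (N * _), orthConj_matMul, ← orthConj_mul, mul_inv_cancel]
          congr 2
          simp [orthConj]
        simp only [h2]
        rw [integral_trace_pow_orthConj k hN hZ, Complex.ofReal_sum, Finset.mul_sum]
        refine Finset.sum_congr rfl fun κ hκ => ?_
        rw [zonal, (mem_partsOf.1 hκ).1]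
        push_cast
        ring
      rw [integral_congr_posDef h1, integral_finsetSum _ fun κ _ => (hpoly κ).mul_const _]
      refine Finset.sum_congr rfl fun κ _ => ?_
      rw [integral_mul_const, hgen]
    · refine ((hint _ hN0 hN1).mul_const (k.factorial : ℂ)).congr (ae_of_all _ fun Z => ?_)
      push_cast
      ring
    · have := abs_trace_mul_le hN hZ
      rw [abs_pow]
      have h3 := Real.pow_div_factorial_le_exp (specNorm N * Z.trace)
        ((abs_nonneg _).trans this) k
      rw [div_le_iff₀ (by positivity)] at h3
      exact (pow_le_pow_left₀ (abs_nonneg _) this k).trans (h3.trans_eq (mul_comm _ _))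
  have hbound : ∀ Z : Matrix (Fin p) (Fin p) ℝ, HasSum
      (fun k : ℕ => ‖h Z‖ * ((specNorm N * Z.trace) ^ k / (k.factorial : ℝ)))
      (‖h Z‖ * Real.exp (specNorm N * Z.trace)) := fun Z => by
    rw [Real.exp_eq_exp_ℝ]
    exact (NormedSpace.expSeries_div_hasSum_exp (specNorm N * Z.trace)).mul_left ‖h Z‖
  -- The bound `|tr(NZ)| ≤ ‖N‖ tr Z` makes `|h| e^{‖N‖ tr Z}` a majorant, integrable because `‖N‖ <
  -- 1`.
  have key := hasSum_integral_of_dominated_convergence (μ := posMeasure p)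
    (F := fun (k : ℕ) Z => h Z * ((((N * Z).trace ^ k : ℝ) : ℂ) / (k.factorial : ℂ)))
    (f := fun Z => h Z * etr (N * Z))
    (fun k Z => ‖h Z‖ * ((specNorm N * Z.trace) ^ k / (k.factorial : ℝ)))
    (fun k => hm.mul (by fun_prop : Continuous fun Z : Matrix (Fin p) (Fin p) ℝ =>
      (((N * Z).trace ^ k : ℝ) : ℂ) / (k.factorial : ℂ)).aestronglyMeasurable)
    (fun k => (ae_posDef p).mono fun Z hZ => ?_)
    (ae_of_all _ fun Z => (hbound Z).summable) ?_ (ae_of_all _ fun Z => ?_)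
  · refine Eq.subst (motive := fun f => HasSum f _) (Eq.symm (funext fun k => ?_)) key
    rw [← Finset.sum_div, ← hpow, ← integral_div]
    simp only [mul_div_assoc]
  · rw [norm_mul, norm_div, Complex.norm_real, Complex.norm_natCast, Real.norm_eq_abs, abs_pow]
    have := abs_trace_mul_le hN hZ
    gcongr
  · simp only [fun Z => (hbound Z).tsum_eq]
    refine (hint _ hN0 hN1).norm.congr (ae_of_all _ fun Z => ?_)
    simp only [norm_mul, Complex.norm_real, Real.norm_eq_abs, Real.abs_exp]
  · rw [etr, Complex.exp_eq_exp_ℂ]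
    simp only [Complex.ofReal_pow]
    exact (NormedSpace.expSeries_div_hasSum_exp ((N * Z).trace : ℂ)).mul_left (h Z)

/-- Rotating the integration variable in `M` along with `Z` leaves its weight and the trace
unchanged; at `D = I` the exponential is invariant as well. -/
lemma confluentDensity_orthConj {p : ℕ} (b μ e : ℂ) (H : Matrix.orthogonalGroup (Fin p) ℝ)
    (Z : Matrix (Fin p) (Fin p) ℝ) :
    confluentDensity b μ e 1 (orthConj H Z) = confluentDensity b μ e 1 Z := by
  have h1 : ∫ X, confluentWeight μ e X * etr (-(orthConj H Z * X)) ∂posMeasure p =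
      ∫ X, confluentWeight μ e X * etr (-(Z * X)) ∂posMeasure p := by
    have := integral_conj_posMeasure (orth_det_ne_zero H) fun X =>
      confluentWeight μ e X * etr (-(orthConj H Z * X))
    rw [abs_orth_det, one_pow, inv_one, one_smul] at this
    rw [← this]
    refine integral_congr_posDef fun X _ => ?_
    change confluentWeight μ e (orthConj H X) * etr (-(orthConj H Z * orthConj H X)) = _
    rw [← orthConj_matMul, confluentWeight, confluentWeight, ← orthConj_one_mat H, ← orthConj_add,
      detPow, detPow, det_orthConj, det_orthConj, orthConj_one_mat, etr, Matrix.trace_neg,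
      trace_orthConj, etr, Matrix.trace_neg, detPow, detPow]
  rw [confluentDensity, confluentM_eq, h1, ← confluentM_eq, confluentDensity, detPow, det_orthConj,
    one_mul, one_mul, etr, Matrix.trace_neg, trace_orthConj, ← Matrix.trace_neg, ← etr, ← detPow]

lemma confluentDensity_mul_etr {p : ℕ} (b μ e : ℂ) (D N Z : Matrix (Fin p) (Fin p) ℝ) :
    confluentDensity b μ e D Z * etr (N * Z) = confluentDensity b μ e (D - N) Z := by
  have : etr (-((D - N) * Z)) = etr (-(D * Z)) * etr (N * Z) := by
    rw [← etr_add]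
    congr 1
    noncomm_ring
  rw [confluentDensity, confluentDensity, this]
  ring

/-- The hypergeometric series as a Laplace transform. -/
lemma hasSum_hypTerm {p : ℕ} {b μ c : ℂ} (hb : ((p : ℝ) - 1) / 2 < b.re)
    (hμ : ((p : ℝ) - 1) / 2 < μ.re) (hcμ : ((p : ℝ) - 1) / 2 < (c - μ).re)
    (hc : ((p : ℝ) - 1) / 2 < c.re) {N : Matrix (Fin p) (Fin p) ℝ} (hN : N.IsSymm)
    (hN1 : specNorm N < 1) :
    HasSum (hypTerm (c - μ) b c N) (gammaP p c / (gammaP p b * gammaP p μ * gammaP p (c - μ)) *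
      ∫ Z, confluentDensity b μ (b - c) (1 - N) Z ∂posMeasure p) := by
  have h := hasSum_zonal_laplace (fun H Z => confluentDensity_orthConj b μ (b - c) H Z)
    (fun r hr hr1 => ?_) hN hN1
  · simp only [confluentDensity_mul_etr] at h
    refine Eq.subst (motive := fun f => HasSum f _) (Eq.symm (funext fun k => ?_))
      (h.mul_left (gammaP p c / (gammaP p b * gammaP p μ * gammaP p (c - μ))))
    rw [hypTerm, Finset.mul_sum]
    refine Finset.sum_congr rfl fun κ hκ => ?_
    rw [confluentDensity_integral_genPow hb hμ hcμ hc (mem_partsOf.1 hκ).2]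
    have := gammaP_ne_zero hb
    have := gammaP_ne_zero hμ
    have := gammaP_ne_zero hcμ
    have := gammaP_ne_zero hc
    field_simp
  -- The weight `e^{r tr Z}` replaces `D = I` by `(1 - r) I`, which is still positive definite; `δ =
  -- 1 - r` is exact.
  · refine (confluentDensity_integral_zero hb hμ hcμ hc (D := 1 - r • 1) (δ := 1 - r)
      (by linarith) (by linarith) ?_).1.congr (ae_of_all _ fun Z => ?_)
    · rw [sub_smul, one_smul, sub_self]
      exact Matrix.PosSemidef.zero
    · simp only [← confluentDensity_mul_etr, etr, Matrix.smul_mul, one_mul, Matrix.trace_smul,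
        smul_eq_mul, Complex.ofReal_exp]

/-! ### The Laplace transform of the Whittaker function -/

/-- Any small positive `δ` below all eigenvalues works; `δ ≤ 1` is imposed for the domination
argument. -/
lemma Matrix.PosDef.exists_sub_smul_one {p : ℕ} {S : Matrix (Fin p) (Fin p) ℝ} (hS : S.PosDef) :
    ∃ δ : ℝ, 0 < δ ∧ δ ≤ 1 ∧ (S - δ • 1).PosSemidef := by
  obtain ⟨H, x, rfl⟩ := exists_orthConj_diagonal hS.isSymm
  have hx : ∀ i, 0 < x i := fun i => by
    have := ((posDef_conj_iff (orth_det_ne_zero H)).1 hS).diag_pos (i := i)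
    simpa using this
  have hev : ∀ᶠ δ in nhdsWithin (0 : ℝ) (Set.Ioi 0), (∀ i, δ ≤ x i) ∧ δ ≤ 1 ∧ 0 < δ := by
    refine (Filter.eventually_all.2 fun i => ?_).and (Filter.Eventually.and ?_
      self_mem_nhdsWithin)
    · exact (eventually_le_nhds (hx i)).filter_mono nhdsWithin_le_nhds
    · exact (eventually_le_nhds one_pos).filter_mono nhdsWithin_le_nhds
  obtain ⟨δ, h1, h2, h3⟩ := hev.exists
  refine ⟨δ, h3, h2, ?_⟩
  have h4 : orthConj H (Matrix.diagonal x) - δ • 1 =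
      orthConj H (Matrix.diagonal fun i => x i - δ) := by
    have h5 : (Matrix.diagonal fun i => x i - δ) = Matrix.diagonal x - δ • 1 := by
      ext i j
      by_cases h : i = j
      · subst h
        simp
      · simp [h]
    have h6 : orthConj H (δ • 1) = δ • 1 := by
      rw [orthConj, Matrix.mul_smul, Matrix.smul_mul, mul_one, orth_mul_transpose]
    rw [h5, orthConj_sub, h6]
  rw [h4]
  exact (Matrix.posSemidef_diagonal_iff.2 fun i => sub_nonneg.2 (h1 i)).mul_mul_conjTranspose_same
    (H : Matrix (Fin p) (Fin p) ℝ)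

/-- Both sides reduce to integrals over `X`, where `X ↦ X⁻¹` exchanges `μ` with `c - μ` and `D` with
`D⁻¹`. -/
lemma integral_confluentDensity_inv {p : ℕ} {b μ c : ℂ} (hb : ((p : ℝ) - 1) / 2 < b.re)
    (hμ : ((p : ℝ) - 1) / 2 < μ.re) (hcμ : ((p : ℝ) - 1) / 2 < (c - μ).re)
    (hc : ((p : ℝ) - 1) / 2 < c.re) {D : Matrix (Fin p) (Fin p) ℝ} (hD : D.PosDef) :
    ∫ Z, confluentDensity b μ (b - c) D Z ∂posMeasure p =
      detPow D (-b) * ∫ Z, confluentDensity b (c - μ) (b - c) D⁻¹ Z ∂posMeasure p := by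
  obtain ⟨δ, hδ, hδ1, hDδ⟩ := hD.exists_sub_smul_one
  obtain ⟨ε, hε, hε1, hDε⟩ := hD.inv.exists_sub_smul_one
  rw [(confluentDensity_integral_zero hb hμ hcμ hc hδ hδ1 hDδ).2,
    (confluentDensity_integral_zero hb hcμ (by rwa [sub_sub_cancel]) hc hε hε1 hDε).2,
    integral_confluentWeight_inv b μ c hD]
  ring

/-! ### Reduction to `B = I` by congruence with the square root. -/

section SquareRoot

variable {p : ℕ} {B : Matrix (Fin p) (Fin p) ℝ}

lemma msqrt_mul_msqrt (hB : B.PosDef) : msqrt B * msqrt B = B :=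
  CFC.sqrt_mul_sqrt_self B (Matrix.nonneg_iff_posSemidef.2 hB.posSemidef)

lemma transpose_msqrt (B : Matrix (Fin p) (Fin p) ℝ) : (msqrt B).transpose = msqrt B :=
  isSymm_iff_isHermitian_real.1
    (Matrix.nonneg_iff_posSemidef.1 (CFC.sqrt_nonneg B)).isHermitian

lemma det_msqrt_ne_zero (hB : B.PosDef) : (msqrt B).det ≠ 0 := fun h =>
  hB.det_pos.ne' (by rw [← msqrt_mul_msqrt hB, Matrix.det_mul, h, zero_mul])

lemma isUnit_det_msqrt (hB : B.PosDef) : IsUnit (msqrt B).det :=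
  isUnit_iff_ne_zero.2 (det_msqrt_ne_zero hB)

lemma transpose_inv_msqrt (B : Matrix (Fin p) (Fin p) ℝ) :
    ((msqrt B)⁻¹).transpose = (msqrt B)⁻¹ := by
  rw [Matrix.transpose_nonsing_inv, transpose_msqrt]

lemma det_inv_msqrt_ne_zero (hB : B.PosDef) : ((msqrt B)⁻¹).det ≠ 0 :=
  (Matrix.isUnit_nonsing_inv_det _ (isUnit_det_msqrt hB)).ne_zero

variable {A : Matrix (Fin p) (Fin p) ℝ}

lemma one_add_shiftC (hB : B.PosDef) :
    1 + shiftC A B = (msqrt B)⁻¹ * (A + (1 / 2 : ℝ) • B) * (msqrt B)⁻¹ := by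
  have h : (msqrt B)⁻¹ * B * (msqrt B)⁻¹ = 1 := by
    nth_rw 2 [← msqrt_mul_msqrt hB]
    rw [← Matrix.mul_assoc, Matrix.nonsing_inv_mul _ (isUnit_det_msqrt hB), one_mul,
      Matrix.mul_nonsing_inv _ (isUnit_det_msqrt hB)]
  rw [Matrix.mul_add, Matrix.add_mul, Matrix.mul_smul, Matrix.smul_mul, h, shiftC, conjInvSqrt]
  have : (1 : Matrix (Fin p) (Fin p) ℝ) = (1 / 2 : ℝ) • 1 + (1 / 2 : ℝ) • 1 := by
    rw [← add_smul]
    norm_num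
  nth_rw 1 [this]
  abel

lemma posDef_add_half (hA : A.PosDef) (hB : B.PosDef) : (A + (1 / 2 : ℝ) • B).PosDef :=
  hA.add (hB.smul (by norm_num))

lemma posDef_one_add_shiftC (hA : A.PosDef) (hB : B.PosDef) : (1 + shiftC A B).PosDef := by
  have := (posDef_conj_iff (det_inv_msqrt_ne_zero hB)).2 (posDef_add_half hA hB)
  rwa [transpose_inv_msqrt, ← one_add_shiftC hB] at this

lemma inv_one_add_shiftC (hB : B.PosDef) : (1 + shiftC A B)⁻¹ = shiftD A B := by
  rw [one_add_shiftC hB, Matrix.mul_inv_rev, Matrix.mul_inv_rev,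
    Matrix.nonsing_inv_nonsing_inv _ (isUnit_det_msqrt hB), shiftD, Matrix.mul_assoc]

lemma det_one_add_shiftC_mul (hB : B.PosDef) :
    ((1 + shiftC A B) * B).det = (A + (1 / 2 : ℝ) • B).det := by
  have h := det_msqrt_ne_zero hB
  have h2 : B.det = (msqrt B).det * (msqrt B).det := by
    rw [← Matrix.det_mul, msqrt_mul_msqrt hB]
  rw [one_add_shiftC hB, Matrix.det_mul, Matrix.det_mul, Matrix.det_mul, h2,
    Matrix.det_nonsing_inv, Ring.inverse_eq_inv']
  field_simp

/-- Congruence by `1 + C` turns the matrix into `C + C²`. -/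
lemma posDef_one_sub_inv {C : Matrix (Fin p) (Fin p) ℝ} (hC : C.PosDef) :
    (1 - (1 + C)⁻¹).PosDef := by
  have hD : (1 + C).PosDef := Matrix.PosDef.one.add hC
  have hu : IsUnit (1 + C).det := isUnit_iff_ne_zero.2 hD.det_pos.ne'
  refine (posDef_conj_iff hD.det_pos.ne').1 ?_
  have ht : (1 + C).transpose = 1 + C := hD.isSymm
  have h : (1 + C) * (1 - (1 + C)⁻¹) * (1 + C).transpose = C + C * C.transpose := by
    have hC' : C.transpose = C := hC.isSymm
    rw [ht, hC', Matrix.mul_sub, Matrix.mul_nonsing_inv _ hu]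
    noncomm_ring
  rw [h]
  exact hC.add_posSemidef (Matrix.posSemidef_self_mul_conjTranspose C)

lemma isSymm_shiftC (hA : A.PosDef) (hB : B.PosDef) : (shiftC A B).IsSymm := by
  have := (posDef_one_add_shiftC hA hB).isSymm.sub Matrix.isSymm_one
  rwa [add_sub_cancel_left] at this

lemma isSymm_shiftD (hA : A.PosDef) (hB : B.PosDef) : (shiftD A B).IsSymm := by
  rw [← inv_one_add_shiftC hB]
  exact (posDef_one_add_shiftC hA hB).inv.isSymm

/-- The powers of `|Y|` in the integrand and in `W` combine to the exponent with `b`, and the factor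
`e^{-tr(Y)/2}` of `W` completes `B^{-1/2} A B^{-1/2}` to `I + C`. -/
lemma laplaceIntegrand_conj (hB : B.PosDef) (α β γ : ℂ) {Y : Matrix (Fin p) (Fin p) ℝ}
    (hY : Y.PosDef) :
    laplaceIntegrand A B α β γ ((msqrt B)⁻¹ * Y * ((msqrt B)⁻¹).transpose) =
      detPow B (-γ + ((p : ℂ) + 1) / 2) / gammaP p (β - α + ((p : ℂ) + 1) / 4) *
        confluentDensity (γ + β + ((p : ℂ) + 1) / 4) (β - α + ((p : ℂ) + 1) / 4)
          (γ + β + ((p : ℂ) + 1) / 4 - (γ - α + ((p : ℂ) + 1) / 2)) (1 + shiftC A B) Y := by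
  have hu := isUnit_det_msqrt hB
  have h1 : msqrt B * ((msqrt B)⁻¹ * Y * (msqrt B)⁻¹) * msqrt B = Y := by
    rw [← Matrix.mul_assoc, ← Matrix.mul_assoc, Matrix.mul_nonsing_inv _ hu, one_mul,
      Matrix.mul_assoc, Matrix.nonsing_inv_mul _ hu, mul_one]
  have h2 : detPow ((msqrt B)⁻¹ * Y * (msqrt B)⁻¹) (γ - ((p : ℂ) + 1) / 2) =
      detPow B (-γ + ((p : ℂ) + 1) / 2) * detPow Y (γ - ((p : ℂ) + 1) / 2) := by
    have h3 : -γ + ((p : ℂ) + 1) / 2 = -(γ - ((p : ℂ) + 1) / 2) := by ring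
    rw [h3, ← detPow_inv hB, ← detPow_mul hB.inv.det_pos.le hY.det_pos.le, detPow, detPow]
    congr 2
    nth_rw 3 [← msqrt_mul_msqrt hB]
    rw [Matrix.mul_inv_rev]
    simp only [Matrix.det_mul]
    ring
  have h4 : etr (-(A * ((msqrt B)⁻¹ * Y * (msqrt B)⁻¹))) * etr (-((1 / 2 : ℝ) • Y)) =
      etr (-((1 + shiftC A B) * Y)) := by
    have h5 : 1 + shiftC A B = conjInvSqrt A B + (1 / 2 : ℝ) • 1 := by
      rw [shiftC]
      have : (1 : Matrix (Fin p) (Fin p) ℝ) = (1 / 2 : ℝ) • 1 + (1 / 2 : ℝ) • 1 := by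
        rw [← add_smul]
        norm_num
      nth_rw 1 [this]
      abel
    have h6 : etr (-(A * ((msqrt B)⁻¹ * Y * (msqrt B)⁻¹))) = etr (-(conjInvSqrt A B * Y)) := by
      rw [← Matrix.mul_assoc, etr_mul_comm, conjInvSqrt]
      simp only [Matrix.mul_assoc]
    rw [h6, ← etr_add, h5, Matrix.add_mul, Matrix.smul_mul, one_mul, neg_add]
  have h7 : γ + β + ((p : ℂ) + 1) / 4 - ((p : ℂ) + 1) / 2 =
      (γ - ((p : ℂ) + 1) / 2) + (β + ((p : ℂ) + 1) / 4) := by ring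
  have h8 : γ + β + ((p : ℂ) + 1) / 4 - (γ - α + ((p : ℂ) + 1) / 2) + ((p : ℂ) + 1) / 2 =
      β + α + ((p : ℂ) + 1) / 4 := by ring
  rw [transpose_inv_msqrt, laplaceIntegrand, h1, h2, whittakerW, confluentDensity, h8, h7,
    detPow_add hY (γ - ((p : ℂ) + 1) / 2), ← h4]
  ring

lemma integrable_laplaceIntegrand_iff (hB : B.PosDef) (α β γ : ℂ)
    (hg : gammaP p (β - α + ((p : ℂ) + 1) / 4) ≠ 0) :
    Integrable (laplaceIntegrand A B α β γ) (posMeasure p) ↔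
      Integrable (confluentDensity (γ + β + ((p : ℂ) + 1) / 4) (β - α + ((p : ℂ) + 1) / 4)
        (γ + β + ((p : ℂ) + 1) / 4 - (γ - α + ((p : ℂ) + 1) / 2)) (1 + shiftC A B))
        (posMeasure p) := by
  rw [← integrable_conj_posMeasure (det_inv_msqrt_ne_zero hB),
    integrable_congr ((ae_posDef p).mono fun Y hY => laplaceIntegrand_conj (A := A) hB α β γ hY),
    integrable_const_mul_iff (isUnit_iff_ne_zero.2 (div_ne_zero (detPow_ne_zero hB _) hg))]

/-- The Jacobian of the substitution cancels `|B|^{(p+1)/2}`, leaving `|B|^{-γ}`. -/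
lemma integral_laplaceIntegrand (hB : B.PosDef) (α β γ : ℂ) :
    ∫ Z, laplaceIntegrand A B α β γ Z ∂posMeasure p =
      detPow B (-γ) / gammaP p (β - α + ((p : ℂ) + 1) / 4) *
        ∫ Z, confluentDensity (γ + β + ((p : ℂ) + 1) / 4) (β - α + ((p : ℂ) + 1) / 4)
          (γ + β + ((p : ℂ) + 1) / 4 - (γ - α + ((p : ℂ) + 1) / 2)) (1 + shiftC A B) Z
          ∂posMeasure p := by
  have h := integral_conj_posMeasure (det_inv_msqrt_ne_zero hB) (laplaceIntegrand A B α β γ)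
  rw [integral_congr_posDef fun Y hY => laplaceIntegrand_conj (A := A) hB α β γ hY,
    integral_const_mul, Complex.real_smul, Complex.ofReal_inv, abs_det_pow_eq_detPow,
    transpose_inv_msqrt, ← Matrix.mul_inv_rev, msqrt_mul_msqrt hB, detPow_inv hB,
    eq_inv_mul_iff_mul_eq₀ (detPow_ne_zero hB _)] at h
  rw [← h, detPow_add hB]
  have h2 : detPow B (-(((p : ℂ) + 1) / 2)) * detPow B (((p : ℂ) + 1) / 2) = 1 := by
    rw [← detPow_add hB, neg_add_cancel, detPow_zero]
  linear_combination (detPow B (-γ) / gammaP p (β - α + ((p : ℂ) + 1) / 4) *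
    ∫ Z, confluentDensity (γ + β + ((p : ℂ) + 1) / 4) (β - α + ((p : ℂ) + 1) / 4)
          (γ + β + ((p : ℂ) + 1) / 4 - (γ - α + ((p : ℂ) + 1) / 2)) (1 + shiftC A B) Z
          ∂posMeasure p) * h2

end SquareRoot

/-! ### Assembly of the two formulas. -/

theorem theorem2p3 (p : ℕ) (hp : 1 ≤ p) (A B : Matrix (Fin p) (Fin p) ℝ)
    (hA : A.PosDef) (hB : B.PosDef) (α β γ : ℂ)
    (hadd : ((p : ℝ) - 3) / 4 < (γ + β).re)
    (hsub : ((p : ℝ) - 3) / 4 < (γ - β).re)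
    (hβα : ((p : ℝ) - 3) / 4 < (β - α).re) :
    -- the integral converges absolutely
    PosIntegrable (laplaceIntegrand A B α β γ) ∧
    -- first form
    (((shiftD A B).PosDef ∧ (1 - shiftD A B).PosDef) ∨
        ((2 : ℝ) • conjInvSqrt A B - 1).PosDef →
      Summable (hypTerm (((p : ℂ) + 1) / 4 + β - α) (((p : ℂ) + 1) / 4 + γ + β)
          (((p : ℂ) + 1) / 2 + γ - α) (1 - shiftD A B)) ∧
      posInt (laplaceIntegrand A B α β γ) =
        detPow B (β + ((p : ℂ) + 1) / 4) *
        detPow (A + (1 / 2 : ℝ) • B) (-(γ + β + ((p : ℂ) + 1) / 4)) *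
        (gammaP p (γ + β + ((p : ℂ) + 1) / 4) * gammaP p (γ - β + ((p : ℂ) + 1) / 4) /
          gammaP p (γ - α + ((p : ℂ) + 1) / 2)) *
        hyp2F1 (((p : ℂ) + 1) / 4 + β - α) (((p : ℂ) + 1) / 4 + γ + β)
          (((p : ℂ) + 1) / 2 + γ - α) (1 - shiftD A B)) ∧
    -- second form
    (specNorm (shiftC A B) < 1 →
      Summable (hypTerm (((p : ℂ) + 1) / 4 + γ - β) (((p : ℂ) + 1) / 4 + γ + β)
          (((p : ℂ) + 1) / 2 + γ - α) (-shiftC A B)) ∧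
      posInt (laplaceIntegrand A B α β γ) =
        detPow B (-γ) *
        (gammaP p (((p : ℂ) + 1) / 4 + γ + β) * gammaP p (((p : ℂ) + 1) / 4 + γ - β) /
          gammaP p (((p : ℂ) + 1) / 2 + γ - α)) *
        hyp2F1 (((p : ℂ) + 1) / 4 + γ - β) (((p : ℂ) + 1) / 4 + γ + β)
          (((p : ℂ) + 1) / 2 + γ - α) (-shiftC A B)) ∧
    -- a sufficient condition for the second form
    (((shiftC A B).PosDef ∧ (1 - shiftC A B).PosDef) ∨
        ((-shiftC A B).PosDef ∧ (1 + shiftC A B).PosDef) →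
      specNorm (shiftC A B) < 1) := by
  have hp' : (1 : ℝ) ≤ p := by exact_mod_cast hp
  have hq : (((p : ℂ) + 1) / 4).re = ((p : ℝ) + 1) / 4 := by
    rw [← Complex.ofReal_natCast, ← Complex.ofReal_one, ← Complex.ofReal_add]
    exact_mod_cast Complex.ofReal_re (((p : ℝ) + 1) / 4)
  have hh : (((p : ℂ) + 1) / 2).re = ((p : ℝ) + 1) / 2 := by
    rw [← Complex.ofReal_natCast, ← Complex.ofReal_one, ← Complex.ofReal_add]
    exact_mod_cast Complex.ofReal_re (((p : ℝ) + 1) / 2)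
  simp only [Complex.add_re, Complex.sub_re] at hadd hsub hβα
  have e1 : ((p : ℂ) + 1) / 4 + γ + β = γ + β + ((p : ℂ) + 1) / 4 := by ring
  have e2 : ((p : ℂ) + 1) / 4 + β - α = β - α + ((p : ℂ) + 1) / 4 := by ring
  have e3 : ((p : ℂ) + 1) / 2 + γ - α = γ - α + ((p : ℂ) + 1) / 2 := by ring
  have e4 : ((p : ℂ) + 1) / 4 + γ - β =
      γ - α + ((p : ℂ) + 1) / 2 - (β - α + ((p : ℂ) + 1) / 4) := by ring
  have e5 : γ - β + ((p : ℂ) + 1) / 4 =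
      γ - α + ((p : ℂ) + 1) / 2 - (β - α + ((p : ℂ) + 1) / 4) := by ring
  have e6 : β + ((p : ℂ) + 1) / 4 = -γ + (γ + β + ((p : ℂ) + 1) / 4) := by ring
  rw [posIntegrable_iff, posInt_eq, integral_laplaceIntegrand hB]
  have hb : ((p : ℝ) - 1) / 2 < (γ + β + ((p : ℂ) + 1) / 4).re := by
    simp only [Complex.add_re, hq]
    linarith
  have hμ : ((p : ℝ) - 1) / 2 < (β - α + ((p : ℂ) + 1) / 4).re := by
    simp only [Complex.add_re, Complex.sub_re, hq]
    linarith
  -- Adding the bounds on `γ - β` and `β - α` gives `Re c > p - 1`, which suffices since `p ≥ 1`.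
  have hc : ((p : ℝ) - 1) / 2 < (γ - α + ((p : ℂ) + 1) / 2).re := by
    simp only [Complex.add_re, Complex.sub_re, hh]
    linarith
  have hcμ : ((p : ℝ) - 1) / 2 <
      (γ - α + ((p : ℂ) + 1) / 2 - (β - α + ((p : ℂ) + 1) / 4)).re := by
    rw [← e5]
    simp only [Complex.add_re, Complex.sub_re, hq]
    linarith
  rw [e1, e2, e3, e4, e5, integrable_laplaceIntegrand_iff hB α β γ (gammaP_ne_zero hμ), e6]
  clear e1 e2 e3 e4 e5 e6 hq hh
  generalize γ + β + ((p : ℂ) + 1) / 4 = b at *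
  generalize β - α + ((p : ℂ) + 1) / 4 = μ at *
  generalize γ - α + ((p : ℂ) + 1) / 2 = c at *
  have hD := posDef_one_add_shiftC hA hB
  have hgb := gammaP_ne_zero hb
  have hgμ := gammaP_ne_zero hμ
  have hgcμ := gammaP_ne_zero hcμ
  have hgc := gammaP_ne_zero hc
  refine ⟨?_, fun h => ?_, fun h => ?_, fun h => ?_⟩
  · obtain ⟨δ, hδ, hδ1, hDδ⟩ := hD.exists_sub_smul_one
    exact (confluentDensity_integral_zero hb hμ hcμ hc hδ hδ1 hDδ).1
  · have hS : (shiftD A B).PosDef := by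
      rw [← inv_one_add_shiftC hB]
      exact hD.inv
    have hS1 : (1 - shiftD A B).PosDef := by
      rcases h with h | h
      · exact h.2
      -- The second alternative says `2C > 0`.
      · have hC : (shiftC A B).PosDef := by
          have := h.smul (show (0 : ℝ) < 1 / 2 by norm_num)
          rwa [smul_sub, smul_smul, show (1 / 2 : ℝ) * 2 = 1 by norm_num, one_smul] at this
        rw [← inv_one_add_shiftC hB]
        exact posDef_one_sub_inv hC
    have hn : specNorm (1 - shiftD A B) < 1 :=
      specNorm_lt_one (Matrix.isSymm_one.sub (isSymm_shiftD hA hB)) (by rwa [sub_sub_cancel])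
        (Matrix.PosDef.one.add hS1)
    -- The expansion is used with `c - μ` in the role of `μ` and `N = I - D⁻¹`, as required after
    -- inversion.
    have hs := hasSum_hypTerm hb hcμ (by rwa [sub_sub_cancel]) hc
      (Matrix.isSymm_one.sub (isSymm_shiftD hA hB)) hn
    rw [sub_sub_cancel, sub_sub_cancel] at hs
    refine ⟨hs.summable, ?_⟩
    have hdet : detPow (A + (1 / 2 : ℝ) • B) (-b) = detPow (1 + shiftC A B) (-b) * detPow B (-b) := by
      rw [← detPow_mul hD.det_pos.le hB.det_pos.le, detPow, detPow, det_one_add_shiftC_mul hB]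
    have hBB : detPow B b * detPow B (-b) = 1 := by
      rw [← detPow_add hB, add_neg_cancel, detPow_zero]
    rw [hyp2F1, hs.tsum_eq, integral_confluentDensity_inv hb hμ hcμ hc hD, inv_one_add_shiftC hB,
      hdet, detPow_add hB]
    field_simp
    linear_combination (-(detPow B (-γ) * detPow (1 + shiftC A B) (-b) *
      ∫ Z, confluentDensity b (c - μ) (b - c) (shiftD A B) Z ∂posMeasure p)) * hBB
  · have hs := hasSum_hypTerm hb hμ hcμ hc (isSymm_shiftC hA hB).neg
      (by rwa [specNorm_neg])
    rw [sub_neg_eq_add] at hs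
    refine ⟨hs.summable, ?_⟩
    rw [hyp2F1, hs.tsum_eq]
    field_simp
  -- `I + C` is congruent to `A + B/2`, hence positive; the other bound `I - C > 0` is given in the
  -- first case and follows from `-C > 0` in the second.
  · rcases h with h | h
    · exact specNorm_lt_one (isSymm_shiftC hA hB) h.2 hD
    · rw [← specNorm_neg]
      exact specNorm_lt_one (isSymm_shiftC hA hB).neg (by rwa [sub_neg_eq_add])
        (Matrix.PosDef.one.add h.1)
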